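/- Consider a word RAM with word length $w \ge 1$ that has a read-only input memory, a constant number of registers and a read-write working memory of words (organized in a constant number of arrays, with arbitrary initial content), and on which addition, subtraction, multiplication, modulo, bit shifts, bitwise AND and OR (all on $w$-bit words), comparisons and memory accesses take one step each. The input is a rooted tree $T$ with node set $\{0,\dots,n-1\}$, given by its root and by an adjacency array in which the neighbors of each node are listed in arbitrary order, one number per word; if $N$ is the size of this input in bits, then $w \ge \log_2 N$. The height of a node $u$ is the number of edges of a longest path from $u$ to a leaf that is a descendant of $u$. A choice dictionary stores a subset $S$ of the universe $\{0,\dots,n-1\}$ and supports, in $O(1)$ time each, the operations add, remove and contains, the operation choice, which returns an arbitrary element of $S$ (and the value $n$ if $S=\emptyset$), and the (re-)initialization with $S=\emptyset$. There are fixed programs, independent of $T$ and $w$, that realize an iteration over all nodes of $T$ in order of their height through the following methods. - $\mathrm{init}(T)$ initializes the iterator and sets $h=0$. - $\mathrm{hasNext}$ returns true exactly if there are nodes of height $h$. - $\mathrm{next}$, which may be called if there are nodes of height $h$, returns a choice dictionary that contains exactly the nodes of height $h$, and increments $h$ by $1$. The returned choice dictionary may be used and modified through its operations until $\mathrm{next}$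 is called again; this does not affect the iteration. The iteration runs in linear time: $\mathrm{init}(T)$ takes $O(n)$ time, all calls of $\mathrm{next}$ together take $O(n)$ time, and every call of $\mathrm{hasNext}$ and of a dictionary operation takes $O(1)$ time. The whole working memory, registers and returned dictionary included, consists of $O(n)$ bits plus $O(1)$ words, i.e. of $O(n+w)$ bits, which is $O(n)$ bits if $w=O(n)$. All constants are absolute. -/

import Mathlib

/-! ### Word RAM

A word RAM with word length `w`. The machine has a read-only input memory, a constant number `r` of
registers, and a working memory that consists of a constant number `k` of arrays ("banks") of words.
Programs are uniform: they do not depend on `w`. -/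

namespace WordRAM

/-- Operands: a register, a literal (taken modulo `2 ^ w`), or the word length `w`. -/
inductive Operand (r : ℕ) : Type
  | reg (i : Fin r)
  | lit (m : ℕ)
  | width

/-- The binary word operations. -/
inductive BinOp : Type
  | add | sub | mul | mod | shl | shr | and | or

/-- The comparisons available in tests. -/
inductive Cmp : Type
  | eq | lt

/-- Programs over `r` registers and `k` memory banks. -/
inductive Prog (r k : ℕ) : Type
  | skip
  /-- `dst := a ∘ b` for a word operation `∘`. -/
  | op (dst : Fin r) (o : BinOp) (a b : Operand r)
  /-- `dst := mem[bank][addr]`. -/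
  | load (dst : Fin r) (bank : Fin k) (addr : Operand r)
  /-- `mem[bank][addr] := val`. -/
  | store (bank : Fin k) (addr val : Operand r)
  /-- `dst := input[addr]`. -/
  | read (dst : Fin r) (addr : Operand r)
  | seq (p q : Prog r k)
  | ite (c : Cmp) (a b : Operand r) (p q : Prog r k)
  | while (c : Cmp) (a b : Operand r) (p : Prog r k)

/-- Content of the registers and of the working memory. -/
structure State (r k w : ℕ) : Type where
  regs : Fin r → BitVec w
  mem : Fin k → BitVec w → BitVec w

variable {r k w : ℕ}

def State.setReg (σ : State r k w) (i : Fin r) (x : BitVec w) : State r k w :=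
  { σ with regs := Function.update σ.regs i x }

def State.setMem (σ : State r k w) (b : Fin k) (a x : BitVec w) : State r k w :=
  { σ with mem := Function.update σ.mem b (Function.update (σ.mem b) a x) }

def Operand.eval (σ : State r k w) : Operand r → BitVec w
  | .reg i => σ.regs i
  | .lit m => BitVec.ofNat w m
  | .width => BitVec.ofNat w w

def BinOp.eval : BinOp → BitVec w → BitVec w → BitVec w
  | .add, x, y => x + y
  | .sub, x, y => x - y
  | .mul, x, y => x * y
  | .mod, x, y => x % y
  | .shl, x, y => x <<< y
  | .shr, x, y => x >>> y
  | .and, x, y => x &&& y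
  | .or, x, y => x ||| y

/-- The outcome of a comparison of words, read as unsigned numbers. -/
def Cmp.Holds : Cmp → BitVec w → BitVec w → Prop
  | .eq, x, y => x = y
  | .lt, x, y => x.toNat < y.toNat

/-- `Exec inp B p σ σ' t`: with input memory `inp` and started in the state `σ`, the program `p` halts
in the state `σ'` after `t` steps, and it accesses only the first `B` words of every memory bank.
Every operation, memory access and test takes one step. A program that accesses a word outside of
the input memory or of the first `B` words of a bank gets stuck. -/
inductive Exec (inp : List (BitVec w)) (B : ℕ) :
    Prog r k → State r k w → State r k w → ℕ → Prop
  | skip (σ : State r k w) : Exec inp B .skip σ σ 1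
  | op (σ : State r k w) (dst : Fin r) (o : BinOp) (a b : Operand r) :
      Exec inp B (.op dst o a b) σ (σ.setReg dst (o.eval (a.eval σ) (b.eval σ))) 1
  | load (σ : State r k w) (dst : Fin r) (bank : Fin k) (addr : Operand r)
      (h : (addr.eval σ).toNat < B) :
      Exec inp B (.load dst bank addr) σ (σ.setReg dst (σ.mem bank (addr.eval σ))) 1
  | store (σ : State r k w) (bank : Fin k) (addr val : Operand r)
      (h : (addr.eval σ).toNat < B) :
      Exec inp B (.store bank addr val) σ (σ.setMem bank (addr.eval σ) (val.eval σ)) 1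
  | read (σ : State r k w) (dst : Fin r) (addr : Operand r) (x : BitVec w)
      (h : inp[(addr.eval σ).toNat]? = some x) :
      Exec inp B (.read dst addr) σ (σ.setReg dst x) 1
  | seq {σ σ₁ σ₂ : State r k w} {p q : Prog r k} {t₁ t₂ : ℕ}
      (h₁ : Exec inp B p σ σ₁ t₁) (h₂ : Exec inp B q σ₁ σ₂ t₂) :
      Exec inp B (.seq p q) σ σ₂ (t₁ + t₂)
  | ite_true {σ σ' : State r k w} {c : Cmp} {a b : Operand r} {p q : Prog r k} {t : ℕ}
      (hc : c.Holds (a.eval σ) (b.eval σ)) (h : Exec inp B p σ σ' t) :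
      Exec inp B (.ite c a b p q) σ σ' (t + 1)
  | ite_false {σ σ' : State r k w} {c : Cmp} {a b : Operand r} {p q : Prog r k} {t : ℕ}
      (hc : ¬ c.Holds (a.eval σ) (b.eval σ)) (h : Exec inp B q σ σ' t) :
      Exec inp B (.ite c a b p q) σ σ' (t + 1)
  | while_true {σ σ₁ σ₂ : State r k w} {c : Cmp} {a b : Operand r} {p : Prog r k} {t₁ t₂ : ℕ}
      (hc : c.Holds (a.eval σ) (b.eval σ)) (h₁ : Exec inp B p σ σ₁ t₁)
      (h₂ : Exec inp B (.while c a b p) σ₁ σ₂ t₂) :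
      Exec inp B (.while c a b p) σ σ₂ (t₁ + t₂ + 1)
  | while_false {σ : State r k w} {c : Cmp} {a b : Operand r} {p : Prog r k}
      (hc : ¬ c.Holds (a.eval σ) (b.eval σ)) :
      Exec inp B (.while c a b p) σ σ 1

end WordRAM

/-! ### Rooted trees -/

namespace RootedTree

variable {n : ℕ}

/-- `v` is a descendant of `u` (possibly `u` itself) in the tree `G` rooted at `root`: the path from
the root to `v` visits `u`. -/
def IsDesc (G : SimpleGraph (Fin n)) (root u v : Fin n) : Prop :=
  ∃ p : G.Walk root v, p.IsPath ∧ u ∈ p.support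

/-- A leaf has no descendants other than itself. -/
def IsLeaf (G : SimpleGraph (Fin n)) (root v : Fin n) : Prop :=
  ∀ x, IsDesc G root v x → x = v

open Classical in
/-- The height of `u`: the number of edges of a longest path from `u` down to a descendant leaf. -/
noncomputable def height (G : SimpleGraph (Fin n)) (root u : Fin n) : ℕ :=
  (Finset.univ.filter fun v => IsDesc G root u v ∧ IsLeaf G root v).sup fun v => G.dist u v

/-- `adj` lists the neighbors of every node of `G`, in an arbitrary order and without repetition. -/
def IsAdjacencyList (G : SimpleGraph (Fin n)) (adj : Fin n → List (Fin n)) : Prop :=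
  ∀ u, (adj u).Nodup ∧ ∀ v, v ∈ adj u ↔ G.Adj u v

/-- The adjacency array representation of a rooted tree: the number of nodes, the root, for every
`i ≤ n` the sum of the degrees of the nodes less than `i` (this is where the neighbors of node `i`
start in the last block), and finally the concatenation of the lists of neighbors. -/
def encode (root : Fin n) (adj : Fin n → List (Fin n)) : List ℕ :=
  [n, (root : ℕ)]
    ++ (List.range (n + 1)).map
        (fun i => (((List.finRange n).take i).map fun v => (adj v).length).sum)
    ++ (List.finRange n).flatMap (fun v => (adj v).map fun u => (u : ℕ))

/-- The input memory: one number of the representation per word. -/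
def inputWords (w : ℕ) (root : Fin n) (adj : Fin n → List (Fin n)) : List (BitVec w) :=
  (encode root adj).map (BitVec.ofNat w)

end RootedTree

/-! ### Iterators that return choice dictionaries -/

namespace HeightIterator

open WordRAM

/-- The calls that a client can make after the iterator has been initialized: the two methods of the
iterator, and the operations of the choice dictionary that the latest call of `next` has returned.
The call `clear` initializes that dictionary anew, as the empty subset of `{0, …, n - 1}`. -/
inductive Call (n : ℕ) : Type
  | hasNext
  | next
  | add (v : Fin n)
  | remove (v : Fin n)
  | contains (v : Fin n)
  | choice
  | clear
  deriving DecidableEq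

/-- What a client knows: the current height `h` of the iterator (that is, the number of calls of
`next` so far) and the set that is stored in the current choice dictionary. -/
structure View (n : ℕ) : Type where
  h : ℕ
  S : Finset (Fin n)

section Spec

variable {n : ℕ}

open Classical in
/-- The nodes of height `h`. -/
noncomputable def level (G : SimpleGraph (Fin n)) (root : Fin n) (h : ℕ) : Finset (Fin n) :=
  Finset.univ.filter fun v => RootedTree.height G root v = h

/-- The view of the client after a call. -/
noncomputable def View.after (G : SimpleGraph (Fin n)) (root : Fin n) (a : View n) :
    Call n → View n
  | .hasNext => a
  | .next => ⟨a.h + 1, level G root a.h⟩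
  | .add v => ⟨a.h, insert v a.S⟩
  | .remove v => ⟨a.h, a.S.erase v⟩
  | .contains _ => a
  | .choice => a
  | .clear => ⟨a.h, ∅⟩

/-- Calls that are permitted: `next` only if there are nodes of the current height, the operations of
the dictionary only after a dictionary has been returned. -/
def Permitted (G : SimpleGraph (Fin n)) (root : Fin n) (a : View n) : Call n → Prop
  | .hasNext => True
  | .next => (level G root a.h).Nonempty
  | _ => 0 < a.h

/-- Finite sequences of permitted calls. -/
def AllPermitted (G : SimpleGraph (Fin n)) (root : Fin n) : View n → List (Call n) → Prop
  | _, [] => True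
  | a, c :: cs => Permitted G root a c ∧ AllPermitted G root (a.after G root c) cs

/-- The correct answers to a call. Truth values are returned as `1` and `0`. The operation `choice`
returns an arbitrary element of the stored set, and `n`, which is not an element of the universe, if
this set is empty. -/
def CorrectAnswer (G : SimpleGraph (Fin n)) (root : Fin n) {w : ℕ} (a : View n) :
    Call n → BitVec w → Prop
  | .hasNext, x => ((level G root a.h).Nonempty ∧ x = BitVec.ofNat w 1) ∨
      (¬ (level G root a.h).Nonempty ∧ x = BitVec.ofNat w 0)
  | .contains v, x => (v ∈ a.S ∧ x = BitVec.ofNat w 1) ∨ (v ∉ a.S ∧ x = BitVec.ofNat w 0)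
  | .choice, x => (∃ v ∈ a.S, x = BitVec.ofNat w (v : ℕ)) ∨ (a.S = ∅ ∧ x = BitVec.ofNat w n)
  | _, _ => True

/-- A call together with the answer it got and the number of steps it took. -/
structure Event (n w : ℕ) : Type where
  call : Call n
  answer : BitVec w
  time : ℕ

/-- All answers in a sequence of events are correct. -/
def AllCorrect (G : SimpleGraph (Fin n)) (root : Fin n) {w : ℕ} : View n → List (Event n w) → Prop
  | _, [] => True
  | a, e :: es => CorrectAnswer G root a e.call e.answer ∧
      AllCorrect G root (a.after G root e.call) es

end Spec

/-- An implementation: one program for every operation, over common registers and a common working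
memory, with a register `arg` where the client puts the argument of a call and a register `res`
where the client finds the answer. -/
structure Impl : Type where
  r : ℕ
  k : ℕ
  arg : Fin r
  res : Fin r
  init : Prog r k
  hasNext : Prog r k
  next : Prog r k
  add : Prog r k
  remove : Prog r k
  contains : Prog r k
  choice : Prog r k
  clear : Prog r k

variable {n w : ℕ}

/-- The program that serves a call. -/
def Impl.prog (I : Impl) : Call n → Prog I.r I.k
  | .hasNext => I.hasNext
  | .next => I.next
  | .add _ => I.add
  | .remove _ => I.remove
  | .contains _ => I.contains
  | .choice => I.choice
  | .clear => I.clear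

/-- The client puts the argument of a call, if there is one, into the register `arg`. -/
def Impl.pass (I : Impl) (σ : State I.r I.k w) : Call n → State I.r I.k w
  | .add v => σ.setReg I.arg (BitVec.ofNat w (v : ℕ))
  | .remove v => σ.setReg I.arg (BitVec.ofNat w (v : ℕ))
  | .contains v => σ.setReg I.arg (BitVec.ofNat w (v : ℕ))
  | _ => σ

/-- `Session I inp B σ es`: in the state `σ`, the implementation can serve the calls of `es` one after
the other, and it does so with the answers and the numbers of steps recorded in `es`. -/
inductive Session (I : Impl) (inp : List (BitVec w)) (B : ℕ) :
    State I.r I.k w → List (Event n w) → Prop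
  | nil (σ : State I.r I.k w) : Session I inp B σ []
  | cons {σ σ' : State I.r I.k w} {c : Call n} {t : ℕ} {es : List (Event n w)}
      (h : Exec inp B (I.prog c) (I.pass σ c) σ' t) (hs : Session I inp B σ' es) :
      Session I inp B σ (⟨c, σ'.regs I.res, t⟩ :: es)

end HeightIterator

/-! The iterator peels leaves. The height of a node is the supremum of the heights of its children
plus one (`height_eq_sup`). Hence, once the nodes of height less than h are deleted, the nodes of
height h are exactly the undeleted nodes all of whose children are deleted. It suffices to notice
when a node loses its last child.

Parent pointers and counters of one word per node would need n words, so both are avoided. When a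
node is deleted, its children are already gone, so the only neighbor that can still be present is
its parent, and a scan of the neighbors finds it (`searchLoop_spec`). The number of undeleted
children, minus one, is kept in binary in as many bits as the node has neighbors, at the positions
that the adjacency array assigns to the node; this makes 2n - 2 bits in total. A decrement takes
more than constant time only for the zeros that it turns into ones. Each decrement creates at most
one zero, so all of them together are linear (`decrLoop_spec`). A decrement that meets no one shows
that the last child is gone (`Counters.decrement`).

Five choice dictionaries over a universe of size at least 2n hold all of this: 0 is handed to the
client, 1 is the current level, 2 collects the next level, 3 contains the deleted nodes, 4 is the
vector of counters. A dictionary is a bit vector cut into words, together with an unordered list of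
its nonzero words and back pointers into that list (`BlockInv`); entries are trusted only if list
and pointers agree, so uninitialized memory is harmless and emptying means resetting one count. The
operation `choice` takes the first listed word, isolates its lowest one, and has to find the
position of that bit without a logarithm instruction. The word length W is a square s * s with s a
power of two, and the position is q * s + r. Both q and r are obtained by counting ones, since the
residue of a sum of powers of 2 ^ s modulo 2 ^ s - 1 counts the summands (`count_multiples`,
`count_ones`). W is at most the minimum of w and n, up to a factor of four below it, except that it
never drops under 4; so the constants are computed in time O(n), and the memory takes O(n + w) bits
(`numWords_mul_le`).

Time is treated as a budget that every statement about a program passes on. The function `potential`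
adds up credits for undeleted nodes, for zeros in the vector of counters and for nodes waiting for
the next level. Each call of `next` is paid by the decrease of the potential, other calls leave it
alone, and initially it is at most 3000 * n, so the bound for a session telescopes
(`exists_session`). -/

/-! ### Budgeted execution over natural-number views of the machine state -/

namespace WordRAM

variable {r k w : ℕ}

/-- `Runs inp B R p a b Q`: started in any state that represents `a`, the program `p` halts in a state
that represents some `a'`, and of a budget of `b` steps at least `b'` are left, where `Q a' b'`. -/
def Runs (inp : List (BitVec w)) (B : ℕ) {α : Type*} (R : State r k w → α → Prop) (p : Prog r k)
    (a : α) (b : ℕ) (Q : α → ℕ → Prop) : Prop :=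
  ∀ σ, R σ a → ∃ σ' t a' b', Exec inp B p σ σ' t ∧ R σ' a' ∧ t + b' ≤ b ∧ Q a' b'

/-- The outcome of a comparison of natural numbers. -/
def Cmp.HoldsNat : Cmp → ℕ → ℕ → Prop
  | .eq, x, y => x = y
  | .lt, x, y => x < y

section Rules

variable {inp : List (BitVec w)} {B : ℕ} {α : Type*} {R : State r k w → α → Prop}
  {p q : Prog r k} {a : α} {b : ℕ} {Q Q' : α → ℕ → Prop}

theorem Cmp.holds_iff (c : Cmp) (x y : BitVec w) : c.Holds x y ↔ c.HoldsNat x.toNat y.toNat := by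
  cases c
  · exact BitVec.toNat_inj.symm
  · exact Iff.rfl

theorem Runs.mono (h : Runs inp B R p a b Q) (hQ : ∀ a' b', Q a' b' → Q' a' b') :
    Runs inp B R p a b Q' := by
  intro σ hσ
  obtain ⟨σ', t, a', b', h1, h2, h3, h4⟩ := h σ hσ
  exact ⟨σ', t, a', b', h1, h2, h3, hQ _ _ h4⟩

theorem Runs.seq (h : Runs inp B R p a b fun a' b' => Runs inp B R q a' b' Q) :
    Runs inp B R (p.seq q) a b Q := by
  intro σ hσ
  obtain ⟨σ₁, t₁, a₁, b₁, h1, h2, h3, h4⟩ := h σ hσ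
  obtain ⟨σ₂, t₂, a₂, b₂, g1, g2, g3, g4⟩ := h4 σ₁ h2
  exact ⟨σ₂, _, a₂, b₂, .seq h1 g1, g2, by omega, g4⟩

theorem Runs.ite {c : Cmp} {x y : Operand r} {vx vy : ℕ}
    (hx : ∀ σ, R σ a → (x.eval σ).toNat = vx) (hy : ∀ σ, R σ a → (y.eval σ).toNat = vy)
    (hb : 1 ≤ b) (hp : c.HoldsNat vx vy → Runs inp B R p a (b - 1) Q)
    (hq : ¬ c.HoldsNat vx vy → Runs inp B R q a (b - 1) Q) :
    Runs inp B R (.ite c x y p q) a b Q := by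
  intro σ hσ
  have hc := c.holds_iff (x.eval σ) (y.eval σ)
  rw [hx σ hσ, hy σ hσ] at hc
  by_cases h : c.HoldsNat vx vy
  · obtain ⟨σ', t, a', b', h1, h2, h3, h4⟩ := hp h σ hσ
    exact ⟨σ', _, a', b', .ite_true (hc.2 h) h1, h2, by omega, h4⟩
  · obtain ⟨σ', t, a', b', h1, h2, h3, h4⟩ := hq h σ hσ
    exact ⟨σ', _, a', b', .ite_false (fun h' => h (hc.1 h')) h1, h2, by omega, h4⟩

/-- A single unfolding: the body has to establish the statement about the loop itself. Invariant and
measure are therefore chosen at each loop, which is proved by an explicit induction. -/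
theorem Runs.whileLoop {c : Cmp} {x y : Operand r} {vx vy : ℕ}
    (hx : ∀ σ, R σ a → (x.eval σ).toNat = vx) (hy : ∀ σ, R σ a → (y.eval σ).toNat = vy)
    (hb : 1 ≤ b)
    (hp : c.HoldsNat vx vy →
      Runs inp B R p a (b - 1) fun a' b' => Runs inp B R (.while c x y p) a' b' Q)
    (hq : ¬ c.HoldsNat vx vy → Q a (b - 1)) :
    Runs inp B R (.while c x y p) a b Q := by
  intro σ hσ
  have hc := c.holds_iff (x.eval σ) (y.eval σ)
  rw [hx σ hσ, hy σ hσ] at hc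
  by_cases h : c.HoldsNat vx vy
  · obtain ⟨σ₁, t₁, a₁, b₁, h1, h2, h3, h4⟩ := hp h σ hσ
    obtain ⟨σ₂, t₂, a₂, b₂, g1, g2, g3, g4⟩ := h4 σ₁ h2
    exact ⟨σ₂, _, a₂, b₂, .while_true (hc.2 h) h1 g1, g2, by omega, g4⟩
  · exact ⟨σ, 1, a, b - 1, .while_false (fun h' => h (hc.1 h')), hσ, by omega, hq h⟩

end Rules

/-! #### Natural-number states -/

/-- A machine state with numbers in place of words. -/
structure NatState (r k : ℕ) : Type where
  reg : Fin r → ℕ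
  mem : Fin k → ℕ → ℕ

namespace NatState

def setReg (ν : NatState r k) (i : Fin r) (x : ℕ) : NatState r k :=
  { ν with reg := Function.update ν.reg i x }

def setMem (ν : NatState r k) (b : Fin k) (a x : ℕ) : NatState r k :=
  { ν with mem := Function.update ν.mem b (Function.update (ν.mem b) a x) }

@[simp] theorem setReg_mem (ν : NatState r k) (i : Fin r) (x : ℕ) : (ν.setReg i x).mem = ν.mem := rfl

@[simp] theorem setMem_reg (ν : NatState r k) (b : Fin k) (a x : ℕ) :
    (ν.setMem b a x).reg = ν.reg := rfl

@[simp] theorem setReg_reg_self (ν : NatState r k) (i : Fin r) (x : ℕ) :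
    (ν.setReg i x).reg i = x := by simp [setReg]

@[simp] theorem setReg_reg_of_ne (ν : NatState r k) {i j : Fin r} (h : j ≠ i) (x : ℕ) :
    (ν.setReg i x).reg j = ν.reg j := by simp [setReg, h]

@[simp] theorem setMem_mem_self (ν : NatState r k) (b : Fin k) (a x : ℕ) :
    (ν.setMem b a x).mem b = Function.update (ν.mem b) a x := by simp [setMem]

@[simp] theorem setMem_mem_of_ne (ν : NatState r k) {b b' : Fin k} (h : b' ≠ b) (a x : ℕ) :
    (ν.setMem b a x).mem b' = ν.mem b' := by simp [setMem, h]

end NatState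

/-- The words of `σ` have the values recorded in `ν`. -/
structure Represents (σ : State r k w) (ν : NatState r k) : Prop where
  reg : ∀ i, (σ.regs i).toNat = ν.reg i
  mem : ∀ b a, (σ.mem b a).toNat = ν.mem b a.toNat

def Operand.val (w : ℕ) (ν : NatState r k) : Operand r → ℕ
  | .reg i => ν.reg i
  | .lit m => m
  | .width => w

/-- The literals fit into a word. -/
def Operand.Fits (w : ℕ) : Operand r → Prop
  | .lit m => m < 2 ^ w
  | _ => True

def BinOp.val : BinOp → ℕ → ℕ → ℕ
  | .add, x, y => x + y
  | .sub, x, y => x - y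
  | .mul, x, y => x * y
  | .mod, x, y => x % y
  | .shl, x, y => x * 2 ^ y
  | .shr, x, y => x / 2 ^ y
  | .and, x, y => x &&& y
  | .or, x, y => x ||| y

/-- The operation neither overflows nor underflows. -/
def BinOp.Fits (w : ℕ) : BinOp → ℕ → ℕ → Prop
  | .add, x, y => x + y < 2 ^ w
  | .sub, x, y => y ≤ x
  | .mul, x, y => x * y < 2 ^ w
  | .shl, x, y => x * 2 ^ y < 2 ^ w
  | _, _, _ => True

theorem Represents.eval {σ : State r k w} {ν : NatState r k} (h : Represents σ ν) {o : Operand r}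
    (ho : o.Fits w) : (o.eval σ).toNat = o.val w ν := by
  cases o with
  | reg i => exact h.reg i
  | lit m => exact (BitVec.toNat_ofNat _ _).trans (Nat.mod_eq_of_lt ho)
  | width => exact (BitVec.toNat_ofNat _ _).trans (Nat.mod_eq_of_lt Nat.lt_two_pow_self)

theorem BinOp.toNat_eval (o : BinOp) {x y : BitVec w} (h : o.Fits w x.toNat y.toNat) :
    (o.eval x y).toNat = o.val x.toNat y.toNat := by
  cases o
  case sub => exact BitVec.toNat_sub_of_le h
  all_goals
    simp only [BinOp.Fits] at h
    simp [BinOp.eval, BinOp.val, Nat.shiftLeft_eq, Nat.shiftRight_eq_div_pow, Nat.mod_eq_of_lt, h]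

theorem Represents.setReg {σ : State r k w} {ν : NatState r k} (h : Represents σ ν) (i : Fin r)
    (x : BitVec w) : Represents (σ.setReg i x) (ν.setReg i x.toNat) := by
  refine ⟨fun j => ?_, h.mem⟩
  by_cases hj : j = i
  · subst hj; simp [State.setReg]
  · simp [State.setReg, hj, h.reg]

theorem Represents.setMem {σ : State r k w} {ν : NatState r k} (h : Represents σ ν) (b : Fin k)
    (a x : BitVec w) : Represents (σ.setMem b a x) (ν.setMem b a.toNat x.toNat) := by
  refine ⟨h.reg, fun b' a' => ?_⟩
  by_cases hb : b' = b
  · subst hb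
    by_cases ha : a' = a
    · subst ha; simp [State.setMem]
    · have : a'.toNat ≠ a.toNat := fun h' => ha (BitVec.toNat_inj.1 h')
      simp [State.setMem, ha, this, h.mem]
  · simp [State.setMem, hb, h.mem]

/-- The weakest precondition of a program, computed on natural-number states. -/
def wp (inp : List (BitVec w)) (B : ℕ) :
    Prog r k → NatState r k → ℕ → (NatState r k → ℕ → Prop) → Prop
  | .skip, ν, b, Q => 1 ≤ b ∧ Q ν (b - 1)
  | .op dst o x y, ν, b, Q => 1 ≤ b ∧ x.Fits w ∧ y.Fits w ∧ o.Fits w (x.val w ν) (y.val w ν) ∧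
      Q (ν.setReg dst (o.val (x.val w ν) (y.val w ν))) (b - 1)
  | .load dst bank addr, ν, b, Q => 1 ≤ b ∧ addr.Fits w ∧ addr.val w ν < B ∧
      Q (ν.setReg dst (ν.mem bank (addr.val w ν))) (b - 1)
  | .store bank addr x, ν, b, Q => 1 ≤ b ∧ addr.Fits w ∧ x.Fits w ∧ addr.val w ν < B ∧
      Q (ν.setMem bank (addr.val w ν) (x.val w ν)) (b - 1)
  | .read dst addr, ν, b, Q => 1 ≤ b ∧ addr.Fits w ∧
      ∃ x, (inp.map BitVec.toNat)[addr.val w ν]? = some x ∧ Q (ν.setReg dst x) (b - 1)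
  | .seq p q, ν, b, Q => wp inp B p ν b fun ν' b' => wp inp B q ν' b' Q
  | .ite c x y p q, ν, b, Q => 1 ≤ b ∧ x.Fits w ∧ y.Fits w ∧
      (c.HoldsNat (x.val w ν) (y.val w ν) → wp inp B p ν (b - 1) Q) ∧
      (¬ c.HoldsNat (x.val w ν) (y.val w ν) → wp inp B q ν (b - 1) Q)
  | .while c x y p, ν, b, Q => Runs inp B Represents (.while c x y p) ν b Q

/-- The conditions `Fits` exclude overflow and underflow, so words compute the same as numbers. A
loop is not computed by `wp`; its clause is the claim itself and is supplied from outside. -/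
theorem Runs.of_wp {inp : List (BitVec w)} {B : ℕ} {p : Prog r k} {ν : NatState r k} {b : ℕ}
    {Q : NatState r k → ℕ → Prop} (h : wp inp B p ν b Q) : Runs inp B Represents p ν b Q := by
  induction p generalizing ν b Q with
  | skip =>
    intro σ hσ
    exact ⟨σ, 1, ν, b - 1, .skip σ, hσ, by have := h.1; omega, h.2⟩
  | op dst o x y =>
    intro σ hσ
    obtain ⟨hb, hx, hy, ho, hQ⟩ := h
    rw [← hσ.eval hx, ← hσ.eval hy] at ho hQ
    rw [← o.toNat_eval ho] at hQ
    exact ⟨_, 1, _, b - 1, .op σ dst o x y, hσ.setReg _ _, by omega, hQ⟩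
  | load dst bank addr =>
    intro σ hσ
    obtain ⟨hb, hx, ho, hQ⟩ := h
    rw [← hσ.eval hx] at ho hQ
    rw [← hσ.mem] at hQ
    exact ⟨_, 1, _, b - 1, .load σ dst bank addr ho, hσ.setReg _ _, by omega, hQ⟩
  | store bank addr x =>
    intro σ hσ
    obtain ⟨hb, hx, hy, ho, hQ⟩ := h
    rw [← hσ.eval hx] at ho hQ
    rw [← hσ.eval hy] at hQ
    exact ⟨_, 1, _, b - 1, .store σ bank addr x ho, hσ.setMem _ _ _, by omega, hQ⟩
  | read dst addr =>
    intro σ hσ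
    obtain ⟨hb, hx, x, ho, hQ⟩ := h
    rw [← hσ.eval hx] at ho
    rw [List.getElem?_map, Option.map_eq_some_iff] at ho
    obtain ⟨y, hy, rfl⟩ := ho
    exact ⟨_, 1, _, b - 1, .read σ dst addr y hy, hσ.setReg _ _, by omega, hQ⟩
  | seq p q ihp ihq => exact Runs.seq ((ihp h).mono fun _ _ h' => ihq h')
  | ite c x y p q ihp ihq =>
    obtain ⟨hb, hx, hy, h1, h2⟩ := h
    exact Runs.ite (fun σ hσ => hσ.eval hx) (fun σ hσ => hσ.eval hy) hb
      (fun h => ihp (h1 h)) (fun h => ihq (h2 h))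
  | _ => exact h

end WordRAM


/-! ### Bit tricks -/

namespace BitTricks

/-- `∑ i < m, 2 ^ (i * s)`. -/
def comb (s : ℕ) : ℕ → ℕ
  | 0 => 0
  | m + 1 => comb s m * 2 ^ s + 1

theorem comb_lt {s : ℕ} (hs : 1 ≤ s) (m : ℕ) : comb s m < 2 ^ (m * s) := by
  induction m with
  | zero => simp [comb]
  | succ m ih =>
    have h2 : 2 ≤ 2 ^ s := by
      calc 2 = 2 ^ 1 := rfl
        _ ≤ 2 ^ s := Nat.pow_le_pow_right (by norm_num) hs
    rw [comb, Nat.succ_mul, pow_add]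
    nlinarith

/-- Since 2 ^ s is congruent to 1, every summand contributes 1: one modulo operation counts ones at
multiples of s. -/
theorem comb_modEq (s m : ℕ) : comb s m ≡ m [MOD 2 ^ s - 1] := by
  induction m with
  | zero => rfl
  | succ m ih =>
    have h : 2 ^ s ≡ 1 [MOD 2 ^ s - 1] :=
      ((Nat.modEq_iff_dvd' Nat.one_le_two_pow).2 dvd_rfl).symm
    simpa [comb] using (ih.mul h).add_right 1

theorem comb_mod_of_lt {s m : ℕ} (h : m < 2 ^ s - 1) : comb s m % (2 ^ s - 1) = m :=
  Eq.trans (comb_modEq s m) (Nat.mod_eq_of_lt h)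

theorem mul_comb_lt {s y : ℕ} (hy : y < 2 ^ s) (m : ℕ) : y * comb s m < 2 ^ (m * s) := by
  induction m with
  | zero => simp [comb]
  | succ m ih =>
    rw [comb, Nat.succ_mul, pow_add]
    nlinarith

/-- Because y has at most s bits, the product consists of m copies of y side by side, without
carries. -/
theorem testBit_mul_comb {s y : ℕ} (hs : 1 ≤ s) (hy : y < 2 ^ s) (m p : ℕ) :
    (y * comb s m).testBit p = (decide (p / s < m) && y.testBit (p % s)) := by
  induction m generalizing p with
  | zero => simp [comb]
  | succ m ih =>
    have : y * comb s (m + 1) = 2 ^ s * (y * comb s m) + y := by rw [comb]; ring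
    rw [this, Nat.testBit_two_pow_mul_add _ hy]
    split_ifs with h
    · simp [Nat.div_eq_of_lt h, Nat.mod_eq_of_lt h]
    · push Not at h
      rw [ih, ← Nat.mod_eq_sub_mod h, Nat.div_eq_sub_div (by omega) h]
      simp

theorem testBit_comb {s : ℕ} (hs : 1 ≤ s) (m p : ℕ) :
    (comb s m).testBit p = (decide (p / s < m) && decide (p % s = 0)) := by
  have := testBit_mul_comb hs (y := 1) (Nat.one_lt_two_pow (by omega)) m p
  rw [one_mul] at this
  rw [this]
  cases p % s <;> simp [Nat.testBit_succ]

/-- Counting the multiples of `s` up to `j`. -/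
theorem count_multiples {s m j : ℕ} (hs : 2 ≤ s) (hm : m < 2 ^ s - 1) (hj : j < m * s) :
    ((2 ^ (j + 1) - 1) &&& comb s m) % (2 ^ s - 1) = j / s + 1 := by
  have hq : j / s < m := (Nat.div_lt_iff_lt_mul (by omega)).2 hj
  -- The mask keeps the positions up to j, hence the ones at 0, s, ..., (j / s) * s. Their number is
  -- small enough to be its own residue.
  have h : (2 ^ (j + 1) - 1) &&& comb s m = comb s (j / s + 1) := by
    refine Nat.eq_of_testBit_eq fun p => ?_
    rw [Nat.testBit_and, Nat.testBit_two_pow_sub_one, testBit_comb (by omega),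
      testBit_comb (by omega)]
    rw [Bool.eq_iff_iff]
    simp only [Bool.and_eq_true, decide_eq_true_eq]
    constructor
    · rintro ⟨h1, h2, h3⟩
      exact ⟨Nat.lt_succ_of_le (Nat.div_le_div_right (by omega)), h3⟩
    · rintro ⟨h1, h3⟩
      refine ⟨?_, by omega, h3⟩
      have h4 : p / s ≤ j / s := by omega
      have h5 := Nat.div_add_mod p s
      have h6 := Nat.div_mul_le_self j s
      have h7 : s * (p / s) ≤ j / s * s := by rw [mul_comm]; exact Nat.mul_le_mul_right _ h4
      omega
  rw [h, comb_mod_of_lt (by omega)]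

/-- Counting the ones of `2 ^ r - 1`. -/
theorem count_ones {s r : ℕ} (hs : 1 ≤ s) (hr : r < s) :
    (((2 ^ r - 1) * comb s s) &&& comb (s + 1) s) % (2 ^ (s + 1) - 1) = r := by
  have hr2 : (2 : ℕ) ^ r ≤ 2 ^ s := Nat.pow_le_pow_right (by norm_num) hr.le
  have h1 : 0 < (2 : ℕ) ^ r := by positivity
  have h : ((2 ^ r - 1) * comb s s) &&& comb (s + 1) s = comb (s + 1) r := by
    refine Nat.eq_of_testBit_eq fun p => ?_
    rw [Nat.testBit_and, testBit_mul_comb hs (by omega), testBit_comb (by omega),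
      testBit_comb (by omega), Nat.testBit_two_pow_sub_one]
    rw [Bool.eq_iff_iff]
    simp only [Bool.and_eq_true, decide_eq_true_eq]
    -- Copies of period s are sampled with period s + 1: position i * (s + 1) = i * s + i is bit i
    -- of copy i, as i < s. The samples thus show all bits of one copy, spread out so that they can
    -- be counted by a residue.
    have key : p % (s + 1) = 0 → p / (s + 1) < s →
        p / s = p / (s + 1) ∧ p % s = p / (s + 1) := by
      intro h0 h1
      have h2 := Nat.div_add_mod p (s + 1)
      set i := p / (s + 1)
      have h3 : p = i + s * i := by rw [h0] at h2; linarith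
      rw [h3]
      refine ⟨?_, ?_⟩
      · rw [Nat.add_mul_div_left _ _ (by omega), Nat.div_eq_of_lt h1, zero_add]
      · rw [Nat.add_mul_mod_self_left, Nat.mod_eq_of_lt h1]
    constructor
    · rintro ⟨⟨h2, h3⟩, h4, h5⟩
      obtain ⟨h6, h7⟩ := key h5 h4
      exact ⟨h7 ▸ h3, h5⟩
    · rintro ⟨h4, h5⟩
      obtain ⟨h6, h7⟩ := key h5 (by omega)
      exact ⟨⟨by omega, by omega⟩, by omega, h5⟩
  have h3 : s < 2 ^ s := Nat.lt_two_pow_self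
  rw [h, comb_mod_of_lt (by rw [pow_succ]; omega)]

/-- Isolating the lowest one of a number. -/
theorem exists_lowest_one {x : ℕ} (hx : x ≠ 0) :
    ∃ j, x.testBit j = true ∧ x - (x &&& (x - 1)) = 2 ^ j := by
  induction x using Nat.strong_induction_on with
  | _ x ih =>
    rcases Nat.even_or_odd' x with ⟨y, rfl | rfl⟩
    · obtain ⟨j, h1, h2⟩ := ih y (by omega) (by omega)
      refine ⟨j + 1, by simpa [Nat.testBit_succ] using h1, ?_⟩
      have h : 2 * y &&& (2 * y - 1) = 2 * (y &&& (y - 1)) := by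
        refine Nat.eq_of_testBit_eq fun p => ?_
        cases p with
        | zero => simp
        | succ p =>
          have : (2 * y - 1) / 2 = y - 1 := by omega
          rw [Nat.testBit_and, Nat.testBit_succ, Nat.testBit_succ, this, Nat.testBit_succ]
          simp
      rw [h, pow_succ]
      omega
    · refine ⟨0, by simp, ?_⟩
      have h : (2 * y + 1) &&& (2 * y + 1 - 1) = 2 * y := by
        refine Nat.eq_of_testBit_eq fun p => ?_
        cases p with
        | zero => simp
        | succ p =>
          have : (2 * y + 1) / 2 = y := by omega
          rw [Nat.testBit_and, Nat.testBit_succ, Nat.testBit_succ, this, Nat.testBit_succ]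
          simp
      rw [h]; omega

/-- The subtracted bit is set, so no borrow occurs. -/
theorem testBit_sub_two_pow {x j : ℕ} (h : x.testBit j = true) (p : ℕ) :
    (x - 2 ^ j).testBit p = (x.testBit p && decide (p ≠ j)) := by
  induction j generalizing x p with
  | zero =>
    have hx : x % 2 = 1 := by simpa using h
    cases p with
    | zero => simp; omega
    | succ p =>
      have : (x - 1) / 2 = x / 2 := by omega
      simp [Nat.testBit_succ, this]
  | succ j ih =>
    rw [Nat.testBit_succ] at h
    have h2 : 2 ^ j ≤ x / 2 := Nat.ge_two_pow_of_testBit h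
    cases p with
    | zero => rw [pow_succ]; simp; omega
    | succ p =>
      have : (x - 2 ^ (j + 1)) / 2 = x / 2 - 2 ^ j := by rw [pow_succ]; omega
      rw [Nat.testBit_succ, Nat.testBit_succ, this, ih h]
      simp

/-- Subtracting one from a number whose lowest one is at position `j`. -/
theorem testBit_pred {x j : ℕ} (h : x.testBit j = true) (hl : ∀ i < j, x.testBit i = false) (p : ℕ) :
    (x - 1).testBit p = (if p < j then true else if p = j then false else x.testBit p) := by
  induction j generalizing x p with
  | zero =>
    have hx : x % 2 = 1 := by simpa using h
    cases p with
    | zero => simp; omega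
    | succ p =>
      have : (x - 1) / 2 = x / 2 := by omega
      simp [Nat.testBit_succ, this]
  | succ j ih =>
    have h0 : x % 2 = 0 := by simpa using hl 0 (by omega)
    rw [Nat.testBit_succ] at h
    have h2 : 2 ^ j ≤ x / 2 := Nat.ge_two_pow_of_testBit h
    have h3 : 0 < 2 ^ j := by positivity
    cases p with
    | zero => simp; omega
    | succ p =>
      have : (x - 1) / 2 = x / 2 - 1 := by omega
      rw [Nat.testBit_succ, Nat.testBit_succ, this,
        ih h fun i hi => by rw [← Nat.testBit_succ]; exact hl _ (by omega)]
      simp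

end BitTricks


/-! ### Block lists with constant-time initialization -/

open Function

/-- A sequence `f` of words, of which only the first `m` may be nonzero, is stored in uninitialized
memory: `dense` lists the indices of the `c` nonzero words, `sparse` gives the positions of these
indices in the list, and `bits` the words themselves. -/
structure BlockInv (W m c : ℕ) (bits dense sparse f : ℕ → ℕ) : Prop where
  dense_lt : ∀ j < c, dense j < m
  sparse_dense : ∀ j < c, sparse (dense j) = j
  word : ∀ i, sparse i < c → dense (sparse i) = i → f i = bits i ∧ f i ≠ 0
  zero : ∀ i, ¬ (sparse i < c ∧ dense (sparse i) = i) → f i = 0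
  lt : ∀ i, f i < 2 ^ W

namespace BlockInv

variable {W m c : ℕ} {bits dense sparse f : ℕ → ℕ}

theorem listed (h : BlockInv W m c bits dense sparse f) {i : ℕ} (hi : f i ≠ 0) :
    sparse i < c ∧ dense (sparse i) = i := by
  by_contra h'; exact hi (h.zero i h')

theorem lt_of_ne_zero (h : BlockInv W m c bits dense sparse f) {i : ℕ} (hi : f i ≠ 0) : i < m := by
  obtain ⟨h1, h2⟩ := h.listed hi
  rw [← h2]; exact h.dense_lt _ h1

theorem dense_injOn (h : BlockInv W m c bits dense sparse f) :
    Set.InjOn dense (Finset.range c : Set ℕ) := by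
  intro a ha b hb hab
  rw [Finset.coe_range, Set.mem_Iio] at ha hb
  rw [← h.sparse_dense a ha, hab, h.sparse_dense b hb]

theorem count_le (h : BlockInv W m c bits dense sparse f) : c ≤ m := by
  simpa using Finset.card_le_card_of_injOn (s := Finset.range c) (t := Finset.range m) dense
    (fun j hj => by
      rw [Finset.coe_range, Set.mem_Iio] at *
      exact h.dense_lt j hj) h.dense_injOn

theorem word_dense (h : BlockInv W m c bits dense sparse f) {j : ℕ} (hj : j < c) :
    f (dense j) = bits (dense j) ∧ f (dense j) ≠ 0 := by
  have := h.sparse_dense j hj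
  exact h.word _ (by omega) (by rw [this])

/-- Pigeonhole: the listed indices are distinct, below m and different from i. There is room for one
more entry. -/
theorem count_lt (h : BlockInv W m c bits dense sparse f) {i : ℕ} (hi : i < m) (hf : f i = 0) :
    c < m := by
  have := Finset.card_le_card_of_injOn (s := Finset.range c) (t := (Finset.range m).erase i) dense
    (fun j hj => by
      rw [Finset.coe_range, Set.mem_Iio] at hj
      rw [Finset.coe_erase, Finset.coe_range]
      refine ⟨h.dense_lt j hj, ?_⟩
      rintro rfl
      exact (h.word_dense hj).2 hf) h.dense_injOn
  rw [Finset.card_erase_of_mem (by simpa using hi), Finset.card_range, Finset.card_range] at this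
  omega

/-- With count 0 nothing is trusted, whatever the memory contains. This is the constant-time
initialization. -/
theorem clear (W m : ℕ) (bits dense sparse : ℕ → ℕ) :
    BlockInv W m 0 bits dense sparse fun _ => 0 :=
  ⟨by simp, by simp, by simp, by simp, by simp⟩

theorem set_listed (h : BlockInv W m c bits dense sparse f) {i y : ℕ} (hi : f i ≠ 0) (hy : y ≠ 0)
    (hlt : y < 2 ^ W) : BlockInv W m c (update bits i y) dense sparse (update f i y) := by
  refine ⟨h.dense_lt, h.sparse_dense, fun a ha hd => ?_, fun a ha => ?_, fun a => ?_⟩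
  · by_cases h' : a = i
    · subst h'; simpa using hy
    · simpa [h'] using h.word a ha hd
  · have h' : a ≠ i := by rintro rfl; exact hi (h.zero _ ha)
    simpa [h'] using h.zero a ha
  · by_cases h' : a = i
    · subst h'; simpa using hlt
    · simpa [h'] using h.lt a

theorem set_unlisted (h : BlockInv W m c bits dense sparse f) {i y : ℕ} (him : i < m) (hi : f i = 0)
    (hy : y ≠ 0) (hlt : y < 2 ^ W) :
    BlockInv W m (c + 1) (update bits i y) (update dense c i) (update sparse i c)
      (update f i y) := by
  have hne : ∀ j < c, dense j ≠ i := by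
    rintro j hj rfl
    exact (h.word_dense hj).2 hi
  refine ⟨fun j hj => ?_, fun j hj => ?_, fun a ha hd => ?_, fun a ha => ?_, fun a => ?_⟩
  · by_cases h' : j = c
    · subst h'; simpa using him
    · simpa [h'] using h.dense_lt j (by omega)
  · by_cases h' : j = c
    · subst h'; simp
    · simpa [h', hne j (by omega)] using h.sparse_dense j (by omega)
  · by_cases h' : a = i
    · subst h'; simpa using hy
    · simp only [update_of_ne h'] at ha hd ⊢
      by_cases hc : sparse a = c
      · rw [hc, update_self] at hd; exact absurd hd.symm h'
      · rw [update_of_ne hc] at hd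
        exact h.word a (by omega) hd
  · by_cases h' : a = i
    · subst h'; simp at ha
    · simp only [update_of_ne h'] at ha ⊢
      refine h.zero a fun ⟨h1, h2⟩ => ha ⟨by omega, ?_⟩
      rw [update_of_ne (by omega), h2]
  · by_cases h' : a = i
    · subst h'; simpa using hlt
    · simpa [h'] using h.lt a

/-- The last entry of the list moves into the slot of i. If i is itself the last entry, the two
updates change nothing and the smaller count alone removes it. The word y left behind is arbitrary,
since it is no longer read. -/
theorem erase_listed (h : BlockInv W m c bits dense sparse f) {i y : ℕ} (hi : f i ≠ 0) :
    BlockInv W m (c - 1) (update bits i y) (update dense (sparse i) (dense (c - 1)))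
      (update sparse (dense (c - 1)) (sparse i)) (update f i 0) := by
  obtain ⟨h1, h2⟩ := h.listed hi
  have hl : sparse (dense (c - 1)) = c - 1 := h.sparse_dense _ (by omega)
  refine ⟨fun j hj => ?_, fun j hj => ?_, fun a ha hd => ?_, fun a ha => ?_, fun a => ?_⟩
  · by_cases h' : j = sparse i
    · subst h'; simpa using h.dense_lt _ (by omega)
    · simpa [h'] using h.dense_lt j (by omega)
  · by_cases h' : j = sparse i
    · subst h'; simp
    · have hs := h.sparse_dense j (by omega)
      have : dense j ≠ dense (c - 1) := fun e => by rw [e] at hs; omega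
      simpa [h', this] using hs
  · by_cases h' : a = dense (c - 1)
    · subst h'
      simp only [update_self] at ha hd
      have : dense (c - 1) ≠ i := fun e => by rw [e] at hl; omega
      have h3 := h.word_dense (j := c - 1) (by omega)
      simpa [this] using h3
    · rw [update_of_ne h'] at ha hd
      by_cases hc : sparse a = sparse i
      · rw [hc, update_self] at hd; exact absurd hd.symm h'
      · rw [update_of_ne hc] at hd
        have : a ≠ i := by rintro rfl; exact hc rfl
        simpa [this] using h.word a (by omega) hd
  · by_cases h3 : a = i
    · subst h3; simp
    rw [update_of_ne h3]
    by_contra h4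
    obtain ⟨h5, h6⟩ := h.listed h4
    apply ha
    have hne : sparse a ≠ sparse i := fun e => h3 (by rw [← h6, e, h2])
    by_cases h' : a = dense (c - 1)
    · subst h'
      rw [update_self, update_self]
      exact ⟨by omega, rfl⟩
    · rw [update_of_ne h', update_of_ne hne]
      refine ⟨?_, h6⟩
      by_contra h7
      have : sparse a = c - 1 := by omega
      rw [this] at h6
      exact h' h6.symm
  · by_cases h' : a = i
    · subst h'; simp
    · simpa [h'] using h.lt a

end BlockInv

/-- The sequence `f` of words of length `W`, read as a set. -/
def IsBlockSet (W : ℕ) (f : ℕ → ℕ) (S : Finset ℕ) : Prop :=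
  ∀ v, v ∈ S ↔ (f (v / W)).testBit (v % W) = true

namespace IsBlockSet

variable {W : ℕ} {f : ℕ → ℕ} {S : Finset ℕ}

theorem eq_of_div_mod {a b : ℕ} (h1 : a / W = b / W) (h2 : a % W = b % W) : a = b := by
  rw [← Nat.div_add_mod a W, h1, h2, Nat.div_add_mod]

theorem insert (h : IsBlockSet W f S) (v : ℕ) :
    IsBlockSet W (update f (v / W) (f (v / W) ||| 2 ^ (v % W))) (insert v S) := by
  intro u
  rw [Finset.mem_insert, h u]
  by_cases h1 : u / W = v / W
  · rw [h1, update_self, Nat.testBit_or, Nat.testBit_two_pow, Bool.or_eq_true, decide_eq_true_eq,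
      or_comm]
    refine or_congr Iff.rfl ⟨fun h => by rw [h], fun h2 => eq_of_div_mod h1 h2.symm⟩
  · have : u ≠ v := by rintro rfl; exact h1 rfl
    simp [h1, this]

theorem erase (h : IsBlockSet W f S) {v : ℕ} (hv : v ∈ S) :
    IsBlockSet W (update f (v / W) (f (v / W) - 2 ^ (v % W))) (S.erase v) := by
  intro u
  rw [Finset.mem_erase, h u]
  by_cases h1 : u / W = v / W
  · rw [h1, update_self, BitTricks.testBit_sub_two_pow ((h v).1 hv), Bool.and_eq_true,
      decide_eq_true_eq, and_comm]
    refine and_congr Iff.rfl ⟨fun h2 h3 => h2 (eq_of_div_mod h1 h3), fun h2 h3 => h2 (by rw [h3])⟩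
  · have : u ≠ v := by rintro rfl; exact h1 rfl
    simp [h1, this]

end IsBlockSet


/-! ### A machine with choice dictionaries -/

namespace DictMachine

open WordRAM

infixr:60 " ;; " => WordRAM.Prog.seq

/-- The registers visible to programs that use the dictionaries. -/
def up (i : Fin 12) : Fin 25 := ⟨i, by omega⟩

/-- The registers used for the implementation of the dictionaries. -/
def tmp (i : Fin 13) : Fin 25 := ⟨12 + i, by omega⟩

/-- The memory banks of the dictionary `d`. -/
def bk (c : Fin 4) (d : Fin 5) : Fin 20 := ⟨4 * d + c, by omega⟩

@[simp] theorem up_inj {i j : Fin 12} : up i = up j ↔ i = j := by simp [up, Fin.ext_iff]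

@[simp] theorem tmp_inj {i j : Fin 13} : tmp i = tmp j ↔ i = j := by simp [tmp, Fin.ext_iff]

@[simp] theorem up_ne_tmp (i : Fin 12) (j : Fin 13) : up i ≠ tmp j := by
  simp [up, tmp, Fin.ext_iff]; omega

@[simp] theorem tmp_ne_up (i : Fin 12) (j : Fin 13) : tmp j ≠ up i := (up_ne_tmp i j).symm

@[simp] theorem bk_inj {c c' : Fin 4} {d d' : Fin 5} : bk c d = bk c' d' ↔ c = c' ∧ d = d' := by
  simp only [bk, Fin.ext_iff]; omega

/-- The parameters of the dictionaries: words of length `4 ^ κ`, of which there are `m` in every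
dictionary. -/
structure Params (w B : ℕ) : Type where
  κ : ℕ
  m : ℕ
  one_le : 1 ≤ κ
  W_le : 4 ^ κ ≤ w
  m_le : m ≤ B
  B_pos : 0 < B
  U_lt : m * 4 ^ κ < 2 ^ w

namespace Params

variable {w B : ℕ} (P : Params w B)

/-- The word length of the dictionaries. -/
def W : ℕ := 4 ^ P.κ

/-- The square root of the word length of the dictionaries. -/
def s : ℕ := 2 ^ P.κ

/-- The size of the universe. -/
def U : ℕ := P.m * 4 ^ P.κ

/-- Powers of two make division by W and multiplication by s into shifts, as the machine has no
division. That W is a square lets a bit position be split into two digits below s, each found by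
counting. -/
theorem s_mul_s : P.s * P.s = P.W := by
  rw [s, W, ← mul_pow]; norm_num

theorem two_le_s : 2 ≤ P.s := by
  calc 2 = 2 ^ 1 := rfl
    _ ≤ 2 ^ P.κ := Nat.pow_le_pow_right (by norm_num) P.one_le

theorem W_le_w : P.W ≤ w := P.W_le

theorem W_pos : 0 < P.W := by unfold W; positivity

theorem W_eq_two_pow : P.W = 2 ^ (2 * P.κ) := by
  rw [W, pow_mul]; norm_num

theorem four_le_w {w B : ℕ} (P : Params w B) : 4 ≤ w := by
  have := P.s_mul_s; have := P.two_le_s; have := P.W_le_w; nlinarith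

theorem two_pow_W_le : 2 ^ P.W ≤ 2 ^ w := Nat.pow_le_pow_right (by norm_num) P.W_le_w

theorem small_lt {w B : ℕ} (P : Params w B) {i : ℕ} (h : i < 16) : i < 2 ^ w :=
  h.trans_le (Nat.pow_le_pow_right (n := 2) (by norm_num) P.four_le_w)

theorem div_lt {v : ℕ} (h : v < P.U) : v / P.W < P.m :=
  (Nat.div_lt_iff_lt_mul P.W_pos).2 h

theorem lt_U {v : ℕ} (h : v / P.W < P.m) : v < P.U := (Nat.div_lt_iff_lt_mul P.W_pos).1 h

theorem U_lt_two_pow : P.U < 2 ^ w := P.U_lt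

theorem m_lt : P.m < 2 ^ w :=
  (Nat.le_mul_of_pos_right _ (by positivity)).trans_lt P.U_lt

/-- The contents of the registers with constants. -/
def const (i : Fin 7) : ℕ :=
  ![2 * P.κ, P.W, P.κ, BitTricks.comb P.s P.s, BitTricks.comb (P.s + 1) P.s, 2 ^ P.s - 1,
    2 ^ (P.s + 1) - 1] i

end Params

/-- The view of programs that use the dictionaries. -/
structure DictState : Type where
  reg : Fin 12 → ℕ
  set : Fin 5 → Finset ℕ

namespace DictState

def setReg (a : DictState) (i : Fin 12) (x : ℕ) : DictState :=
  { a with reg := Function.update a.reg i x }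

def setSet (a : DictState) (d : Fin 5) (S : Finset ℕ) : DictState :=
  { a with set := Function.update a.set d S }

@[simp] theorem setReg_set (a : DictState) (i : Fin 12) (x : ℕ) : (a.setReg i x).set = a.set := rfl

@[simp] theorem setSet_reg (a : DictState) (d : Fin 5) (S : Finset ℕ) :
    (a.setSet d S).reg = a.reg := rfl

@[simp] theorem setReg_reg_self (a : DictState) (i : Fin 12) (x : ℕ) :
    (a.setReg i x).reg i = x := by simp [setReg]

@[simp] theorem setReg_reg_of_ne (a : DictState) {i j : Fin 12} (h : j ≠ i) (x : ℕ) :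
    (a.setReg i x).reg j = a.reg j := by simp [setReg, h]

@[simp] theorem setSet_set_self (a : DictState) (d : Fin 5) (S : Finset ℕ) :
    (a.setSet d S).set d = S := by simp [setSet]

@[simp] theorem setSet_set_of_ne (a : DictState) {d d' : Fin 5} (h : d' ≠ d) (S : Finset ℕ) :
    (a.setSet d S).set d' = a.set d' := by simp [setSet, h]

end DictState

variable {w B : ℕ}

/-- The memory of `ν` represents the set `S` in the dictionary `d`. -/
def DictRep (P : Params w B) (ν : NatState 25 20) (d : Fin 5) (S : Finset ℕ) : Prop :=
  ∃ f, BlockInv P.W P.m (ν.mem (bk 3 d) 0) (ν.mem (bk 0 d)) (ν.mem (bk 1 d)) (ν.mem (bk 2 d)) f ∧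
    IsBlockSet P.W f S

/-- Of the 13 internal registers the first seven hold constants; the remaining six are unconstrained
and serve as scratch space. By `DictRep`, the banks 0 to 3 of a dictionary hold the words, the list
of nonzero words, the back pointers, and the length of the list in the first cell. -/
structure Abs (P : Params w B) (ν : NatState 25 20) (a : DictState) : Prop where
  user : ∀ i, ν.reg (up i) = a.reg i
  const : ∀ i : Fin 7, ν.reg (tmp (i.castLE (by norm_num))) = P.const i
  dict : ∀ d, DictRep P ν d (a.set d)

theorem Abs.congr {P : Params w B} {ν ν' : NatState 25 20} {a : DictState} (h : Abs P ν a)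
    (hm : ν'.mem = ν.mem) (hr : ∀ i : Fin 25, i.val < 19 → ν'.reg i = ν.reg i) : Abs P ν' a := by
  refine ⟨fun i => ?_, fun i => ?_, fun d => ?_⟩
  · rw [hr _ (by simp only [up]; omega), h.user]
  · rw [hr _ (by simp only [tmp, Fin.val_castLE]; omega), h.const]
  · unfold DictRep; rw [hm]; exact h.dict d

theorem Abs.c0 {P : Params w B} {ν : NatState 25 20} {a : DictState} (h : Abs P ν a) :
    ν.reg (tmp 0) = 2 * P.κ := h.const 0
theorem Abs.c1 {P : Params w B} {ν : NatState 25 20} {a : DictState} (h : Abs P ν a) :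
    ν.reg (tmp 1) = P.W := h.const 1
theorem Abs.c2 {P : Params w B} {ν : NatState 25 20} {a : DictState} (h : Abs P ν a) :
    ν.reg (tmp 2) = P.κ := h.const 2
theorem Abs.c3 {P : Params w B} {ν : NatState 25 20} {a : DictState} (h : Abs P ν a) :
    ν.reg (tmp 3) = BitTricks.comb P.s P.s := h.const 3
theorem Abs.c4 {P : Params w B} {ν : NatState 25 20} {a : DictState} (h : Abs P ν a) :
    ν.reg (tmp 4) = BitTricks.comb (P.s + 1) P.s := h.const 4
theorem Abs.c5 {P : Params w B} {ν : NatState 25 20} {a : DictState} (h : Abs P ν a) :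
    ν.reg (tmp 5) = 2 ^ P.s - 1 := h.const 5
theorem Abs.c6 {P : Params w B} {ν : NatState 25 20} {a : DictState} (h : Abs P ν a) :
    ν.reg (tmp 6) = 2 ^ (P.s + 1) - 1 := h.const 6

/-- Registers outside of the scratch area. -/
theorem ne_tmp {i : Fin 25} (hi : i.val < 19) {j : Fin 13} (hj : 7 ≤ j.val) : i ≠ tmp j := by
  rintro rfl; simp only [tmp] at hi; omega

/-- Looks up the word with the bit `x` in the dictionary `d`. -/
def locate (d : Fin 5) (x : Fin 12) : Prog 25 20 :=
  .op (tmp 7) .shr (.reg (up x)) (.reg (tmp 0)) ;;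
  .op (tmp 8) .mod (.reg (up x)) (.reg (tmp 1)) ;;
  .load (tmp 9) (bk 3 d) (.lit 0) ;;
  .load (tmp 10) (bk 2 d) (.reg (tmp 7)) ;;
  .op (tmp 12) .add (.lit 0) (.lit 0) ;;
  .ite .lt (.reg (tmp 10)) (.reg (tmp 9))
    (.load (tmp 11) (bk 1 d) (.reg (tmp 10)) ;;
      .ite .eq (.reg (tmp 11)) (.reg (tmp 7)) (.load (tmp 12) (bk 0 d) (.reg (tmp 7))) .skip)
    .skip

def insertProg (d : Fin 5) (x : Fin 12) : Prog 25 20 :=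
  locate d x ;;
  .ite .eq (.reg (tmp 12)) (.lit 0)
    (.store (bk 2 d) (.reg (tmp 7)) (.reg (tmp 9)) ;;
      .store (bk 1 d) (.reg (tmp 9)) (.reg (tmp 7)) ;;
      .op (tmp 9) .add (.reg (tmp 9)) (.lit 1) ;;
      .store (bk 3 d) (.lit 0) (.reg (tmp 9)))
    .skip ;;
  .op (tmp 11) .shl (.lit 1) (.reg (tmp 8)) ;;
  .op (tmp 12) .or (.reg (tmp 12)) (.reg (tmp 11)) ;;
  .store (bk 0 d) (.reg (tmp 7)) (.reg (tmp 12))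

/-- Tests whether the bit found by `locate` is set. -/
def testProg (p q : Prog 25 20) : Prog 25 20 :=
  .op (tmp 11) .shr (.reg (tmp 12)) (.reg (tmp 8)) ;;
  .op (tmp 11) .and (.reg (tmp 11)) (.lit 1) ;;
  .ite .eq (.reg (tmp 11)) (.lit 1) p q

def eraseProg (d : Fin 5) (x : Fin 12) : Prog 25 20 :=
  locate d x ;;
  testProg
    (.op (tmp 11) .shl (.lit 1) (.reg (tmp 8)) ;;
      .op (tmp 12) .sub (.reg (tmp 12)) (.reg (tmp 11)) ;;
      .store (bk 0 d) (.reg (tmp 7)) (.reg (tmp 12)) ;;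
      .ite .eq (.reg (tmp 12)) (.lit 0)
        (.op (tmp 9) .sub (.reg (tmp 9)) (.lit 1) ;;
          .store (bk 3 d) (.lit 0) (.reg (tmp 9)) ;;
          .load (tmp 11) (bk 1 d) (.reg (tmp 9)) ;;
          .store (bk 1 d) (.reg (tmp 10)) (.reg (tmp 11)) ;;
          .store (bk 2 d) (.reg (tmp 11)) (.reg (tmp 10)))
        .skip)
    .skip

def memProg (d : Fin 5) (x : Fin 12) (p q : Prog 25 20) : Prog 25 20 :=
  locate d x ;; testProg p q

def clearProg (d : Fin 5) : Prog 25 20 := .store (bk 3 d) (.lit 0) (.lit 0)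

/-- If x is the first listed word, x - (x &&& (x - 1)) is a power 2 ^ j. Masking 2 ^ (j + 1) - 1
counts j / s + 1 multiples of s; after subtracting one and shifting this gives (j / s) * s. Dividing
2 ^ j by the corresponding power leaves 2 ^ r with r = j % s, and r is counted from the ones of 2 ^
r - 1. An empty dictionary yields the content of register 0, where clients keep n. -/
def choiceProg (y : Fin 12) (d : Fin 5) : Prog 25 20 :=
  .load (tmp 9) (bk 3 d) (.lit 0) ;;
  .ite .eq (.reg (tmp 9)) (.lit 0) (.op (up y) .add (.reg (up 0)) (.lit 0))
    (.load (tmp 7) (bk 1 d) (.lit 0) ;;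
      .load (tmp 12) (bk 0 d) (.reg (tmp 7)) ;;
      .op (tmp 8) .sub (.reg (tmp 12)) (.lit 1) ;;
      .op (tmp 8) .and (.reg (tmp 12)) (.reg (tmp 8)) ;;
      .op (tmp 12) .sub (.reg (tmp 12)) (.reg (tmp 8)) ;;
      .op (tmp 8) .sub (.reg (tmp 12)) (.lit 1) ;;
      .op (tmp 8) .add (.reg (tmp 8)) (.reg (tmp 12)) ;;
      .op (tmp 8) .and (.reg (tmp 8)) (.reg (tmp 3)) ;;
      .op (tmp 8) .mod (.reg (tmp 8)) (.reg (tmp 5)) ;;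
      .op (tmp 8) .sub (.reg (tmp 8)) (.lit 1) ;;
      .op (tmp 8) .shl (.reg (tmp 8)) (.reg (tmp 2)) ;;
      .op (tmp 12) .shr (.reg (tmp 12)) (.reg (tmp 8)) ;;
      .op (tmp 12) .sub (.reg (tmp 12)) (.lit 1) ;;
      .op (tmp 12) .mul (.reg (tmp 12)) (.reg (tmp 3)) ;;
      .op (tmp 12) .and (.reg (tmp 12)) (.reg (tmp 4)) ;;
      .op (tmp 12) .mod (.reg (tmp 12)) (.reg (tmp 6)) ;;
      .op (tmp 12) .add (.reg (tmp 12)) (.reg (tmp 8)) ;;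
      .op (tmp 7) .shl (.reg (tmp 7)) (.reg (tmp 0)) ;;
      .op (up y) .add (.reg (tmp 7)) (.reg (tmp 12)))

/-! ### Correctness and cost of the dictionary operations -/

section Specs

variable {P : Params w B} {inp : List (BitVec w)} {ν : NatState 25 20} {a : DictState}

/-- A back pointer read from uninitialized memory may be anything; it is followed only if it is
below the count, which also keeps the access in bounds, and it is believed only if the list points
back. In all other cases the word is 0. The pointer itself is meaningful only for nonzero words. -/
theorem locate_spec (h : Abs P ν a) {d : Fin 5} {x : Fin 12} (hx : a.reg x < P.U) {b : ℕ}
    (hb : 10 ≤ b) {f : ℕ → ℕ}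
    (hf : BlockInv P.W P.m (ν.mem (bk 3 d) 0) (ν.mem (bk 0 d)) (ν.mem (bk 1 d)) (ν.mem (bk 2 d)) f) :
    Runs inp B Represents (locate d x) ν b fun ν' b' =>
      b ≤ b' + 10 ∧ ν'.mem = ν.mem ∧ (∀ i : Fin 25, i.val < 19 → ν'.reg i = ν.reg i) ∧
      ν'.reg (tmp 7) = a.reg x / P.W ∧ ν'.reg (tmp 8) = a.reg x % P.W ∧
      ν'.reg (tmp 9) = ν.mem (bk 3 d) 0 ∧ ν'.reg (tmp 12) = f (a.reg x / P.W) ∧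
      (f (a.reg x / P.W) ≠ 0 → ν'.reg (tmp 10) = ν.mem (bk 2 d) (a.reg x / P.W)) := by
  apply Runs.of_wp
  have hB := P.B_pos
  have h1 : a.reg x / P.W < B := (P.div_lt hx).trans_le P.m_le
  have hc : ν.mem (bk 3 d) 0 ≤ B := hf.count_le.trans P.m_le
  have hne : ∀ i : Fin 25, i.val < 19 → ∀ j : Fin 13, 7 ≤ j.val → i ≠ tmp j :=
    fun i hi j hj => ne_tmp hi hj
  simp [locate, wp, Operand.Fits, Operand.val, BinOp.Fits, BinOp.val, h.user, h.c0, h.c1, hB,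
    ← P.W_eq_two_pow, h1, Cmp.HoldsNat]
  refine ⟨by omega, by omega, by omega, by omega, by omega, by omega, fun h2 => ⟨by omega, by omega,
    by omega, fun h3 => ⟨by omega, by omega, ?_, ?_⟩, fun h3 => ⟨by omega, by omega, ?_, ?_⟩⟩,
    fun h2 => ⟨by omega, by omega, ?_, ?_⟩⟩
  · intro i hi; simp [hne i hi]
  · exact (hf.word _ h2 h3).1.symm
  · intro i hi; simp [hne i hi]
  · exact (hf.zero _ fun h => h3 h.2).symm
  · intro i hi; simp [hne i hi]
  · exact (hf.zero _ fun h => by omega).symm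

theorem Abs.setSet {ν' : NatState 25 20} (h : Abs P ν a) {d : Fin 5} {S : Finset ℕ}
    (hr : ∀ i : Fin 25, i.val < 19 → ν'.reg i = ν.reg i)
    (hm : ∀ c d', d' ≠ d → ν'.mem (bk c d') = ν.mem (bk c d')) (hd : DictRep P ν' d S) :
    Abs P ν' (a.setSet d S) := by
  refine ⟨fun i => ?_, fun i => ?_, fun d' => ?_⟩
  · rw [hr _ (by simp only [up]; omega), h.user]; rfl
  · rw [hr _ (by simp only [tmp, Fin.val_castLE]; omega), h.const]
  · by_cases hd' : d' = d
    · subst hd'; simpa using hd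
    · rw [DictState.setSet_set_of_ne _ hd']
      have := h.dict d'
      unfold DictRep at this ⊢
      simpa only [hm _ _ hd'] using this

theorem insertProg_spec (h : Abs P ν a) {d : Fin 5} {x : Fin 12} (hx : a.reg x < P.U) {b : ℕ}
    (hb : 40 ≤ b) :
    Runs inp B Represents (insertProg d x) ν b fun ν' b' =>
      b ≤ b' + 40 ∧ Abs P ν' (a.setSet d (insert (a.reg x) (a.set d))) := by
  obtain ⟨f, hf, hS⟩ := h.dict d
  refine Runs.seq ((locate_spec h hx (by omega) hf).mono ?_)
  rintro ν' b' ⟨hb', hm, hr, r7, r8, r9, r12, r10⟩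
  have hB := P.B_pos
  have him := P.div_lt hx
  have h1 : a.reg x / P.W < B := him.trans_le P.m_le
  have hmod : a.reg x % P.W < P.W := Nat.mod_lt _ P.W_pos
  have hpow : 2 ^ (a.reg x % P.W) < 2 ^ P.W := Nat.pow_lt_pow_right (by norm_num) hmod
  have hpw : 2 ^ (a.reg x % P.W) < 2 ^ w := hpow.trans_le P.two_pow_W_le
  have hS' := hS.insert (a.reg x)
  have hlt : f (a.reg x / P.W) ||| 2 ^ (a.reg x % P.W) < 2 ^ P.W := Nat.or_lt_two_pow (hf.lt _) hpow
  have hy : f (a.reg x / P.W) ||| 2 ^ (a.reg x % P.W) ≠ 0 := by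
    intro h0
    have := congrArg (fun z => z.testBit (a.reg x % P.W)) h0
    simp at this
  have o1 := P.small_lt (i := 1) (by norm_num)
  apply Runs.of_wp
  simp [wp, Operand.Fits, Operand.val, BinOp.Fits, BinOp.val, hB, Cmp.HoldsNat, r7, r8, r9, r12, h1,
    o1, hpw]
  refine ⟨by omega, fun h0 => ?_, fun h0 => ?_⟩
  -- The word was zero, so it is not listed and the list is not full: appending stays within the
  -- memory bound.
  · have hcm := hf.count_lt him h0
    have := P.m_le
    have := P.m_lt
    refine ⟨by omega, by omega, by omega, by omega, by omega, by omega, by omega, by omega,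
      by omega, by omega, ?_⟩
    refine h.setSet (fun i hi => ?_) (fun c d' hd' => ?_) ⟨_, ?_, hS'⟩
    · simp [ne_tmp hi, hr i hi]
    · simp [hd', hm]
    · rw [h0, Nat.zero_or] at hy hlt ⊢
      simpa [hm] using hf.set_unlisted him h0 hy hlt
  · refine ⟨by omega, by omega, by omega, by omega, by omega, ?_⟩
    refine h.setSet (fun i hi => ?_) (fun c d' hd' => ?_) ⟨_, ?_, hS'⟩
    · simp [ne_tmp hi, hr i hi]
    · simp [hd', hm]
    · simpa [hm] using hf.set_listed h0 hy hlt

theorem testProg_spec {p q : Prog 25 20} {ν' : NatState 25 20} {b x : ℕ} (hb : 3 ≤ b) {f : ℕ → ℕ} {S : Finset ℕ} {Q : NatState 25 20 → ℕ → Prop}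
    (hS : IsBlockSet P.W f S) (r8 : ν'.reg (tmp 8) = x % P.W) (r12 : ν'.reg (tmp 12) = f (x / P.W))
    (hp : x ∈ S → ∀ z, Runs inp B Represents p (ν'.setReg (tmp 11) z) (b - 3) Q)
    (hq : x ∉ S → ∀ z, Runs inp B Represents q (ν'.setReg (tmp 11) z) (b - 3) Q) :
    Runs inp B Represents (testProg p q) ν' b Q := by
  have o1 := P.small_lt (i := 1) (by norm_num)
  have hbit : x ∈ S ↔ (f (x / P.W) / 2 ^ (x % P.W)) &&& 1 = 1 := by
    rw [hS, Nat.and_one_is_mod, Nat.testBit_eq_decide_div_mod_eq, decide_eq_true_eq]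
  have hu : ∀ y z, (ν'.setReg (tmp 11) y).setReg (tmp 11) z = ν'.setReg (tmp 11) z := by
    intro y z; simp [NatState.setReg]
  refine Runs.seq (Runs.of_wp (p := .op _ _ _ _) ⟨by omega, trivial, trivial, trivial, ?_⟩)
  refine Runs.seq (Runs.of_wp (p := .op _ _ _ _) ⟨by omega, trivial, o1, trivial, ?_⟩)
  simp only [Operand.val, BinOp.val, r8, r12, NatState.setReg_reg_self, hu]
  refine Runs.ite (fun σ hσ => hσ.eval (o := .reg _) trivial) (fun σ hσ => hσ.eval (o := .lit 1) o1)
    (by omega) (fun h => ?_) (fun h => ?_)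
  · simp only [Cmp.HoldsNat, Operand.val, NatState.setReg_reg_self] at h
    exact hp (hbit.2 h) _
  · simp only [Cmp.HoldsNat, Operand.val, NatState.setReg_reg_self] at h
    exact hq (fun h' => h (hbit.1 h')) _

/-- The test branches instead of returning a truth value, so it is specified by what its two
continuations achieve. -/
theorem memProg_spec (h : Abs P ν a) {d : Fin 5} {x : Fin 12} (hx : a.reg x < P.U) {b : ℕ}
    (hb : 40 ≤ b) {p q : Prog 25 20} {Q : NatState 25 20 → ℕ → Prop}
    (hp : a.reg x ∈ a.set d → ∀ ν' b', Abs P ν' a → b ≤ b' + 40 →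
      Runs inp B Represents p ν' b' Q)
    (hq : a.reg x ∉ a.set d → ∀ ν' b', Abs P ν' a → b ≤ b' + 40 →
      Runs inp B Represents q ν' b' Q) :
    Runs inp B Represents (memProg d x p q) ν b Q := by
  obtain ⟨f, hf, hS⟩ := h.dict d
  refine Runs.seq ((locate_spec h hx (by omega) hf).mono ?_)
  rintro ν' b' ⟨hb', hm, hr, r7, r8, r9, r12, r10⟩
  have h' := h.congr hm hr
  have h'' : ∀ z, Abs P (ν'.setReg (tmp 11) z) a := fun z =>
    h'.congr rfl fun i hi => by simp [ne_tmp hi]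
  exact testProg_spec (by omega) hS r8 r12
    (fun hxs z => hp hxs _ _ (h'' z) (by omega)) (fun hxs z => hq hxs _ _ (h'' z) (by omega))

theorem eraseProg_spec (h : Abs P ν a) {d : Fin 5} {x : Fin 12} (hx : a.reg x < P.U) {b : ℕ}
    (hb : 40 ≤ b) :
    Runs inp B Represents (eraseProg d x) ν b fun ν' b' =>
      b ≤ b' + 40 ∧ Abs P ν' (a.setSet d ((a.set d).erase (a.reg x))) := by
  obtain ⟨f, hf, hS⟩ := h.dict d
  refine Runs.seq ((locate_spec h hx (by omega) hf).mono ?_)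
  rintro ν' b' ⟨hb', hm, hr, r7, r8, r9, r12, r10⟩
  have h' := h.congr hm hr
  refine testProg_spec (by omega) hS r8 r12 (fun hxs z => ?_) (fun hxs z => ?_)
  · have hB := P.B_pos
    have him := P.div_lt hx
    have h1 : a.reg x / P.W < B := him.trans_le P.m_le
    have hmod : a.reg x % P.W < P.W := Nat.mod_lt _ P.W_pos
    have hpow : 2 ^ (a.reg x % P.W) < 2 ^ P.W := Nat.pow_lt_pow_right (by norm_num) hmod
    have hpw : 2 ^ (a.reg x % P.W) < 2 ^ w := hpow.trans_le P.two_pow_W_le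
    have hbit := (hS _).1 hxs
    have hge : 2 ^ (a.reg x % P.W) ≤ f (a.reg x / P.W) := Nat.ge_two_pow_of_testBit hbit
    have hf0 : f (a.reg x / P.W) ≠ 0 := by
      have : 0 < 2 ^ (a.reg x % P.W) := by positivity
      omega
    have r10 := r10 hf0
    obtain ⟨l1, l2⟩ := hf.listed hf0
    have hS' := hS.erase hxs
    have hlt := hf.lt (a.reg x / P.W)
    have hcm := hf.count_le
    have := P.m_le
    have hdl := hf.dense_lt (ν.mem (bk 3 d) 0 - 1) (by omega)
    have o1 := P.small_lt (i := 1) (by norm_num)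
    apply Runs.of_wp
    simp [wp, Operand.Fits, Operand.val, BinOp.Fits, BinOp.val, hB, Cmp.HoldsNat, r7, r8, r9, r10,
      r12, h1, o1, hpw, hm, hge]
    refine ⟨by omega, by omega, by omega, by omega, fun h0 => ?_, fun h0 => ?_⟩
    · refine ⟨by omega, by omega, by omega, by omega, by omega, by omega, by omega, by omega,
        by omega, by omega, ?_⟩
      refine h.setSet (fun i hi => ?_) (fun c d' hd' => ?_) ⟨_, ?_, hS'⟩
      · simp [ne_tmp hi, hr i hi]
      · simp [hd', hm]
      · rw [h0]
        simpa [hm] using hf.erase_listed hf0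
    · refine ⟨by omega, by omega, ?_⟩
      refine h.setSet (fun i hi => ?_) (fun c d' hd' => ?_) ⟨_, ?_, hS'⟩
      · simp [ne_tmp hi, hr i hi]
      · simp [hd', hm]
      · simpa [hm] using hf.set_listed hf0 h0 ((Nat.sub_le _ _).trans_lt hlt)
  · refine Runs.of_wp ⟨by omega, by omega, ?_⟩
    -- Erasing an absent element stores nothing.
    rw [Finset.erase_eq_of_notMem hxs]
    refine h.setSet (fun i hi => ?_) (fun c d' hd' => ?_) ⟨f, ?_, hS⟩
    · simp [ne_tmp hi, hr i hi]
    · simp [hm]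
    · simpa [hm] using hf

/-- No abstract state is presupposed, because during the setup the dictionaries that are not yet
cleared represent nothing; those already valid are carried along. -/
theorem clearProg_spec (P : Params w B)
    {d : Fin 5} {b : ℕ} {Q : NatState 25 20 → ℕ → Prop}
    (hb : 40 ≤ b) (hQ : ∀ ν' b', b ≤ b' + 40 → ν'.reg = ν.reg → DictRep P ν' d ∅ →
      (∀ d' S, d' ≠ d → DictRep P ν d' S → DictRep P ν' d' S) → Q ν' b') :
    Runs inp B Represents (clearProg d) ν b Q := by
  apply Runs.of_wp
  have o1 := P.small_lt (i := 0) (by norm_num)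
  have hB := P.B_pos
  simp [clearProg, wp, Operand.Fits, Operand.val, hB]
  refine ⟨by omega, hQ _ _ (by omega) rfl ⟨fun _ => 0, ?_, fun v => by simp⟩ ?_⟩
  · simpa using BlockInv.clear _ _ _ _ _
  · intro d' S hd'
    simp [DictRep, hd']

theorem choiceProg_spec (h : Abs P ν a) {d : Fin 5} {y : Fin 12} (hn : a.reg 0 < 2 ^ w) {b : ℕ} (hb : 40 ≤ b) :
    Runs inp B Represents (choiceProg y d) ν b fun ν' b' =>
      b ≤ b' + 40 ∧ ((∃ v ∈ a.set d, Abs P ν' (a.setReg y v)) ∨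
        a.set d = ∅ ∧ Abs P ν' (a.setReg y (a.reg 0))) := by
  obtain ⟨f, hf, hS⟩ := h.dict d
  have hB := P.B_pos
  have o0 := P.small_lt (i := 0) (by norm_num)
  have o1 := P.small_lt (i := 1) (by norm_num)
  have hU : ∀ v ∈ a.set d, v < 2 ^ w := fun v hv => by
    refine (P.lt_U (hf.lt_of_ne_zero fun h0 => ?_)).trans P.U_lt_two_pow
    rw [hS, h0, Nat.zero_testBit] at hv
    exact Bool.false_ne_true hv
  have habs : ∀ (ν' : NatState 25 20) v, ν'.mem = ν.mem → ν'.reg (up y) = v →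
      (∀ i : Fin 25, i.val < 19 → i ≠ up y → ν'.reg i = ν.reg i) → Abs P ν' (a.setReg y v) := by
    intro ν' v hm hv hr
    refine ⟨fun i => ?_, fun i => ?_, fun d => ?_⟩
    · by_cases hi : i = y
      · subst hi; simpa using hv
      · rw [hr _ (by simp only [up]; omega) (by simpa using hi), h.user]; simp [hi]
    · rw [hr _ (by simp only [tmp, Fin.val_castLE]; omega) (by simp), h.const]
    · unfold DictRep; rw [hm]; exact h.dict d
  refine Runs.seq (Runs.of_wp (p := .load _ _ _) ⟨by omega, o0, hB, ?_⟩)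
  refine Runs.ite (fun σ hσ => hσ.eval (o := .reg _) trivial) (fun σ hσ => hσ.eval (o := .lit 0) o0)
    (by omega) (fun hc => ?_) (fun hc => ?_)
  · simp only [Cmp.HoldsNat, Operand.val, NatState.setReg_reg_self] at hc
    apply Runs.of_wp
    simp [wp, Operand.Fits, Operand.val, BinOp.Fits, BinOp.val, h.user, hn]
    refine ⟨by omega, by omega, Or.inr ⟨?_, habs _ _ (by simp) (by simp) fun i hi hiy => ?_⟩⟩
    · ext v
      have : f (v / P.W) = 0 := hf.zero _ fun h => by omega
      simp [hS v, this]
    · simp [ne_tmp hi, hiy]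
  · simp only [Cmp.HoldsNat, Operand.val, NatState.setReg_reg_self] at hc
    obtain ⟨hx, hx0⟩ := hf.word_dense (j := 0) (by omega)
    have hi := hf.dense_lt 0 (by omega)
    have hlt := hf.lt (ν.mem (bk 1 d) 0)
    set i := ν.mem (bk 1 d) 0 with hidef
    rw [hx] at hx0 hlt
    set x := ν.mem (bk 0 d) i with hxdef
    have hiB := hi.trans_le P.m_le
    obtain ⟨j, hj1, hj2⟩ := BitTricks.exists_lowest_one hx0
    have hjW : j < P.W := by
      by_contra hj
      rw [Nat.testBit_eq_false_of_lt (hlt.trans_le (Nat.pow_le_pow_right (by norm_num)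
        (not_lt.1 hj)))] at hj1
      exact Bool.false_ne_true hj1
    have hs2 := P.two_le_s
    have hss := P.s_mul_s
    have hr : j % P.s < P.s := Nat.mod_lt _ (by omega)
    have hq : j / P.s * P.s + j % P.s = j := Nat.div_add_mod' j P.s
    have hsp : P.s < 2 ^ P.s := Nat.lt_two_pow_self
    -- The count of multiples can be as large as s, so it is its own residue modulo 2 ^ s - 1 only
    -- under this inequality. It needs s to be at least 2, which is why κ is at least 1.
    have hsp' : P.s < 2 ^ P.s - 1 := by
      have : ∀ n, 2 ≤ n → n < 2 ^ n - 1 := fun n hn => by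
        induction n, hn using Nat.le_induction with
        | base => norm_num
        | succ n _ ih => rw [pow_succ]; omega
      exact this _ hs2
    have e1 := BitTricks.count_multiples hs2 hsp' (hss ▸ hjW)
    have e2 := BitTricks.count_ones (by omega) hr
    have e3 : (2 : ℕ) ^ j / 2 ^ (j / P.s * P.s) = 2 ^ (j % P.s) := by
      rw [Nat.pow_div (by omega) (by norm_num)]; congr 1; omega
    have hjw : 2 ^ j ≤ 2 ^ (P.W - 1) := Nat.pow_le_pow_right (by norm_num) (by omega)
    have hW1 : 2 ^ P.W = 2 ^ (P.W - 1) * 2 := by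
      rw [← pow_succ]; congr 1; have := P.W_pos; omega
    have hpp := P.two_pow_W_le
    have hpos : 0 < 2 ^ j := by positivity
    have hpos' : 0 < 2 ^ (j % P.s) := by positivity
    -- The mask is formed as a sum, since 2 ^ (j + 1) itself overflows when j is the top bit of a
    -- machine word.
    have e0 : 2 ^ j - 1 + 2 ^ j = 2 ^ (j + 1) - 1 := by rw [pow_succ]; omega
    have hv : i * P.W + j ∈ a.set d := by
      rw [hS, mul_comm, Nat.mul_add_div P.W_pos, Nat.div_eq_of_lt hjW, Nat.mul_add_mod,
        Nat.mod_eq_of_lt hjW, add_zero, hx]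
      exact hj1
    have hvw := hU _ hv
    have hmul : (2 ^ (j % P.s) - 1) * BitTricks.comb P.s P.s < 2 ^ w := by
      refine (BitTricks.mul_comb_lt ?_ _).trans_le (hss ▸ hpp)
      exact (Nat.sub_le _ _).trans_lt (Nat.pow_lt_pow_right (by norm_num) hr)
    have hqs : j / P.s * 2 ^ P.κ = j / P.s * P.s := rfl
    have hqlt : j / P.s * P.s < 2 ^ w := by
      have := Nat.lt_two_pow_self (n := j); omega
    have hle : x &&& (x - 1) ≤ x := Nat.and_le_left
    have hadd : 2 ^ j - 1 + 2 ^ j < 2 ^ w := by omega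
    have hjw2 : j < 2 ^ w := by
      have := Nat.lt_two_pow_self (n := j); omega
    have hrq : j % P.s + j / P.s * P.s = j := by omega
    have hiw : i * P.W < 2 ^ w := by omega
    rw [e0] at hadd
    apply Runs.of_wp
    simp [wp, Operand.Fits, Operand.val, BinOp.Fits, BinOp.val, h.c0, h.c2, h.c3, h.c4, h.c5, h.c6,
      hB, o1, ← hidef, ← hxdef, hiB, hj2, e0, e1, hqs, e3, e2, hadd, hmul, hqlt, hrq, hjw2,
      ← P.W_eq_two_pow, hvw, hiw, hle]
    refine ⟨by omega, by omega, by omega, by omega, by omega, by omega, by omega, by omega,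
      by omega, by omega, by omega, by omega, by omega, by omega, by omega, by omega, by omega,
      by omega, by omega, by omega, by omega, by omega, by omega, ?_⟩
    refine Or.inl ⟨_, hv, habs _ _ (by simp) (by simp) fun i hi hiy => ?_⟩
    simp [ne_tmp hi, hiy]

end Specs

end DictMachine


/-! ### Programs that use choice dictionaries -/

namespace DictMachine

open WordRAM

/-- Programs with choice dictionaries. -/
inductive DictProg : Type
  | skip
  | op (dst : Fin 12) (o : BinOp) (x y : Operand 12)
  | read (dst : Fin 12) (addr : Operand 12)
  | insert (d : Fin 5) (x : Fin 12)
  | erase (d : Fin 5) (x : Fin 12)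
  | clear (d : Fin 5)
  | choice (dst : Fin 12) (d : Fin 5)
  | seq (p q : DictProg)
  | ite (c : Cmp) (x y : Operand 12) (p q : DictProg)
  | ifMem (d : Fin 5) (x : Fin 12) (p q : DictProg)
  | loop (c : Cmp) (x y : Operand 12) (p : DictProg)

infixr:60 " ;;; " => DictProg.seq

def upOperand : Operand 12 → Operand 25
  | .reg i => .reg (up i)
  | .lit m => .lit m
  | .width => .width

/-- The translation into programs of the word RAM. -/
def DictProg.compile : DictProg → Prog 25 20
  | skip => .skip
  | op dst o x y => .op (up dst) o (upOperand x) (upOperand y)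
  | read dst addr => .read (up dst) (upOperand addr)
  | insert d x => insertProg d x
  | erase d x => eraseProg d x
  | clear d => clearProg d
  | choice dst d => choiceProg dst d
  | seq p q => .seq p.compile q.compile
  | ite c x y p q => .ite c (upOperand x) (upOperand y) p.compile q.compile
  | ifMem d x p q => memProg d x p.compile q.compile
  | loop c x y p => .while c (upOperand x) (upOperand y) p.compile

variable {w B : ℕ}

/-- The state `σ` represents the view `a`. -/
def Rel (P : Params w B) (σ : State 25 20 w) (a : DictState) : Prop :=
  ∃ ν, Represents σ ν ∧ Abs P ν a

def DictState.val (w : ℕ) (a : DictState) : Operand 12 → ℕ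
  | .reg i => a.reg i
  | .lit m => m
  | .width => w

/-- Budgeted execution of programs with choice dictionaries. -/
def DRuns (P : Params w B) (inp : List (BitVec w)) (p : DictProg) (a : DictState) (b : ℕ)
    (Q : DictState → ℕ → Prop) : Prop :=
  Runs inp B (Rel P) p.compile a b Q

/-- The weakest precondition of a program with choice dictionaries. -/
def dwp (P : Params w B) (inp : List (BitVec w)) :
    DictProg → DictState → ℕ → (DictState → ℕ → Prop) → Prop
  | .skip, a, b, Q => 1 ≤ b ∧ Q a (b - 1)
  | .op dst o x y, a, b, Q => 1 ≤ b ∧ x.Fits w ∧ y.Fits w ∧ o.Fits w (a.val w x) (a.val w y) ∧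
      Q (a.setReg dst (o.val (a.val w x) (a.val w y))) (b - 1)
  | .read dst addr, a, b, Q => 1 ≤ b ∧ addr.Fits w ∧
      ∃ x, (inp.map BitVec.toNat)[a.val w addr]? = some x ∧ Q (a.setReg dst x) (b - 1)
  | .insert d x, a, b, Q => 40 ≤ b ∧ a.reg x < P.U ∧
      Q (a.setSet d (insert (a.reg x) (a.set d))) (b - 40)
  | .erase d x, a, b, Q => 40 ≤ b ∧ a.reg x < P.U ∧
      Q (a.setSet d ((a.set d).erase (a.reg x))) (b - 40)
  | .clear d, a, b, Q => 40 ≤ b ∧ Q (a.setSet d ∅) (b - 40)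
  | .choice dst d, a, b, Q => 40 ≤ b ∧ (∀ v ∈ a.set d, Q (a.setReg dst v) (b - 40)) ∧
      (a.set d = ∅ → Q (a.setReg dst (a.reg 0)) (b - 40))
  | .seq p q, a, b, Q => dwp P inp p a b fun a' b' => dwp P inp q a' b' Q
  | .ite c x y p q, a, b, Q => 1 ≤ b ∧ x.Fits w ∧ y.Fits w ∧
      (c.HoldsNat (a.val w x) (a.val w y) → dwp P inp p a (b - 1) Q) ∧
      (¬ c.HoldsNat (a.val w x) (a.val w y) → dwp P inp q a (b - 1) Q)
  | .ifMem d x p q, a, b, Q => 40 ≤ b ∧ a.reg x < P.U ∧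
      (a.reg x ∈ a.set d → dwp P inp p a (b - 40) Q) ∧
      (a.reg x ∉ a.set d → dwp P inp q a (b - 40) Q)
  | .loop c x y p, a, b, Q => DRuns P inp (.loop c x y p) a b Q

/-! ### Correctness of the translation -/

section

variable {P : Params w B} {inp : List (BitVec w)} {a : DictState} {b : ℕ}
  {Q Q' : DictState → ℕ → Prop}

theorem upOperand_fits {x : Operand 12} (h : x.Fits w) : (upOperand x).Fits w := by
  cases x <;> exact h

theorem Abs.val_eq {ν : NatState 25 20} (h : Abs P ν a) (x : Operand 12) :
    (upOperand x).val w ν = a.val w x := by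
  cases x
  · exact h.user _
  · rfl
  · rfl

theorem Rel.eval {σ : State 25 20 w} (h : Rel P σ a) {x : Operand 12} (hx : x.Fits w) :
    ((upOperand x).eval σ).toNat = a.val w x := by
  obtain ⟨ν, h1, h2⟩ := h
  rw [h1.eval (upOperand_fits hx), h2.val_eq]

theorem Abs.setReg {ν : NatState 25 20} (h : Abs P ν a) (i : Fin 12) (x : ℕ) :
    Abs P (ν.setReg (up i) x) (a.setReg i x) := by
  refine ⟨fun j => ?_, fun j => ?_, fun d => h.dict d⟩
  · by_cases hj : j = i
    · subst hj; simp
    · simp [hj, h.user]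
  · simpa using h.const j

theorem Rel.setReg {σ : State 25 20 w} (h : Rel P σ a) (i : Fin 12) (x : BitVec w) :
    Rel P (σ.setReg (up i) x) (a.setReg i x.toNat) := by
  obtain ⟨ν, h1, h2⟩ := h
  exact ⟨_, h1.setReg _ _, h2.setReg _ _⟩

theorem Rel.reg_lt {σ : State 25 20 w} (h : Rel P σ a) (i : Fin 12) : a.reg i < 2 ^ w := by
  obtain ⟨ν, h1, h2⟩ := h
  rw [← h2.user, ← h1.reg]
  exact BitVec.isLt _

/-- Lifting runs on natural-number states. -/
theorem runs_rel_of_runs {p : Prog 25 20} {Q₁ : NatState 25 20 → ℕ → Prop} {c : ℕ}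
    (h : ∀ ν, Abs P ν a → (∀ i, a.reg i < 2 ^ w) → Runs inp B Represents p ν b Q₁)
    (hQ : ∀ ν' b', Q₁ ν' b' → b ≤ b' + c ∧ ∃ a', Abs P ν' a' ∧ Q a' (b - c)) :
    Runs inp B (Rel P) p a b Q := by
  rintro σ hσ
  have hlt := fun i => hσ.reg_lt i
  obtain ⟨ν, h1, h2⟩ := hσ
  obtain ⟨σ', t, ν', b', g1, g2, g3, g4⟩ := h ν h2 hlt σ h1
  obtain ⟨h3, a', h4, h5⟩ := hQ _ _ g4
  exact ⟨σ', t, a', b - c, g1, ⟨ν', g2, h4⟩, by omega, h5⟩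

/-- Which element `choice` returns depends on the representation and not on the abstract set, so
`dwp` asks for the postcondition for every element. Each dictionary operation is charged a flat 40
steps, an upper bound for all of them. -/
theorem DRuns.of_dwp {p : DictProg} (h : dwp P inp p a b Q) : DRuns P inp p a b Q := by
  induction p generalizing a b Q with
  | skip =>
    intro σ hσ
    exact ⟨σ, 1, a, b - 1, .skip σ, hσ, by have := h.1; omega, h.2⟩
  | op dst o x y =>
    intro σ hσ
    obtain ⟨hb, hx, hy, ho, hQ⟩ := h
    rw [← hσ.eval hx, ← hσ.eval hy] at ho hQ
    rw [← o.toNat_eval ho] at hQ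
    exact ⟨_, 1, _, b - 1, .op σ _ o _ _, hσ.setReg _ _, by omega, hQ⟩
  | read dst addr =>
    intro σ hσ
    obtain ⟨hb, hx, x, ho, hQ⟩ := h
    rw [← hσ.eval hx] at ho
    rw [List.getElem?_map, Option.map_eq_some_iff] at ho
    obtain ⟨y, hy, rfl⟩ := ho
    exact ⟨_, 1, _, b - 1, .read σ _ _ y hy, hσ.setReg _ _, by omega, hQ⟩
  | insert d x =>
    exact runs_rel_of_runs (fun ν hν _ => insertProg_spec hν h.2.1 h.1)
      fun ν' b' h' => ⟨h'.1, _, h'.2, h.2.2⟩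
  | erase d x =>
    exact runs_rel_of_runs (fun ν hν _ => eraseProg_spec hν h.2.1 h.1)
      fun ν' b' h' => ⟨h'.1, _, h'.2, h.2.2⟩
  | clear d =>
    refine runs_rel_of_runs (Q₁ := fun ν' b' => b ≤ b' + 40 ∧ Abs P ν' (a.setSet d ∅))
      (fun ν hν _ => clearProg_spec P h.1 fun ν' b' hb' hr h1 h2 => ⟨hb', ?_⟩)
      fun ν' b' h' => ⟨h'.1, _, h'.2, h.2⟩
    refine ⟨fun i => by rw [hr, hν.user]; rfl, fun i => by rw [hr, hν.const], fun d' => ?_⟩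
    by_cases hd : d' = d
    · subst hd; simpa using h1
    · rw [DictState.setSet_set_of_ne _ hd]; exact h2 _ _ hd (hν.dict d')
  | choice dst d =>
    refine runs_rel_of_runs (c := 40) (fun ν hν hlt => choiceProg_spec hν (hlt 0) h.1) ?_
    rintro ν' b' ⟨h1, ⟨v, hv, h2⟩ | ⟨hd, h2⟩⟩
    · exact ⟨h1, _, h2, h.2.1 v hv⟩
    · exact ⟨h1, _, h2, h.2.2 hd⟩
  | seq p q ihp ihq => exact Runs.seq ((ihp h).mono fun _ _ h' => ihq h')
  | ite c x y p q ihp ihq =>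
    obtain ⟨hb, hx, hy, h1, h2⟩ := h
    exact Runs.ite (fun σ hσ => hσ.eval hx) (fun σ hσ => hσ.eval hy) hb
      (fun h => ihp (h1 h)) (fun h => ihq (h2 h))
  | ifMem d x p q ihp ihq =>
    obtain ⟨hb, hx, h1, h2⟩ := h
    rintro σ ⟨ν, hσ, hν⟩
    -- The membership test is specified on `Represents`, the branches on `Rel`. The postcondition
    -- carries the abstract state existentially to pass from one to the other.
    obtain ⟨σ', t, ν', b', g1, g2, g3, a', b'', g4, g5, g6⟩ :=
      memProg_spec (inp := inp) (p := p.compile) (q := q.compile) hν hx hb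
        (Q := fun ν' b' => ∃ a' b'', Abs P ν' a' ∧ b'' ≤ b' ∧ Q a' b'')
        (fun hm ν' b' hν' hb' σ' hσ' => by
          obtain ⟨σ₁, t, a₁, b₁, g1, ⟨ν₁, g2, g2'⟩, g3, g4⟩ := ihp (h1 hm) σ' ⟨ν', hσ', hν'⟩
          exact ⟨σ₁, t, ν₁, b₁, g1, g2, by omega, a₁, b₁, g2', le_rfl, g4⟩)
        (fun hm ν' b' hν' hb' σ' hσ' => by
          obtain ⟨σ₁, t, a₁, b₁, g1, ⟨ν₁, g2, g2'⟩, g3, g4⟩ := ihq (h2 hm) σ' ⟨ν', hσ', hν'⟩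
          exact ⟨σ₁, t, ν₁, b₁, g1, g2, by omega, a₁, b₁, g2', le_rfl, g4⟩) σ hσ
    exact ⟨σ', t, a', b'', g1, ⟨ν', g2, g4⟩, by omega, g6⟩
  | loop c x y p => exact h

theorem DRuns.mono {p : DictProg} (h : DRuns P inp p a b Q) (hQ : ∀ a' b', Q a' b' → Q' a' b') :
    DRuns P inp p a b Q' := Runs.mono h hQ

theorem DRuns.loop {c : Cmp} {x y : Operand 12} {p : DictProg} (hx : x.Fits w) (hy : y.Fits w)
    (hb : 1 ≤ b)
    (hp : c.HoldsNat (a.val w x) (a.val w y) →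
      DRuns P inp p a (b - 1) fun a' b' => DRuns P inp (.loop c x y p) a' b' Q)
    (hq : ¬ c.HoldsNat (a.val w x) (a.val w y) → Q a (b - 1)) :
    DRuns P inp (.loop c x y p) a b Q :=
  Runs.whileLoop (fun _ hσ => hσ.eval hx) (fun _ hσ => hσ.eval hy) hb hp hq

end

end DictMachine


/-! ### Initialization of the dictionaries -/

namespace BitTricks

/-- The leading one sits at position m * s. The coarser bound `comb_lt` would not do: `comb (s + 1)
s` has its leading one at (s - 1) * (s + 1) = s * s - 1 and just fits into s * s bits. -/
theorem comb_succ_lt {s : ℕ} (hs : 1 ≤ s) (m : ℕ) : comb s (m + 1) < 2 ^ (m * s + 1) := by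
  have h := comb_lt hs m
  have h2 : 2 ≤ 2 ^ s := by
    calc 2 = 2 ^ 1 := rfl
      _ ≤ 2 ^ s := Nat.pow_le_pow_right (by norm_num) hs
  cases m with
  | zero => simp [comb]
  | succ m =>
    have h3 : comb s (m + 1) * 2 ^ s < 2 ^ (m * s + s) * 2 ^ s := by
      rw [← Nat.succ_mul]; exact Nat.mul_lt_mul_of_pos_right h (by positivity)
    have : comb s (m + 1 + 1) = comb s (m + 1) * 2 ^ s + 1 := rfl
    have h5 : comb s (m + 1) * 2 ^ s < 2 ^ ((m + 1) * s) * 2 ^ s :=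
      Nat.mul_lt_mul_of_pos_right h (by positivity)
    have h6 := comb_lt hs m
    have h7 : comb s (m + 1) = comb s m * 2 ^ s + 1 := rfl
    have h8 : 0 < 2 ^ (m * s) := by positivity
    have h9 : comb s (m + 1) < 2 ^ (m * s + 1) := comb_succ_lt hs m
    have h10 : comb s (m + 1) + 1 ≤ 2 ^ (m * s + 1) := h9
    rw [this, Nat.succ_mul m s, add_right_comm, pow_add 2 (m * s + 1) s]
    nlinarith

end BitTricks

namespace DictMachine

open WordRAM

/-- The logarithm of the square root of the word length of the dictionaries. -/
def logRoot (n w : ℕ) : ℕ := max 1 (Nat.log 4 (min w n))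

/-- The right-hand side is the loop test of `logLoop`. Comparing with a quarter of the minimum
avoids forming 4 ^ (j + 1), which does not fit into a word when w = 4 and j = 1. -/
theorem lt_logRoot {n w j : ℕ} (hn : 1 ≤ n) (hw : 1 ≤ w) (hj : 1 ≤ j) :
    j < logRoot n w ↔ 4 ^ j < min w n / 4 + 1 := by
  have : 4 ^ j < min w n / 4 + 1 ↔ 4 ^ (j + 1) ≤ min w n := by
    rw [pow_succ]; omega
  rw [this, ← Nat.le_log_iff_pow_le (by norm_num) (by omega), logRoot]
  omega

theorem pow_logRoot_le_or {n w : ℕ} (hn : 1 ≤ n) (hw : 1 ≤ w) :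
    logRoot n w = 1 ∨ 4 ^ logRoot n w ≤ min w n := by
  rcases Nat.lt_or_ge 1 (logRoot n w) with h | h
  · right
    rw [← Nat.le_log_iff_pow_le (by norm_num) (by omega)]
    unfold logRoot at h ⊢; omega
  · left; unfold logRoot at h ⊢; omega

theorem min_lt_pow_logRoot {n w : ℕ} (hn : 1 ≤ n) (hw : 1 ≤ w) :
    min w n < 4 * 4 ^ logRoot n w := by
  have h := (lt_logRoot hn hw (j := logRoot n w) (by unfold logRoot; omega)).not.1 (lt_irrefl _)
  omega

/-- The number of words of the dictionaries. -/
def numWords (n w : ℕ) : ℕ := 2 * n / 4 ^ logRoot n w + 1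

/-- If w < 4 * W, only a constant factor of each machine word is wasted. Otherwise n < 4 * W, and
there are so few words that their unused parts amount to O(w) bits. -/
theorem numWords_mul_le {n w : ℕ} (hn : 1 ≤ n) (hw : 1 ≤ w) :
    numWords n w * w ≤ 8 * n + 9 * w := by
  have h := min_lt_pow_logRoot hn hw
  have h0 : 0 < 4 ^ logRoot n w := by positivity
  unfold numWords
  set W := 4 ^ logRoot n w
  have h1 := Nat.div_mul_le_self (2 * n) W
  rw [add_mul]
  rcases Nat.lt_or_ge w (4 * W) with h2 | h2
  · have : 2 * n / W * w ≤ 2 * n / W * (4 * W) := Nat.mul_le_mul_left _ h2.le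
    have h3 : 2 * n / W * (4 * W) = 4 * (2 * n / W * W) := by ring
    omega
  · have h3 : 2 * n / W < 8 := (Nat.div_lt_iff_lt_mul h0).2 (by omega)
    have : 2 * n / W * w ≤ 8 * w := Nat.mul_le_mul_right _ h3.le
    omega

/-- The parameters for trees with `n` nodes. -/
def mkParams (n w : ℕ) (hn : 1 ≤ n) (hw : 4 ≤ w) (hnw : 2 * n + w < 2 ^ w) :
    Params w (numWords n w) where
  κ := logRoot n w
  m := numWords n w
  one_le := by unfold logRoot; omega
  W_le := by
    rcases pow_logRoot_le_or hn (w := w) (by omega) with h | h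
    · rw [h]; omega
    · omega
  U_lt := by
    have hW : 4 ^ logRoot n w ≤ w := by
      rcases pow_logRoot_le_or hn (w := w) (by omega) with h | h
      · rw [h]; omega
      · omega
    have h1 := Nat.div_mul_le_self (2 * n) (4 ^ logRoot n w)
    change (2 * n / 4 ^ logRoot n w + 1) * 4 ^ logRoot n w < 2 ^ w
    rw [add_mul, one_mul]
    exact (Nat.add_le_add h1 hW).trans_lt hnw
  m_le := le_rfl
  B_pos := Nat.succ_pos _

theorem le_mkParams_U (n w : ℕ) (hn : 1 ≤ n) (hw : 4 ≤ w) (hnw : 2 * n + w < 2 ^ w) :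
    2 * n ≤ (mkParams n w hn hw hnw).U := by
  have h0 : 0 < 4 ^ logRoot n w := by positivity
  have := Nat.lt_div_mul_add (a := 2 * n) h0
  change 2 * n ≤ (2 * n / 4 ^ logRoot n w + 1) * 4 ^ logRoot n w
  rw [add_mul]; omega

/-- Determines the word length of the dictionaries. -/
def logLoop : Prog 25 20 :=
  .while .lt (.reg (tmp 1)) (.reg (tmp 7))
    (.op (tmp 1) .shl (.reg (tmp 1)) (.lit 2) ;;
      .op (tmp 2) .add (.reg (tmp 2)) (.lit 1))

/-- Computes the constants for finding the logarithm of a power of two. -/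
def combLoop : Prog 25 20 :=
  .while .lt (.reg (tmp 8)) (.reg (tmp 9))
    (.op (tmp 3) .shl (.reg (tmp 3)) (.reg (tmp 9)) ;;
      .op (tmp 3) .add (.reg (tmp 3)) (.lit 1) ;;
      .op (tmp 4) .shl (.reg (tmp 4)) (.reg (tmp 10)) ;;
      .op (tmp 4) .add (.reg (tmp 4)) (.lit 1) ;;
      .op (tmp 8) .add (.reg (tmp 8)) (.lit 1))

def minProg : Prog 25 20 :=
  .read (up 0) (.lit 0) ;;
  .ite .lt .width (.reg (up 0)) (.op (tmp 7) .shr .width (.lit 2))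
    (.op (tmp 7) .shr (.reg (up 0)) (.lit 2)) ;;
  .op (tmp 7) .add (.reg (tmp 7)) (.lit 1) ;;
  .op (tmp 1) .add (.lit 4) (.lit 0) ;;
  .op (tmp 2) .add (.lit 1) (.lit 0)

def maskProg : Prog 25 20 :=
  .op (tmp 0) .add (.reg (tmp 2)) (.reg (tmp 2)) ;;
  .op (tmp 9) .shl (.lit 1) (.reg (tmp 2)) ;;
  .op (tmp 10) .add (.reg (tmp 9)) (.lit 1) ;;
  .op (tmp 5) .shl (.lit 1) (.reg (tmp 9)) ;;
  .op (tmp 5) .sub (.reg (tmp 5)) (.lit 1) ;;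
  .op (tmp 6) .shl (.lit 1) (.reg (tmp 10)) ;;
  .op (tmp 6) .sub (.reg (tmp 6)) (.lit 1) ;;
  .op (tmp 3) .add (.lit 0) (.lit 0) ;;
  .op (tmp 4) .add (.lit 0) (.lit 0) ;;
  .op (tmp 8) .add (.lit 0) (.lit 0)

def constProg : Prog 25 20 := minProg ;; logLoop ;; maskProg ;; combLoop

def setupProg : Prog 25 20 :=
  constProg ;; clearProg 0 ;; clearProg 1 ;; clearProg 2 ;; clearProg 3 ;; clearProg 4

/-! ### Computing the constants in linear time -/

section

variable {n w B : ℕ} {inp : List (BitVec w)}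

theorem two_pow_small {w i : ℕ} (hw : 4 ≤ w) (hi : i < 16) : i < 2 ^ w :=
  hi.trans_le (Nat.pow_le_pow_right (n := 2) (by norm_num) hw)

theorem logLoop_spec (hn : 1 ≤ n) (hw : 4 ≤ w) {ν : NatState 25 20} {j b : ℕ}
    {Q : NatState 25 20 → ℕ → Prop} (hj : 1 ≤ j) (hjn : j ≤ logRoot n w)
    (h1 : ν.reg (tmp 1) = 4 ^ j) (h2 : ν.reg (tmp 2) = j)
    (h7 : ν.reg (tmp 7) = min w n / 4 + 1) (hb : 3 * (logRoot n w - j) + 1 ≤ b)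
    (hQ : ∀ ν' b', b ≤ b' + (3 * (logRoot n w - j) + 1) → ν'.reg (up 0) = ν.reg (up 0) →
      ν'.reg (tmp 1) = 4 ^ logRoot n w → ν'.reg (tmp 2) = logRoot n w → Q ν' b') :
    Runs inp B Represents logLoop ν b Q := by
  induction hk : logRoot n w - j generalizing j ν b with
  | zero =>
    have hj' : logRoot n w = j := by omega
    refine Runs.whileLoop (fun σ hσ => hσ.eval (o := .reg _) trivial)
      (fun σ hσ => hσ.eval (o := .reg _) trivial) (by omega) (fun hc => ?_) (fun hc => ?_)
    · simp only [Cmp.HoldsNat, Operand.val, h1, h7] at hc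
      rw [← lt_logRoot hn (by omega) hj] at hc
      omega
    · exact hQ _ _ (by omega) rfl (by rw [h1, hj']) (by rw [h2, hj'])
  | succ k ih =>
    have hlt := (lt_logRoot hn (by omega) hj).1 (show j < logRoot n w by omega)
    have hjw : 4 ^ j * 4 < 2 ^ w := by
      have := Nat.lt_two_pow_self (n := w); omega
    have hj2 : j < 4 ^ j := Nat.lt_pow_self (by norm_num)
    refine Runs.whileLoop (fun σ hσ => hσ.eval (o := .reg _) trivial)
      (fun σ hσ => hσ.eval (o := .reg _) trivial) (by omega) (fun hc => ?_) (fun hc => ?_)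
    · apply Runs.of_wp
      simp [wp, Operand.Fits, Operand.val, BinOp.Fits, BinOp.val, h1, h2,
        two_pow_small hw (i := 1), two_pow_small hw (i := 2), hjw]
      refine ⟨by omega, by omega, by omega, ?_⟩
      refine ih (j := j + 1) (by omega) (by omega) (by simp [pow_succ]) (by simp) (by simp [h7])
        (by omega) (fun ν' b' hb' h0 h1' h2' => hQ ν' b' (by omega) (by simpa using h0) h1' h2')
        (by omega)
    · simp only [Cmp.HoldsNat, Operand.val, h1, h7] at hc
      omega

theorem combLoop_spec {s : ℕ} (hs : 2 ≤ s) (hsw : s * s ≤ w) {ν : NatState 25 20} {j b : ℕ}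
    {Q : NatState 25 20 → ℕ → Prop} (hj : j ≤ s)
    (h3 : ν.reg (tmp 3) = BitTricks.comb s j) (h4 : ν.reg (tmp 4) = BitTricks.comb (s + 1) j)
    (h8 : ν.reg (tmp 8) = j) (h9 : ν.reg (tmp 9) = s) (h10 : ν.reg (tmp 10) = s + 1)
    (hb : 6 * (s - j) + 1 ≤ b)
    (hQ : ∀ ν' b', b ≤ b' + (6 * (s - j) + 1) →
      (∀ i, i ≠ tmp 3 → i ≠ tmp 4 → i ≠ tmp 8 → ν'.reg i = ν.reg i) →
      ν'.reg (tmp 3) = BitTricks.comb s s → ν'.reg (tmp 4) = BitTricks.comb (s + 1) s → Q ν' b') :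
    Runs inp B Represents combLoop ν b Q := by
  have hw : 4 ≤ w := by nlinarith
  induction hk : s - j generalizing j ν b with
  | zero =>
    have hj' : j = s := by omega
    subst hj'
    refine Runs.whileLoop (fun σ hσ => hσ.eval (o := .reg _) trivial)
      (fun σ hσ => hσ.eval (o := .reg _) trivial) (by omega) (fun hc => ?_) (fun hc => ?_)
    · simp only [Cmp.HoldsNat, Operand.val, h8, h9] at hc
      omega
    · exact hQ _ _ (by omega) (fun _ _ _ _ => rfl) h3 h4
  | succ k ih =>
    have e1 : BitTricks.comb s j * 2 ^ s + 1 < 2 ^ w := by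
      refine (BitTricks.comb_succ_lt (by omega) j).trans_le (Nat.pow_le_pow_right (by norm_num) ?_)
      have : j * s ≤ (s - 1) * s := Nat.mul_le_mul_right _ (by omega)
      obtain ⟨t, rfl⟩ : ∃ t, s = t + 1 := ⟨s - 1, by omega⟩
      simp only [Nat.add_sub_cancel] at this
      nlinarith
    -- The tightest bound: from j ≤ s - 1 follows j * (s + 1) + 1 ≤ s * s ≤ w.
    have e2 : BitTricks.comb (s + 1) j * 2 ^ (s + 1) + 1 < 2 ^ w := by
      refine (BitTricks.comb_succ_lt (by omega) j).trans_le (Nat.pow_le_pow_right (by norm_num) ?_)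
      have : j * (s + 1) ≤ (s - 1) * (s + 1) := Nat.mul_le_mul_right _ (by omega)
      obtain ⟨t, rfl⟩ : ∃ t, s = t + 1 := ⟨s - 1, by omega⟩
      simp only [Nat.add_sub_cancel] at this
      nlinarith
    have e3 : j + 1 < 2 ^ w := by
      have := Nat.lt_two_pow_self (n := w)
      have : s ≤ s * s := Nat.le_mul_self s
      omega
    refine Runs.whileLoop (fun σ hσ => hσ.eval (o := .reg _) trivial)
      (fun σ hσ => hσ.eval (o := .reg _) trivial) (by omega) (fun hc => ?_) (fun hc => ?_)
    · apply Runs.of_wp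
      simp [wp, Operand.Fits, Operand.val, BinOp.Fits, BinOp.val, h3, h4, h8, h9, h10,
        two_pow_small hw (i := 1), e1, e2, e3, (Nat.lt_succ_self _).trans e1,
        (Nat.lt_succ_self _).trans e2]
      repeat refine ⟨by omega, ?_⟩
      refine ih (j := j + 1) (by omega) (by simp [BitTricks.comb]) (by simp [BitTricks.comb])
        (by simp) (by simp [h9]) (by simp [h10]) (by omega)
        (fun ν' b' hb' h0 h1' h2' => hQ ν' b' (by omega) (fun i hi3 hi4 hi8 => ?_) h1' h2')
        (by omega)
      rw [h0 i hi3 hi4 hi8]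
      simp [hi3, hi4, hi8]
    · simp only [Cmp.HoldsNat, Operand.val, h8, h9] at hc
      omega

/-- The time is linear in n although w may be far larger: either W ≤ min w n or W = 4, so that κ ≤ n
and s ≤ n + 1 bound the numbers of rounds of the two loops. -/
theorem constProg_spec (hn : 1 ≤ n) (hw : 4 ≤ w) (hnw : 2 * n + w < 2 ^ w)
    (hinp : (inp.map BitVec.toNat)[0]? = some n) {ν : NatState 25 20} {b : ℕ}
    (hb : 9 * n + 50 ≤ b) :
    Runs inp B Represents constProg ν b fun ν' b' => b ≤ b' + (9 * n + 50) ∧ ν'.reg (up 0) = n ∧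
      ∀ i : Fin 7, ν'.reg (tmp (i.castLE (by norm_num))) = (mkParams n w hn hw hnw).const i := by
  set P := mkParams n w hn hw hnw with hP
  have hκn : logRoot n w ≤ n := by
    rcases pow_logRoot_le_or hn (w := w) (by omega) with h | h
    · omega
    · have := Nat.lt_pow_self (n := logRoot n w) (a := 4) (by norm_num); omega
  have hs2 := P.two_le_s
  have hss := P.s_mul_s
  have hsw := P.W_le_w
  have hsn : P.s ≤ n + 1 := by
    rcases pow_logRoot_le_or hn (w := w) (by omega) with h | h
    · have : P.s = 2 ^ logRoot n w := rfl
      rw [this, h]; omega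
    · have : P.W ≤ min w n := h
      nlinarith [min_le_right w n]
  have o0 := two_pow_small hw (i := 0) (by norm_num)
  have o1 := two_pow_small hw (i := 1) (by norm_num)
  have o2 := two_pow_small hw (i := 2) (by norm_num)
  have o4 := two_pow_small hw (i := 4) (by norm_num)
  have hmin : min w n / 4 + 1 < 2 ^ w := by omega
  have hs1w : P.s + 1 < w := by nlinarith
  have hlt := Nat.lt_two_pow_self (n := w)
  have hpow : 2 ^ P.s < 2 ^ w := Nat.pow_lt_pow_right (by norm_num) (by omega)
  have hpow' : 2 ^ (P.s + 1) < 2 ^ w := Nat.pow_lt_pow_right (by norm_num) (by omega)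
  have hκs : P.κ < P.s := Nat.lt_two_pow_self
  have hκ : logRoot n w = P.κ := rfl
  have hs : 2 ^ P.κ = P.s := rfl
  have hsu : P.s < 2 ^ w := by omega
  have hs1u : P.s + 1 < 2 ^ w := by omega
  have hκ2 : P.κ + P.κ < 2 ^ w := by
    have : P.κ + P.κ ≤ P.s * P.s := by nlinarith
    omega
  have hpre : Runs inp B Represents minProg ν b fun ν' b' => b ≤ b' + 6 ∧ ν'.reg (up 0) = n ∧
      ν'.reg (tmp 1) = 4 ∧ ν'.reg (tmp 2) = 1 ∧ ν'.reg (tmp 7) = min w n / 4 + 1 := by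
    apply Runs.of_wp
    refine ⟨by omega, o0, n, hinp, ?_⟩
    refine ⟨by omega, trivial, trivial, fun hc => ?_, fun hc => ?_⟩
    all_goals
      simp only [Cmp.HoldsNat, Operand.val, NatState.setReg_reg_self] at hc
      simp [wp, Operand.Fits, Operand.val, BinOp.Fits, BinOp.val, o1, o2, o4]
      omega
  refine Runs.seq (hpre.mono ?_)
  rintro ν₁ b₁ ⟨hb₁, f0, f1, f2, f7⟩
  refine Runs.seq (logLoop_spec hn hw (j := 1) le_rfl P.one_le f1 f2 f7 (by omega) ?_)
  intro ν₂ b₂ hb₂ e0 e1 e2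
  rw [hκ] at e1 e2 hb₂
  rw [f0] at e0
  have hmask : Runs inp B Represents maskProg ν₂ b₂ fun ν' b' => b₂ ≤ b' + 10 ∧
      ν'.reg (up 0) = n ∧ ν'.reg (tmp 0) = 2 * P.κ ∧ ν'.reg (tmp 1) = P.W ∧
      ν'.reg (tmp 2) = P.κ ∧ ν'.reg (tmp 3) = 0 ∧ ν'.reg (tmp 4) = 0 ∧
      ν'.reg (tmp 5) = 2 ^ P.s - 1 ∧ ν'.reg (tmp 6) = 2 ^ (P.s + 1) - 1 ∧ ν'.reg (tmp 8) = 0 ∧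
      ν'.reg (tmp 9) = P.s ∧ ν'.reg (tmp 10) = P.s + 1 := by
    apply Runs.of_wp
    simp [maskProg, wp, Operand.Fits, Operand.val, BinOp.Fits, BinOp.val, o1, e0, e1, e2, hs,
      hsu, hs1u, hpow, hpow', Nat.one_le_two_pow, ← two_mul, Params.W]
    omega
  refine Runs.seq (hmask.mono ?_)
  rintro ν₃ b₃ ⟨hb₃, g0, c0, c1, c2, c3, c4, c5, c6, g8, g9, g10⟩
  refine combLoop_spec hs2 (by omega) (j := 0) (by omega) c3 c4 g8 g9 g10 (by omega) ?_
  intro ν₄ b₄ hb₄ g g3 g4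
  have g' : ∀ i : Fin 13, i ≠ 3 → i ≠ 4 → i ≠ 8 → ν₄.reg (tmp i) = ν₃.reg (tmp i) :=
    fun i h1 h2 h3 => g _ (by simpa using h1) (by simpa using h2) (by simpa using h3)
  refine ⟨by omega, ?_, fun i => ?_⟩
  · rw [g _ (by simp) (by simp) (by simp), g0]
  · fin_cases i
    · exact (g' 0 (by simp) (by simp) (by simp)).trans c0
    · exact (g' 1 (by simp) (by simp) (by simp)).trans c1
    · exact (g' 2 (by simp) (by simp) (by simp)).trans c2
    · exact g3
    · exact g4
    · exact (g' 5 (by simp) (by simp) (by simp)).trans c5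
    · exact (g' 6 (by simp) (by simp) (by simp)).trans c6

theorem setupProg_spec (hn : 1 ≤ n) (hw : 4 ≤ w) (hnw : 2 * n + w < 2 ^ w)
    (hinp : (inp.map BitVec.toNat)[0]? = some n) {ν : NatState 25 20} {b : ℕ}
    (hb : 9 * n + 250 ≤ b) :
    Runs inp (numWords n w) Represents setupProg ν b fun ν' b' => b ≤ b' + (9 * n + 250) ∧
      ν'.reg (up 0) = n ∧ Abs (mkParams n w hn hw hnw) ν' ⟨fun i => ν'.reg (up i), fun _ => ∅⟩ := by
  set P := mkParams n w hn hw hnw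
  refine Runs.seq ((constProg_spec hn hw hnw hinp (by omega)).mono ?_)
  rintro ν₀ b₀ ⟨hb₀, h0, hc⟩
  refine Runs.seq (clearProg_spec P (by omega) fun ν₁ b₁ hb₁ r₁ d₁ p₁ => ?_)
  refine Runs.seq (clearProg_spec P (by omega) fun ν₂ b₂ hb₂ r₂ d₂ p₂ => ?_)
  refine Runs.seq (clearProg_spec P (by omega) fun ν₃ b₃ hb₃ r₃ d₃ p₃ => ?_)
  refine Runs.seq (clearProg_spec P (by omega) fun ν₄ b₄ hb₄ r₄ d₄ p₄ => ?_)
  refine clearProg_spec P (by omega) fun ν₅ b₅ hb₅ r₅ d₅ p₅ => ?_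
  have hr : ν₅.reg = ν₀.reg := by rw [r₅, r₄, r₃, r₂, r₁]
  refine ⟨by omega, by rw [hr, h0], fun i => rfl, fun i => by rw [hr, hc], fun d => ?_⟩
  fin_cases d
  · exact p₅ _ _ (by decide) (p₄ _ _ (by decide) (p₃ _ _ (by decide) (p₂ _ _ (by decide) d₁)))
  · exact p₅ _ _ (by decide) (p₄ _ _ (by decide) (p₃ _ _ (by decide) d₂))
  · exact p₅ _ _ (by decide) (p₄ _ _ (by decide) d₃)
  · exact p₅ _ _ (by decide) d₄
  · exact d₅

end

end DictMachine


/-! ### Heights in rooted trees -/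

namespace RootedTree

variable {n : ℕ} {G : SimpleGraph (Fin n)} {root : Fin n}

open Classical in
/-- The children of a node. -/
noncomputable def children (G : SimpleGraph (Fin n)) (root u : Fin n) : Finset (Fin n) :=
  Finset.univ.filter fun c => G.Adj u c ∧ G.dist root c = G.dist root u + 1

theorem mem_children {u c : Fin n} :
    c ∈ children G root u ↔ G.Adj u c ∧ G.dist root c = G.dist root u + 1 := by
  simp [children]

/-- Paths in a tree are unique and hence geodesic. Descent becomes equality in a triangle
inequality, and the arguments below are arithmetic with distances instead of surgery on walks. -/
theorem isDesc_iff (hG : G.IsTree) {u v : Fin n} :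
    IsDesc G root u v ↔ G.dist root v = G.dist root u + G.dist u v := by
  have hlen : ∀ {x y : Fin n} (p : G.Walk x y), p.IsPath → p.length = G.dist x y := by
    intro x y p hp
    obtain ⟨q, hq, hl⟩ := hG.connected.exists_path_of_dist x y
    rw [← hl, (hG.existsUnique_path x y).unique hp hq]
  constructor
  · rintro ⟨p, hp, hu⟩
    have h := congrArg SimpleGraph.Walk.length (p.take_spec hu)
    rw [SimpleGraph.Walk.length_append, hlen _ (hp.takeUntil hu), hlen _ (hp.dropUntil hu),
      hlen _ hp] at h
    exact h.symm
  · intro h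
    obtain ⟨p, hp⟩ := hG.connected.exists_walk_length_eq_dist root u
    obtain ⟨q, hq⟩ := hG.connected.exists_walk_length_eq_dist u v
    refine ⟨p.append q, (p.append q).isPath_of_length_eq_dist ?_, ?_⟩
    · rw [SimpleGraph.Walk.length_append, hp, hq, h]
    · rw [SimpleGraph.Walk.mem_support_append_iff]
      exact Or.inl p.end_mem_support

theorem isDesc_self (hG : G.IsTree) (u : Fin n) : IsDesc G root u u := by
  rw [isDesc_iff hG, G.dist_self, add_zero]

theorem isDesc_of_mem_children (hG : G.IsTree) {u c v : Fin n} (hc : c ∈ children G root u)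
    (hv : IsDesc G root c v) : IsDesc G root u v ∧ G.dist u v = G.dist c v + 1 := by
  rw [isDesc_iff hG] at hv ⊢
  obtain ⟨h1, h2⟩ := mem_children.1 hc
  have h3 : G.dist u c = 1 := SimpleGraph.dist_eq_one_iff_adj.2 h1
  have h4 := hG.connected.dist_triangle (u := u) (v := c) (w := v)
  have h5 := hG.connected.dist_triangle (u := root) (v := u) (w := v)
  omega

theorem exists_child_of_isDesc (hG : G.IsTree) {u v : Fin n} (hv : IsDesc G root u v)
    (hne : v ≠ u) : ∃ c ∈ children G root u, IsDesc G root c v := by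
  rw [isDesc_iff hG] at hv
  obtain ⟨p, hp⟩ := hG.connected.exists_walk_length_eq_dist u v
  cases p with
  | nil => exact absurd rfl hne
  | @cons _ c _ h q =>
    rw [SimpleGraph.Walk.length_cons] at hp
    have h1 := SimpleGraph.dist_le q
    have h3 : G.dist u c = 1 := SimpleGraph.dist_eq_one_iff_adj.2 h
    have h4 := hG.connected.dist_triangle (u := root) (v := u) (w := c)
    have h5 := hG.connected.dist_triangle (u := root) (v := c) (w := v)
    have h6 := hG.connected.dist_triangle (u := u) (v := c) (w := v)
    exact ⟨c, mem_children.2 ⟨h, by omega⟩, (isDesc_iff hG).2 (by omega)⟩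

/-- A descendant of u at maximal distance from u is a leaf, since a proper descendant of it would be
farther away. -/
theorem exists_isLeaf (hG : G.IsTree) (u : Fin n) :
    ∃ v, IsDesc G root u v ∧ IsLeaf G root v := by
  classical
  obtain ⟨v, hv, hmax⟩ := Finset.exists_max_image
    (Finset.univ.filter fun v => IsDesc G root u v) (fun v => G.dist u v)
    ⟨u, by simpa using isDesc_self hG u⟩
  rw [Finset.mem_filter] at hv
  refine ⟨v, hv.2, fun x hx => ?_⟩
  have h1 := (isDesc_iff hG).1 hv.2
  have h2 := (isDesc_iff hG).1 hx
  have h3 := hG.connected.dist_triangle (u := u) (v := v) (w := x)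
  have h4 := hG.connected.dist_triangle (u := root) (v := u) (w := x)
  have h5 := hmax x (by simp only [Finset.mem_filter, Finset.mem_univ, true_and]
                        exact (isDesc_iff hG).2 (by omega))
  exact (hG.connected.dist_eq_zero_iff.1 (by omega : G.dist v x = 0)).symm

/-- The height of a node is determined by the heights of its children. -/
theorem height_eq_sup (hG : G.IsTree) (u : Fin n) :
    height G root u = (children G root u).sup fun c => height G root c + 1 := by
  classical
  apply le_antisymm
  · refine Finset.sup_le fun v hv => ?_
    rw [Finset.mem_filter] at hv
    by_cases hne : v = u
    · subst hne; rw [G.dist_self]; exact Nat.zero_le _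
    · obtain ⟨c, hc, hcv⟩ := exists_child_of_isDesc hG hv.2.1 hne
      refine le_trans ?_ (Finset.le_sup hc)
      rw [(isDesc_of_mem_children hG hc hcv).2]
      refine Nat.succ_le_succ ?_
      exact Finset.le_sup (f := fun v => G.dist c v) (by
        rw [Finset.mem_filter]; exact ⟨Finset.mem_univ _, hcv, hv.2.2⟩)
  · refine Finset.sup_le fun c hc => ?_
    -- A supremum over the empty set would be 0 and would not be attained; a leaf below c makes it
    -- the distance to an actual leaf.
    have hne : (Finset.univ.filter fun v => IsDesc G root c v ∧ IsLeaf G root v).Nonempty := by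
      obtain ⟨v, h1, h2⟩ := exists_isLeaf hG (root := root) c
      exact ⟨v, by simp [h1, h2]⟩
    obtain ⟨v, hv, he⟩ := Finset.exists_mem_eq_sup _ hne fun v => G.dist c v
    rw [Finset.mem_filter] at hv
    obtain ⟨h1, h2⟩ := isDesc_of_mem_children hG hc hv.2.1
    have : height G root c = G.dist c v := he
    rw [this, ← h2]
    exact Finset.le_sup (f := fun v => G.dist u v) (by
      rw [Finset.mem_filter]; exact ⟨Finset.mem_univ _, h1, hv.2.2⟩)

theorem height_lt_of_mem_children (hG : G.IsTree) {u c : Fin n} (hc : c ∈ children G root u) :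
    height G root c < height G root u := by
  rw [height_eq_sup hG u]
  exact Finset.le_sup (f := fun c => height G root c + 1) hc

/-- In this form the recursion identifies the next level: it compares the deletion of all children
with a bound on the height. -/
theorem height_le_iff (hG : G.IsTree) {u : Fin n} {h : ℕ} :
    height G root u ≤ h ↔ ∀ c ∈ children G root u, height G root c < h := by
  rw [height_eq_sup hG u, Finset.sup_le_iff]
  rfl

theorem mem_children_root {v : Fin n} (h : G.Adj root v) : v ∈ children G root root := by
  rw [mem_children, SimpleGraph.dist_eq_one_iff_adj.2 h, G.dist_self]
  exact ⟨h, rfl⟩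

theorem root_notMem_children (u : Fin n) : root ∉ children G root u := by
  rw [mem_children, G.dist_self]; omega

/-- The parent is the last node before u on the path from the root. A neighbor off that path
prolongs it and is a child; a neighbor on it is the parent, as there are no cycles. -/
theorem exists_parent (hG : G.IsTree) {u : Fin n} (hu : u ≠ root) :
    ∃ p, u ∈ children G root p ∧ ∀ v, G.Adj u v → v = p ∨ v ∈ children G root u := by
  obtain ⟨q, hq, hl⟩ := hG.connected.exists_path_of_dist root u
  have key : ∀ v, G.Adj u v → v = q.penultimate ∨ v ∈ children G root u := by
    intro v hv
    by_cases hs : v ∈ q.support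
    · exact Or.inl (hG.isAcyclic.eq_penultimate_of_adj_end hq hv hs)
    · right
      obtain ⟨q', hq', hl'⟩ := hG.connected.exists_path_of_dist root v
      rw [(hG.existsUnique_path root v).unique hq' (hq.concat hs hv),
        SimpleGraph.Walk.length_concat] at hl'
      exact mem_children.2 ⟨hv, by omega⟩
  have hnil : ¬ q.Nil := fun h => hu h.eq.symm
  have hadj := q.adj_penultimate hnil
  refine ⟨q.penultimate, ?_, key⟩
  rw [mem_children]
  refine ⟨hadj, ?_⟩
  have h1 := SimpleGraph.dist_le q.dropLast
  rw [SimpleGraph.Walk.length_dropLast] at h1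
  have h2 := hG.connected.dist_triangle (u := root) (v := q.penultimate) (w := u)
  have h3 : G.dist q.penultimate u = 1 := SimpleGraph.dist_eq_one_iff_adj.2 hadj
  have : q.length ≠ 0 := fun h => hnil (SimpleGraph.Walk.length_eq_zero_iff.1 h)
  omega

/-- By `exists_parent`, a second parent would have to be a child of u, which contradicts its
distance from the root. -/
theorem parent_unique (hG : G.IsTree) {u p p' : Fin n} (h : u ∈ children G root p)
    (h' : u ∈ children G root p') : p = p' := by
  have hu : u ≠ root := by rintro rfl; exact root_notMem_children p h
  obtain ⟨q, -, hq⟩ := exists_parent hG hu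
  have key : ∀ p, u ∈ children G root p → p = q := by
    intro p hp
    obtain ⟨h1, h2⟩ := mem_children.1 hp
    refine (hq p h1.symm).resolve_right fun h3 => ?_
    have := (mem_children.1 h3).2
    omega
  rw [key p h, key p' h']

/-- The number of neighbors of a node that are not its children. -/
theorem card_children (hG : G.IsTree) {adj : Fin n → List (Fin n)} (ha : IsAdjacencyList G adj)
    (u : Fin n) : (children G root u).card = (adj u).length - if u = root then 0 else 1 := by
  have hl : (adj u).length = (adj u).toFinset.card :=
    (List.toFinset_card_of_nodup (ha u).1).symm
  rw [hl]
  split_ifs with hu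
  · subst hu
    rw [Nat.sub_zero]
    congr 1
    ext v
    rw [List.mem_toFinset, (ha u).2]
    exact ⟨fun h => (mem_children.1 h).1, mem_children_root⟩
  · obtain ⟨p, hp, hv⟩ := exists_parent hG hu
    obtain ⟨h1, h2⟩ := mem_children.1 hp
    rw [← Finset.card_erase_of_mem (a := p) (by rw [List.mem_toFinset, (ha u).2]; exact h1.symm)]
    congr 1
    ext v
    rw [Finset.mem_erase, List.mem_toFinset, (ha u).2]
    refine ⟨fun h => ⟨?_, (mem_children.1 h).1⟩, fun h => (hv v h.2).resolve_left h.1⟩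
    rintro rfl
    have := (mem_children.1 h).2
    omega

/-- Handshake lemma with n - 1 edges. This bounds the length of the input, the number of counter
bits and the time for scanning all neighbors. -/
theorem sum_length_adj (hG : G.IsTree) {adj : Fin n → List (Fin n)} (ha : IsAdjacencyList G adj) :
    ∑ u, (adj u).length + 2 = 2 * n := by
  classical
  have h1 : ∀ u, (adj u).length = G.degree u := by
    intro u
    rw [← List.toFinset_card_of_nodup (ha u).1, SimpleGraph.degree]
    congr 1
    ext v
    rw [List.mem_toFinset, (ha u).2, SimpleGraph.mem_neighborFinset]
  rw [Finset.sum_congr rfl fun u _ => h1 u, G.sum_degrees_eq_twice_card_edges]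
  have := hG.card_edgeFinset
  rw [Fintype.card_fin] at this
  omega

end RootedTree


/-! ### The adjacency array -/

theorem List.getElem?_flatMap_sum_length {α β : Type*} (f : α → List β) (l : List α) {i j : ℕ}
    (hi : i < l.length) (hj : j < (f l[i]).length) :
    (l.flatMap f)[((l.take i).map fun x => (f x).length).sum + j]? = (f l[i])[j]? := by
  induction l generalizing i with
  | nil => simp at hi
  | cons x l ih =>
    cases i with
    | zero =>
      simp only [List.getElem_cons_zero] at hj
      simp [List.getElem?_append_left hj]
    | succ i =>
      simp only [List.getElem_cons_succ] at hj ⊢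
      simp only [List.length_cons, Nat.add_lt_add_iff_right] at hi
      rw [← ih hi hj, List.flatMap_cons, List.getElem?_append_right]
      · simp [add_assoc]
      · simp [add_assoc]

namespace RootedTree

variable {n : ℕ} {adj : Fin n → List (Fin n)}

/-- The number of entries of the adjacency array that precede the neighbors of node `i`. -/
def offset (adj : Fin n → List (Fin n)) (i : ℕ) : ℕ :=
  (((List.finRange n).take i).map fun v => (adj v).length).sum

theorem offset_succ (adj : Fin n → List (Fin n)) (u : Fin n) :
    offset adj (u + 1) = offset adj u + (adj u).length := by
  unfold offset
  rw [List.take_add_one, List.map_append, List.sum_append]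
  simp

theorem offset_eq_sum (adj : Fin n → List (Fin n)) : offset adj n = ∑ u, (adj u).length := by
  unfold offset
  rw [List.take_of_length_le (by simp), Fin.sum_univ_def]

theorem offset_mono (adj : Fin n → List (Fin n)) : Monotone (offset adj) := by
  refine monotone_nat_of_le_succ fun i => ?_
  unfold offset
  rw [List.take_add_one, List.map_append, List.sum_append]
  exact Nat.le_add_right _ _

theorem offset_add_lt {u : Fin n} {j : ℕ} (hj : j < (adj u).length) :
    offset adj u + j < offset adj n := by
  have := offset_mono adj (show (u : ℕ) + 1 ≤ n by omega)
  rw [offset_succ] at this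
  omega

/-- The intervals between successive offsets are disjoint, so counters of different nodes share no
bits. -/
theorem eq_of_offset_add_eq {u v : Fin n} {i j : ℕ} (hi : i < (adj u).length)
    (hj : j < (adj v).length) (h : offset adj u + i = offset adj v + j) : u = v := by
  have h1 := offset_succ adj u
  have h2 := offset_succ adj v
  rcases lt_trichotomy (u : ℕ) v with huv | huv | huv
  · have := offset_mono adj (show (u : ℕ) + 1 ≤ v by omega); omega
  · exact Fin.ext huv
  · have := offset_mono adj (show (v : ℕ) + 1 ≤ u by omega); omega

theorem encode_eq (root : Fin n) (adj : Fin n → List (Fin n)) :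
    encode root adj = [n, (root : ℕ)] ++ (List.range (n + 1)).map (offset adj) ++
      (List.finRange n).flatMap (fun v => (adj v).map Fin.val) := by
  -- The coercion of a list of nodes in `encode` elaborates to a monadic bind.
  have h : ∀ l : List (Fin n), (do let a ← l; pure (a : ℕ) : List ℕ) = l.map Fin.val := by
    intro l
    induction l with
    | nil => rfl
    | cons x l ih => simpa using ih
  simp only [encode, h, List.map_id_fun', id]
  rfl

theorem length_encode (root : Fin n) (adj : Fin n → List (Fin n)) :
    (encode root adj).length = n + 3 + offset adj n := by
  rw [offset_eq_sum, encode_eq, Fin.sum_univ_def]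
  simp [List.length_flatMap]
  omega

theorem encode_zero (root : Fin n) (adj : Fin n → List (Fin n)) :
    (encode root adj)[0]? = some n := by
  simp [encode]

theorem encode_root (root : Fin n) (adj : Fin n → List (Fin n)) :
    (encode root adj)[1]? = some (root : ℕ) := by
  simp [encode]

theorem encode_offset (root : Fin n) (adj : Fin n → List (Fin n)) {i : ℕ} (hi : i ≤ n) :
    (encode root adj)[i + 2]? = some (offset adj i) := by
  have h : i < n + 1 := by omega
  rw [encode_eq, List.append_assoc, List.getElem?_append_right (by simp),
    List.getElem?_append_left]
  · simp [h]
  · simpa using h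

theorem encode_adj (root : Fin n) (adj : Fin n → List (Fin n)) {u : Fin n} {j : ℕ}
    (hj : j < (adj u).length) :
    (encode root adj)[offset adj u + j + (n + 3)]? = some ((adj u)[j] : ℕ) := by
  have h := List.getElem?_flatMap_sum_length (fun v => (adj v).map Fin.val)
    (List.finRange n) (i := u) (j := j) (by simp) (by simpa using hj)
  simp only [List.length_map, List.getElem_finRange] at h
  have e : offset adj u + j + (n + 3) - ([n, (root : ℕ)] ++ (List.range (n + 1)).map
      (offset adj)).length = offset adj u + j := by
    simp
  rw [encode_eq, List.getElem?_append_right (by simp), e]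
  refine h.trans ?_
  simp [hj]

theorem map_toNat_inputWords {w : ℕ} {root : Fin n} (h : ∀ x ∈ encode root adj, x < 2 ^ w) :
    (inputWords w root adj).map BitVec.toNat = encode root adj := by
  rw [inputWords, List.map_map]
  conv_rhs => rw [← List.map_id (encode root adj)]
  refine List.map_congr_left fun x hx => ?_
  simpa using Nat.mod_eq_of_lt (h x hx)

theorem le_of_mem_encode {root : Fin n} {x : ℕ} (h : x ∈ encode root adj) :
    x ≤ n + offset adj n := by
  simp only [encode_eq, List.mem_append, List.mem_map, List.mem_flatMap, List.mem_cons,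
    List.not_mem_nil, or_false, List.mem_range] at h
  rcases h with ((rfl | rfl) | ⟨i, hi, rfl⟩) | ⟨v, -, u, -, rfl⟩
  · omega
  · omega
  · exact (offset_mono adj (show i ≤ n by omega)).trans (by omega)
  · omega

end RootedTree


/-! ### The programs of the iterator -/

namespace HeightIterator

open WordRAM DictMachine RootedTree

/-- Reads the bounds of the list of neighbors of the node in register `x`. -/
def rangeProg (x : Fin 12) : DictProg :=
  .op 11 .add (.reg x) (.lit 2) ;;;
  .read 6 (.reg 11) ;;;
  .op 11 .add (.reg 11) (.lit 1) ;;;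
  .read 7 (.reg 11)

/-- Writes the binary representation of a number to the part of the counters between two bounds. -/
def fillLoop : DictProg :=
  .loop .lt (.reg 6) (.reg 7)
    (.op 11 .and (.reg 10) (.lit 1) ;;;
      .ite .eq (.reg 11) (.lit 1) (.insert 4 6) .skip ;;;
      .op 10 .shr (.reg 10) (.lit 1) ;;;
      .op 6 .add (.reg 6) (.lit 1))

/-- A node with k > 0 children receives the counter k - 1, so that underflow, and not the value 0,
signals the last child; a node without children joins the first level. Except at the root, one
neighbor is the parent and is not counted. Conventions: registers 0, 1 and 9 hold n, the root and n
+ 3, the start of the neighbor lists; 2 and 3 are argument and answer; 4 is the current node; 6 and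
7 bound an interval. -/
def initLoop : DictProg :=
  .loop .lt (.reg 4) (.reg 0)
    (rangeProg 4 ;;;
      .op 10 .sub (.reg 7) (.reg 6) ;;;
      .ite .eq (.reg 4) (.reg 1) .skip (.op 10 .sub (.reg 10) (.lit 1)) ;;;
      .ite .eq (.reg 10) (.lit 0) (.insert 1 4) (.op 10 .sub (.reg 10) (.lit 1) ;;; fillLoop) ;;;
      .op 4 .add (.reg 4) (.lit 1))

def initProg : DictProg :=
  .read 1 (.lit 1) ;;;
  .op 9 .add (.reg 0) (.lit 3) ;;;
  .op 4 .add (.lit 0) (.lit 0) ;;;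
  initLoop

/-- Looks for a neighbor that is not yet deleted. -/
def searchLoop : DictProg :=
  .loop .lt (.reg 6) (.reg 7)
    (.op 11 .add (.reg 6) (.reg 9) ;;;
      .read 5 (.reg 11) ;;;
      .ifMem 3 5 .skip (.op 8 .add (.reg 5) (.lit 0)) ;;;
      .op 6 .add (.reg 6) (.lit 1))

/-- Decrements a counter. -/
def decrLoop : DictProg :=
  .loop .lt (.reg 6) (.reg 7)
    (.ifMem 4 6
      (.erase 4 6 ;;; .op 7 .add (.lit 0) (.lit 0) ;;; .op 10 .add (.lit 1) (.lit 0))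
      (.insert 4 6 ;;; .op 6 .add (.reg 6) (.lit 1)))

/-- Register 8 receives the undeleted neighbor, which is the parent, or keeps n if there is none.
After `decrLoop`, the flag in register 10 is still 0 exactly if the counter contained no one; then
the deleted node was the last child and the parent is ready. -/
def deleteProg : DictProg :=
  .erase 1 4 ;;;
  .insert 0 4 ;;;
  .insert 3 4 ;;;
  rangeProg 4 ;;;
  .op 8 .add (.reg 0) (.lit 0) ;;;
  searchLoop ;;;
  .ite .lt (.reg 8) (.reg 0)
    (rangeProg 8 ;;;
      .op 10 .add (.lit 0) (.lit 0) ;;;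
      decrLoop ;;;
      .ite .eq (.reg 10) (.lit 0) (.insert 2 8) .skip)
    .skip

def deleteLoop : DictProg :=
  .loop .lt (.reg 4) (.reg 0) (deleteProg ;;; .choice 4 1)

def moveLoop : DictProg :=
  .loop .lt (.reg 4) (.reg 0) (.erase 2 4 ;;; .insert 1 4 ;;; .choice 4 2)

/-- The nodes of the current level are moved one by one into dictionary 0, from which the iteration
never reads; the client may therefore modify it freely. -/
def nextProg : DictProg :=
  .clear 0 ;;; .choice 4 1 ;;; deleteLoop ;;; .choice 4 2 ;;; moveLoop

def hasNextProg : DictProg :=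
  .choice 4 1 ;;;
  .ite .lt (.reg 4) (.reg 0) (.op 3 .add (.lit 1) (.lit 0)) (.op 3 .add (.lit 0) (.lit 0))

def containsProg : DictProg :=
  .ifMem 0 2 (.op 3 .add (.lit 1) (.lit 0)) (.op 3 .add (.lit 0) (.lit 0))

/-- The implementation of the iterator. -/
def impl : Impl where
  r := 25
  k := 20
  arg := up 2
  res := up 3
  init := setupProg ;; initProg.compile
  hasNext := hasNextProg.compile
  next := nextProg.compile
  add := (DictProg.insert 0 2).compile
  remove := (DictProg.erase 0 2).compile
  contains := containsProg.compile
  choice := (DictProg.choice 3 0).compile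
  clear := (DictProg.clear 0).compile

/-! ### Their loops -/

/-- The input memory holds the adjacency array, and words and dictionaries are long enough. -/
structure Setting {w B n : ℕ} (P : Params w B) (inp : List (BitVec w)) (root : Fin n)
    (adj : Fin n → List (Fin n)) : Prop where
  inp_eq : inp.map BitVec.toNat = encode root adj
  lt_two_pow : n + 3 + offset adj n < 2 ^ w
  offset_le : offset adj n ≤ 2 * n
  U_le : 2 * n ≤ P.U

/-- A set of nodes, as a set of numbers. -/
def nodes {n : ℕ} (D : Finset (Fin n)) : Finset ℕ := D.map Fin.valEmbedding

theorem mem_nodes {n : ℕ} {D : Finset (Fin n)} {x : ℕ} : x ∈ nodes D ↔ ∃ u ∈ D, (u : ℕ) = x := by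
  simp [nodes]

@[simp] theorem coe_mem_nodes {n : ℕ} {D : Finset (Fin n)} {u : Fin n} :
    (u : ℕ) ∈ nodes D ↔ u ∈ D := by
  simp [nodes, Fin.val_inj]

theorem nodes_insert {n : ℕ} (D : Finset (Fin n)) (u : Fin n) :
    nodes (insert u D) = insert (u : ℕ) (nodes D) := Finset.map_insert _ _ _

theorem nodes_erase {n : ℕ} (D : Finset (Fin n)) (u : Fin n) :
    nodes (D.erase u) = (nodes D).erase (u : ℕ) := Finset.map_erase _ _ _

theorem nodes_eq_empty {n : ℕ} {D : Finset (Fin n)} : nodes D = ∅ ↔ D = ∅ := Finset.map_eq_empty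

/-- The registers that are fixed after the initialization. -/
structure Std {n : ℕ} (root : Fin n) (a : DictState) : Prop where
  size : a.reg 0 = n
  root : a.reg 1 = root
  base : a.reg 9 = n + 3

/-- The two states agree on the registers that are used by loops over nodes. -/
def SameRegs (a a' : DictState) : Prop :=
  a'.reg 0 = a.reg 0 ∧ a'.reg 1 = a.reg 1 ∧ a'.reg 4 = a.reg 4 ∧ a'.reg 9 = a.reg 9

theorem Std.congr {n : ℕ} {root : Fin n} {a a' : DictState} (h : Std root a) (h' : SameRegs a a') :
    Std root a' :=
  ⟨h'.1.trans h.size, h'.2.1.trans h.root, h'.2.2.2.trans h.base⟩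

/-! ### Specifications of the inner loops -/

section

variable {w B n : ℕ} {P : Params w B} {inp : List (BitVec w)} {root : Fin n}
  {adj : Fin n → List (Fin n)} {a : DictState} {b : ℕ} {Q : DictState → ℕ → Prop}

theorem rangeProg_spec (hS : Setting P inp root adj) {x : Fin 12}
    {u : Fin n} (hu : a.reg x = u) (hb : 4 ≤ b)
    (hQ : Q (((((a.setReg 11 (u + 2)).setReg 6 (offset adj u)).setReg 11 (u + 2 + 1)).setReg 7
      (offset adj u + (adj u).length))) (b - 4)) :
    dwp P inp (rangeProg x) a b Q := by
  have h1 := P.small_lt (i := 1) (by norm_num)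
  have h2 := P.small_lt (i := 2) (by norm_num)
  have := hS.lt_two_pow
  have h3 : (u : ℕ) + 2 < 2 ^ w := by omega
  have h4 : (u : ℕ) + 2 + 1 < 2 ^ w := by omega
  have h5 := encode_offset root adj (i := u + 1) (by omega)
  rw [add_right_comm, offset_succ] at h5
  simp [rangeProg, dwp, Operand.Fits, DictState.val, BinOp.Fits, BinOp.val, hu, h1, h2, h3, h4,
    hS.inp_eq, encode_offset, h5]
  exact ⟨by omega, by omega, by omega, by omega, by simpa only [Nat.sub_sub] using hQ⟩

theorem fillLoop_spec (hS : Setting P inp root adj) {u : Fin n} {j x : ℕ}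
    (hj : j ≤ (adj u).length) (h6 : a.reg 6 = offset adj u + j)
    (h7 : a.reg 7 = offset adj u + (adj u).length) (h10 : a.reg 10 = x / 2 ^ j)
    (hb : 50 * ((adj u).length - j) + 1 ≤ b)
    (hQ : ∀ a' b', b ≤ b' + (50 * ((adj u).length - j) + 1) → SameRegs a a' →
      (∀ d, d ≠ 4 → a'.set d = a.set d) →
      (∀ e, e ∈ a'.set 4 ↔ e ∈ a.set 4 ∨
        ∃ i, j ≤ i ∧ i < (adj u).length ∧ x.testBit i = true ∧ e = offset adj u + i) → Q a' b') :
    DRuns P inp fillLoop a b Q := by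
  induction hk : (adj u).length - j generalizing j a b with
  | zero =>
    refine DRuns.loop trivial trivial (by omega) (fun hc => ?_) (fun hc => ?_)
    · simp only [Cmp.HoldsNat, DictState.val, h6, h7] at hc; omega
    · refine hQ _ _ (by omega) ⟨rfl, rfl, rfl, rfl⟩ (fun _ _ => rfl) fun e => ?_
      refine ⟨Or.inl, fun h => h.resolve_right ?_⟩
      rintro ⟨i, h1, h2, -⟩; omega
  | succ k ih =>
    have hlt := hS.lt_two_pow
    have hUl := hS.U_le
    have hol := hS.offset_le
    have hoff := offset_add_lt (adj := adj) (u := u) (j := j) (by omega)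
    have h1 := P.small_lt (i := 1) (by norm_num)
    have hU : offset adj u + j < P.U := by omega
    have hw : offset adj u + j + 1 < 2 ^ w := by omega
    refine DRuns.loop trivial trivial (by omega) (fun hc => ?_) (fun hc => ?_)
    · have hbit : x / 2 ^ j % 2 = 1 ↔ x.testBit j = true := by
        rw [Nat.testBit_eq_decide_div_mod_eq, decide_eq_true_eq]
      apply DRuns.of_dwp
      simp [dwp, Operand.Fits, DictState.val, BinOp.Fits, BinOp.val, h1, h6, h10, Cmp.HoldsNat, hU,
        hw]
      have hdiv : x / 2 ^ j / 2 = x / 2 ^ (j + 1) := by rw [Nat.div_div_eq_div_mul, pow_succ]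
      refine ⟨by omega, by omega, fun ht => ⟨by omega, by omega, by omega, ?_⟩,
        fun ht => ⟨by omega, by omega, by omega, ?_⟩⟩
      · refine ih (j := j + 1) (by omega) (by simp; omega) (by simp [h7]) (by simp [hdiv])
          (by omega) (fun a' b' hb' hr hs h4 => ?_) (by omega)
        refine hQ a' b' (by omega) (by simpa [SameRegs] using hr)
          (fun d hd => by rw [hs d hd]; simp [hd]) fun e => ?_
        rw [h4]
        simp only [DictState.setReg_set, DictState.setSet_set_self, Finset.mem_insert]
        constructor
        · rintro ((rfl | h) | ⟨i, e1, e2, e3, e4⟩)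
          · exact Or.inr ⟨j, le_rfl, by omega, hbit.1 ht, rfl⟩
          · exact Or.inl h
          · exact Or.inr ⟨i, by omega, e2, e3, e4⟩
        · rintro (h | ⟨i, e1, e2, e3, e4⟩)
          · exact Or.inl (Or.inr h)
          · rcases Nat.eq_or_lt_of_le e1 with rfl | e1
            · exact Or.inl (Or.inl e4)
            · exact Or.inr ⟨i, e1, e2, e3, e4⟩
      · refine ih (j := j + 1) (by omega) (by simp; omega) (by simp [h7]) (by simp [hdiv])
          (by omega) (fun a' b' hb' hr hs h4 => ?_) (by omega)
        refine hQ a' b' (by omega) (by simpa [SameRegs] using hr)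
          (fun d hd => by rw [hs d hd]; simp) fun e => ?_
        rw [h4]
        simp only [DictState.setReg_set]
        refine or_congr Iff.rfl ⟨?_, ?_⟩
        · rintro ⟨i, e1, e2, e3, e4⟩
          exact ⟨i, by omega, e2, e3, e4⟩
        · rintro ⟨i, e1, e2, e3, e4⟩
          rcases Nat.eq_or_lt_of_le e1 with rfl | e1
          · have := hbit.2 e3; omega
          · exact ⟨i, e1, e2, e3, e4⟩
    · simp only [Cmp.HoldsNat, DictState.val, h6, h7] at hc; omega

/-- The scan does not stop at a hit, since its cost is charged to the degree anyway. It promises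
just some undeleted neighbor; uniqueness comes from the tree where the loop is used. -/
theorem searchLoop_spec (hS : Setting P inp root adj) {u : Fin n} {j : ℕ} {D : Finset (Fin n)}
    (hj : j ≤ (adj u).length) (hstd : Std root a) (h3 : a.set 3 = nodes D)
    (h6 : a.reg 6 = offset adj u + j) (h7 : a.reg 7 = offset adj u + (adj u).length)
    (hb : 50 * ((adj u).length - j) + 1 ≤ b)
    (hQ : ∀ a' b', b ≤ b' + (50 * ((adj u).length - j) + 1) → SameRegs a a' → a'.set = a.set →
      (a'.reg 8 = a.reg 8 ∧ (∀ i (h : i < (adj u).length), j ≤ i → (adj u)[i] ∈ D)) ∨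
        (∃ v ∈ adj u, v ∉ D ∧ a'.reg 8 = v) → Q a' b') :
    DRuns P inp searchLoop a b Q := by
  induction hk : (adj u).length - j generalizing j a b with
  | zero =>
    refine DRuns.loop trivial trivial (by omega) (fun hc => ?_) (fun hc => ?_)
    · simp only [Cmp.HoldsNat, DictState.val, h6, h7] at hc; omega
    · refine hQ _ _ (by omega) ⟨rfl, rfl, rfl, rfl⟩ rfl (Or.inl ⟨rfl, fun i h hi => by omega⟩)
  | succ k ih =>
    have hlt := hS.lt_two_pow
    have hUl := hS.U_le
    have hj' : j < (adj u).length := by omega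
    have hoff := offset_add_lt (adj := adj) (u := u) hj'
    have h0 := P.small_lt (i := 0) (by norm_num)
    have h1 := P.small_lt (i := 1) (by norm_num)
    have hw : offset adj u + j + (n + 3) < 2 ^ w := by omega
    have hw1 : offset adj u + j + 1 < 2 ^ w := by omega
    have hU : ((adj u)[j] : ℕ) < P.U := by omega
    have hv : ((adj u)[j] : ℕ) < 2 ^ w := by omega
    have hin := encode_adj root adj hj'
    refine DRuns.loop trivial trivial (by omega) (fun hc => ?_) (fun hc => ?_)
    · apply DRuns.of_dwp
      simp [dwp, Operand.Fits, DictState.val, BinOp.Fits, BinOp.val, h0, h1, h6, hstd.base, hw,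
        hw1, hS.inp_eq, hin, hU, hv, h3]
      refine ⟨by omega, by omega, by omega, fun hD => ⟨by omega, by omega, ?_⟩,
        fun hD => ⟨by omega, by omega, ?_⟩⟩
      · refine ih (j := j + 1) (by omega) (hstd.congr (by simp [SameRegs])) (by simpa using h3)
          (by simp; omega) (by simp [h7]) (by omega) (fun a' b' hb' hr hs h8 => ?_) (by omega)
        refine hQ a' b' (by omega) (by simpa [SameRegs] using hr) (by simpa using hs) ?_
        refine h8.imp (fun ⟨e1, e2⟩ => ⟨by simpa using e1, fun i hi hji => ?_⟩) id
        rcases Nat.eq_or_lt_of_le hji with rfl | hji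
        · exact hD
        · exact e2 i hi hji
      · refine ih (j := j + 1) (by omega) (hstd.congr (by simp [SameRegs])) (by simpa using h3)
          (by simp; omega) (by simp [h7]) (by omega) (fun a' b' hb' hr hs h8 => ?_) (by omega)
        refine hQ a' b' (by omega) (by simpa [SameRegs] using hr) (by simpa using hs) (Or.inr ?_)
        rcases h8 with ⟨e1, -⟩ | h8
        · exact ⟨_, List.getElem_mem hj', hD, by simpa using e1⟩
        · exact h8
    · simp only [Cmp.HoldsNat, DictState.val, h6, h7] at hc; omega

/-- The effect of decrementing the counter between `o + j` and `o + l`. -/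
def Decremented (o l j : ℕ) (c c' : Finset ℕ) (flag : ℕ) : Prop :=
  (flag = 1 ∧ ∃ i, j ≤ i ∧ i < l ∧ o + i ∈ c ∧ (∀ i', j ≤ i' → i' < i → o + i' ∉ c) ∧
    ∀ e, e ∈ c' ↔ (e ∈ c ∨ ∃ i', j ≤ i' ∧ i' < i ∧ e = o + i') ∧ e ≠ o + i) ∨
  (flag = 0 ∧ (∀ i, j ≤ i → i < l → o + i ∉ c) ∧
    ∀ e, e ∈ c' ↔ e ∈ c ∨ ∃ i, j ≤ i ∧ i < l ∧ e = o + i)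

/-- The amortized bound. Every position passed turns a zero into a one and releases a credit of 100,
which pays for the round; the one that is finally erased costs a credit, which the constant 200
covers. -/
theorem decrLoop_spec (hS : Setting P inp root adj) {u : Fin n} {j : ℕ}
    (hj : j ≤ (adj u).length) (h6 : a.reg 6 = offset adj u + j)
    (h7 : a.reg 7 = offset adj u + (adj u).length) (h10 : a.reg 10 = 0)
    (hc : ∀ e ∈ a.set 4, e < offset adj n)
    (hb : 100 * (offset adj n - (a.set 4).card) + 200 ≤ b)
    (hQ : ∀ a' b', b + 100 * (a.set 4).card ≤ b' + 100 * (a'.set 4).card + 200 → SameRegs a a' →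
      a'.reg 8 = a.reg 8 → (∀ d, d ≠ 4 → a'.set d = a.set d) →
      (∀ e ∈ a'.set 4, e < offset adj n) →
      Decremented (offset adj u) (adj u).length j (a.set 4) (a'.set 4) (a'.reg 10) → Q a' b') :
    DRuns P inp decrLoop a b Q := by
  induction hk : (adj u).length - j generalizing j a b with
  | zero =>
    refine DRuns.loop trivial trivial (by omega) (fun hc => ?_) (fun _ => ?_)
    · simp only [Cmp.HoldsNat, DictState.val, h6, h7] at hc; omega
    · refine hQ _ _ (by omega) ⟨rfl, rfl, rfl, rfl⟩ rfl (fun _ _ => rfl) hc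
        (Or.inr ⟨h10, fun i h1 h2 => by omega, fun e => ⟨Or.inl, fun h => h.resolve_right ?_⟩⟩)
      rintro ⟨i, h1, h2, -⟩; omega
  | succ k ih =>
    have hlt := hS.lt_two_pow
    have hUl := hS.U_le
    have hol := hS.offset_le
    have hoff := offset_add_lt (adj := adj) (u := u) (j := j) (by omega)
    have h0 := P.small_lt (i := 0) (by norm_num)
    have h1 := P.small_lt (i := 1) (by norm_num)
    have hU : offset adj u + j < P.U := by omega
    have hw : offset adj u + j + 1 < 2 ^ w := by omega
    -- The number of zeros is a truncated difference; it changes by one with each insertion only as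
    -- long as the cardinality stays within the bound.
    have hcard : ∀ s : Finset ℕ, (∀ e ∈ s, e < offset adj n) → s.card ≤ offset adj n := by
      intro s hs
      simpa using Finset.card_le_card (s := s) (t := Finset.range (offset adj n))
        fun e he => Finset.mem_range.2 (hs e he)
    refine DRuns.loop trivial trivial (by omega) (fun _ => ?_) (fun hc => ?_)
    · apply DRuns.of_dwp
      simp [dwp, Operand.Fits, DictState.val, BinOp.Fits, BinOp.val, h0, h1, h6, hU, hw]
      refine ⟨by omega, fun hm => ⟨by omega, by omega, by omega, ?_⟩,
        fun hm => ⟨by omega, by omega, ?_⟩⟩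
      · have hpos := Finset.card_pos.2 ⟨_, hm⟩
        have hcd := hcard _ hc
        -- The upper bound in register 7 has been set to 0, so the loop ends here.
        refine DRuns.loop trivial trivial (by omega) (fun hc' => ?_) (fun _ => ?_)
        · simp [Cmp.HoldsNat, DictState.val] at hc'
        · refine hQ _ _ ?_ (by simp [SameRegs]) (by simp) (fun d hd => by simp [hd])
            (fun e he => hc e ?_) ?_
          · simp [Finset.card_erase_of_mem hm]; omega
          · simp at he; exact he.2
          · refine Or.inl ⟨by simp, j, le_rfl, by omega, hm, fun i' h1 h2 => by omega, fun e => ?_⟩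
            simp only [DictState.setReg_set, DictState.setSet_set_self, Finset.mem_erase]
            refine ⟨fun h => ⟨Or.inl h.2, h.1⟩, fun ⟨h, h'⟩ => ⟨h', h.resolve_right ?_⟩⟩
            rintro ⟨i, h1, h2, -⟩; omega
      · have hci : (insert (offset adj u + j) (a.set 4)).card = (a.set 4).card + 1 :=
          Finset.card_insert_of_notMem hm
        have hc' : ∀ e ∈ insert (offset adj u + j) (a.set 4), e < offset adj n := by
          intro e he
          rcases Finset.mem_insert.1 he with rfl | he
          · exact hoff
          · exact hc e he
        have hcd := hcard _ hc'
        refine ih (j := j + 1) (by omega) (by simp; omega) (by simp [h7]) (by simp [h10])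
          (by simpa using hc') (by simp [hci]; omega)
          (fun a' b' hb' hr h8 hs h4 hdec => ?_) (by omega)
        simp [hci] at hb' h8
        refine hQ a' b' (by omega) (by simpa [SameRegs] using hr) h8
          (fun d hd => by rw [hs d hd]; simp [hd]) h4 ?_
        simp only [DictState.setReg_set, DictState.setSet_set_self] at hdec
        rcases hdec with ⟨e1, i, e2, e3, e4, e5, e6⟩ | ⟨e1, e2, e3⟩
        · refine Or.inl ⟨e1, i, by omega, e3, ?_, fun i' f1 f2 => ?_, fun e => ?_⟩
          · exact (Finset.mem_insert.1 e4).resolve_left (by omega)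
          · rcases Nat.eq_or_lt_of_le f1 with rfl | f1
            · exact hm
            · exact fun h => e5 i' f1 f2 (Finset.mem_insert_of_mem h)
          · rw [e6, Finset.mem_insert]
            refine and_congr ⟨?_, ?_⟩ Iff.rfl
            · rintro ((rfl | h) | ⟨i', f1, f2, f3⟩)
              · exact Or.inr ⟨j, le_rfl, by omega, rfl⟩
              · exact Or.inl h
              · exact Or.inr ⟨i', by omega, f2, f3⟩
            · rintro (h | ⟨i', f1, f2, f3⟩)
              · exact Or.inl (Or.inr h)
              · rcases Nat.eq_or_lt_of_le f1 with rfl | f1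
                · exact Or.inl (Or.inl f3)
                · exact Or.inr ⟨i', f1, f2, f3⟩
        · refine Or.inr ⟨e1, fun i f1 f2 => ?_, fun e => ?_⟩
          · rcases Nat.eq_or_lt_of_le f1 with rfl | f1
            · exact hm
            · exact fun h => e2 i f1 f2 (Finset.mem_insert_of_mem h)
          · rw [e3, Finset.mem_insert]
            constructor
            · rintro ((rfl | h) | ⟨i', f1, f2, f3⟩)
              · exact Or.inr ⟨j, le_rfl, by omega, rfl⟩
              · exact Or.inl h
              · exact Or.inr ⟨i', by omega, f2, f3⟩
            · rintro (h | ⟨i', f1, f2, f3⟩)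
              · exact Or.inl (Or.inr h)
              · rcases Nat.eq_or_lt_of_le f1 with rfl | f1
                · exact Or.inl (Or.inl f3)
                · exact Or.inr ⟨i', f1, f2, f3⟩
    · simp only [Cmp.HoldsNat, DictState.val, h6, h7] at hc; omega

end

end HeightIterator


/-! ### The initialization of the iterator -/

namespace HeightIterator

open WordRAM DictMachine RootedTree

section

variable {w B n : ℕ} {P : Params w B} {inp : List (BitVec w)} {G : SimpleGraph (Fin n)}
  {root : Fin n} {adj : Fin n → List (Fin n)} {a : DictState} {b : ℕ}
  {Q : DictState → ℕ → Prop}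

/-- The nodes below `k` without children. -/
noncomputable def leavesBelow (G : SimpleGraph (Fin n)) (root : Fin n) (k : ℕ) : Finset (Fin n) :=
  Finset.univ.filter fun v => (v : ℕ) < k ∧ children G root v = ∅

/-- The initial counters of the nodes below `k`. -/
def CountersBelow (G : SimpleGraph (Fin n)) (root : Fin n) (adj : Fin n → List (Fin n)) (k : ℕ)
    (c : Finset ℕ) : Prop :=
  ∀ e, e ∈ c ↔ ∃ v : Fin n, (v : ℕ) < k ∧ ∃ i < (adj v).length,
    ((children G root v).card - 1).testBit i = true ∧ e = offset adj v + i

theorem one_le_length_adj (hG : G.IsTree) (ha : IsAdjacencyList G adj) {u : Fin n}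
    (hu : u ≠ root) : 1 ≤ (adj u).length := by
  obtain ⟨p, hp, -⟩ := exists_parent hG hu
  exact List.length_pos_of_mem (((ha u).2 p).2 (mem_children.1 hp).1.symm)

theorem leavesBelow_succ (u : Fin n) : leavesBelow G root (u + 1) =
    if children G root u = ∅ then insert u (leavesBelow G root u) else leavesBelow G root u := by
  have key : ∀ v : Fin n, (v : ℕ) < u + 1 ↔ v = u ∨ (v : ℕ) < u := fun v => by
    rw [Fin.ext_iff]; omega
  ext v
  split_ifs with h
  · simp only [leavesBelow, key, Finset.mem_filter, Finset.mem_univ, true_and, Finset.mem_insert]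
    constructor
    · rintro ⟨h1 | h1, h2⟩
      · exact Or.inl h1
      · exact Or.inr ⟨h1, h2⟩
    · rintro (rfl | ⟨h1, h2⟩)
      · exact ⟨Or.inl rfl, h⟩
      · exact ⟨Or.inr h1, h2⟩
  · simp only [leavesBelow, key, Finset.mem_filter, Finset.mem_univ, true_and]
    refine ⟨?_, fun ⟨h1, h2⟩ => ⟨Or.inr h1, h2⟩⟩
    rintro ⟨rfl | h1, h2⟩
    · exact absurd h2 h
    · exact ⟨h1, h2⟩

theorem CountersBelow.succ {u : Fin n} {c c' : Finset ℕ} (h : CountersBelow G root adj u c)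
    (h' : ∀ e, e ∈ c' ↔ e ∈ c ∨ ∃ i, 0 ≤ i ∧ i < (adj u).length ∧
      ((children G root u).card - 1).testBit i = true ∧ e = offset adj u + i) :
    CountersBelow G root adj (u + 1) c' := by
  intro e
  rw [h', h e]
  constructor
  · rintro (⟨v, h1, h2⟩ | ⟨i, -, h1, h2⟩)
    · exact ⟨v, by omega, h2⟩
    · exact ⟨u, by omega, i, h1, h2⟩
  · rintro ⟨v, h1, i, h2, h3⟩
    by_cases hv : v = u
    · subst hv; exact Or.inr ⟨i, by omega, h2, h3⟩
    · have : (v : ℕ) ≠ u := fun h => hv (Fin.ext h)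
      exact Or.inl ⟨v, by omega, i, h2, h3⟩

theorem initLoop_spec (hG : G.IsTree) (ha : IsAdjacencyList G adj) (hS : Setting P inp root adj)
    {k : ℕ} (hk : k ≤ n) (hstd : Std root a) (h4 : a.reg 4 = k)
    (hcur : a.set 1 = nodes (leavesBelow G root k)) (hctr : CountersBelow G root adj k (a.set 4))
    (hb : 100 * (n - k) + 50 * (offset adj n - offset adj k) + 1 ≤ b)
    (hQ : ∀ a' b', b ≤ b' + (100 * (n - k) + 50 * (offset adj n - offset adj k) + 1) →
      Std root a' → a'.set 1 = nodes (leavesBelow G root n) →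
      CountersBelow G root adj n (a'.set 4) → (∀ d, d ≠ 1 → d ≠ 4 → a'.set d = a.set d) →
      Q a' b') :
    DRuns P inp initLoop a b Q := by
  induction hj : n - k generalizing k a b with
  | zero =>
    obtain rfl : k = n := by omega
    refine DRuns.loop trivial trivial (by omega) (fun hc => ?_) (fun _ => ?_)
    · simp only [Cmp.HoldsNat, DictState.val, h4, hstd.size] at hc; omega
    · exact hQ _ _ (by omega) hstd hcur hctr fun _ _ _ => rfl
  | succ j ih =>
    obtain ⟨u, rfl⟩ : ∃ u : Fin n, (u : ℕ) = k := ⟨⟨k, by omega⟩, rfl⟩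
    have hlt := hS.lt_two_pow
    have hUl := hS.U_le
    have hmono := offset_mono adj (show (u : ℕ) + 1 ≤ n by omega)
    have hsucc := offset_succ adj u
    have h0 := P.small_lt (i := 0) (by norm_num)
    have h1 := P.small_lt (i := 1) (by norm_num)
    have huU : (u : ℕ) < P.U := by omega
    have hu1 : (u : ℕ) + 1 < 2 ^ w := by omega
    have hcard := card_children hG ha (root := root) u
    -- The root and the other nodes differ only in how the number of children is obtained; the rest
    -- of the round is treated once.
    have tail : ∀ (a₁ : DictState) b₁, Std root a₁ → a₁.reg 4 = u → a₁.set = a.set →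
        a₁.reg 6 = offset adj u → a₁.reg 7 = offset adj u + (adj u).length →
        a₁.reg 10 = (children G root u).card → b ≤ b₁ + 20 →
        dwp P inp (.ite .eq (.reg 10) (.lit 0) (.insert 1 4)
          (.op 10 .sub (.reg 10) (.lit 1) ;;; fillLoop) ;;; .op 4 .add (.reg 4) (.lit 1)) a₁ b₁
          fun a' b' => DRuns P inp initLoop a' b' Q := by
      intro a₁ b₁ s1 s4 hset s6 s7 s10 hb₁
      refine ⟨by omega, trivial, h0, fun hc => ?_, fun hc => ?_⟩
      · simp only [Cmp.HoldsNat, DictState.val, s10, Finset.card_eq_zero] at hc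
        simp [dwp, Operand.Fits, DictState.val, BinOp.Fits, BinOp.val, s4, h1, huU, hu1, hset]
        refine ⟨by omega, by omega, ?_⟩
        -- For a node without children the truncated difference 0 - 1 is 0, so `CountersBelow` asks
        -- for no bits.
        refine ih (k := u + 1) (by omega)
          ⟨by simp [s1.size], by simp [s1.root], by simp [s1.base]⟩ (by simp)
          (by simp [leavesBelow_succ, hc, nodes_insert, hcur])
          (hctr.succ fun e => by simp [hset, hc]) (by omega)
          (fun a' b' hb' e1 e2 e3 e4 => ?_) (by omega)
        refine hQ a' b' (by omega) e1 e2 e3 fun d hd1 hd4 => ?_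
        rw [e4 d hd1 hd4]
        simp [hd1, hset]
      · simp only [Cmp.HoldsNat, DictState.val, s10] at hc
        have hc' : children G root u ≠ ∅ := fun h => hc (Finset.card_eq_zero.2 h)
        refine ⟨by omega, trivial, h1, by simp only [BinOp.Fits, DictState.val, s10]; omega, ?_⟩
        refine fillLoop_spec hS (u := u) (j := 0) (x := (children G root u).card - 1) (by omega)
          (by simp [s6]) (by simp [s7]) (by simp [s10, DictState.val, BinOp.val]) (by omega) ?_
        intro a₂ b₂ hb₂ hr hs hc4
        obtain ⟨r0, r1, r4, r9⟩ := hr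
        simp at r0 r1 r4 r9
        simp only [DictState.setReg_set, hset] at hs hc4
        refine ⟨by omega, trivial, h1, by simpa [BinOp.Fits, DictState.val, r4, s4] using hu1, ?_⟩
        refine ih (k := u + 1) (by omega)
          ⟨by simp [r0, s1.size], by simp [r1, s1.root], by simp [r9, s1.base]⟩
          (by simp [DictState.val, BinOp.val, r4, s4])
          (by rw [DictState.setReg_set, hs 1 (by decide), hcur, leavesBelow_succ, if_neg hc'])
          (hctr.succ hc4) (by omega) (fun a' b' hb' e1 e2 e3 e4 => ?_) (by omega)
        refine hQ a' b' (by omega) e1 e2 e3 fun d hd1 hd4 => ?_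
        rw [e4 d hd1 hd4, DictState.setReg_set, hs d hd4]
    refine DRuns.loop trivial trivial (by omega) (fun _ => ?_) (fun hc => ?_)
    · apply DRuns.of_dwp
      refine rangeProg_spec hS h4 (by omega) ?_
      refine ⟨by omega, trivial, trivial, by simp [BinOp.Fits, DictState.val], ?_⟩
      refine ⟨by omega, trivial, trivial, fun hc => ?_, fun hc => ?_⟩
      · simp [Cmp.HoldsNat, DictState.val, h4, hstd.root, Fin.val_inj] at hc
        subst hc
        refine ⟨by omega, tail _ _ ⟨by simp [hstd.size], by simp [hstd.root], by simp [hstd.base]⟩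
          (by simp [h4]) (by simp) (by simp) (by simp) ?_ (by omega)⟩
        simp [hcard, DictState.val, BinOp.val]
      · simp [Cmp.HoldsNat, DictState.val, h4, hstd.root, Fin.val_inj] at hc
        have hle := one_le_length_adj hG ha hc
        refine ⟨by omega, trivial, h1, ?_, ?_⟩
        · simpa [BinOp.Fits, DictState.val, BinOp.val] using hle
        refine tail _ _ ⟨by simp [hstd.size], by simp [hstd.root], by simp [hstd.base]⟩
          (by simp [h4]) (by simp) (by simp) (by simp) ?_ (by omega)
        simp [hcard, DictState.val, BinOp.val, hc]
    · simp only [Cmp.HoldsNat, DictState.val, h4, hstd.size] at hc; omega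

end

end HeightIterator


/-! ### Processing the nodes of a level -/

namespace HeightIterator

open WordRAM DictMachine RootedTree

section

variable {w B n : ℕ} {P : Params w B} {inp : List (BitVec w)} {G : SimpleGraph (Fin n)}
  {root : Fin n} {adj : Fin n → List (Fin n)} {a : DictState} {b : ℕ}
  {Q : DictState → ℕ → Prop} {D : Finset (Fin n)}

/-- The counter of a node holds the number of its children outside of `D`, decremented by one. -/
structure Counters (G : SimpleGraph (Fin n)) (root : Fin n) (adj : Fin n → List (Fin n))
    (D : Finset (Fin n)) (c : Finset ℕ) : Prop where
  lt : ∀ e ∈ c, e < offset adj n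
  bits : ∀ p, (children G root p \ D).Nonempty → ∀ i < (adj p).length,
    offset adj p + i ∈ c ↔ ((children G root p \ D).card - 1).testBit i = true

theorem CountersBelow.counters {c : Finset ℕ} (h : CountersBelow G root adj n c) :
    Counters G root adj ∅ c := by
  refine ⟨fun e he => ?_, fun p _ i hi => ?_⟩
  · obtain ⟨v, -, i, hi, -, rfl⟩ := (h e).1 he
    exact offset_add_lt hi
  · rw [h, Finset.sdiff_empty]
    constructor
    · rintro ⟨v, -, j, hj, h1, h2⟩
      obtain rfl := eq_of_offset_add_eq hi hj h2
      obtain rfl : i = j := by omega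
      exact h1
    · intro h1
      exact ⟨p, p.2, i, hi, h1, rfl⟩

theorem sdiff_insert_of_notMem_children {p u : Fin n} (h : u ∉ children G root p) :
    children G root p \ insert u D = children G root p \ D := by
  ext v
  simp only [Finset.mem_sdiff, Finset.mem_insert, not_or]
  refine ⟨fun ⟨h1, h2⟩ => ⟨h1, h2.2⟩, fun ⟨h1, h2⟩ => ⟨h1, ?_, h2⟩⟩
  rintro rfl; exact h h1

/-- The root is nobody's child, so no counter is affected. -/
theorem Counters.insert_root {c : Finset ℕ} (h : Counters G root adj D c) :
    Counters G root adj (insert root D) c := by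
  refine ⟨h.lt, fun p => ?_⟩
  rw [sdiff_insert_of_notMem_children (root_notMem_children p)]
  exact h.bits p

/-- Only the counter of the parent changes, because parents are unique and intervals disjoint. If a
one was found, this is binary subtraction of one. If not, the counter was 0 and u was the last
child; the interval then holds meaningless ones, but `Counters` demands nothing of nodes without
remaining children. -/
theorem Counters.decrement (hG : G.IsTree) (ha : IsAdjacencyList G adj) {c c' : Finset ℕ}
    (h : Counters G root adj D c) {u p : Fin n} (hu : u ∉ D) (hp : u ∈ children G root p)
    {flag : ℕ} (hlt : ∀ e ∈ c', e < offset adj n)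
    (hd : Decremented (offset adj p) (adj p).length 0 c c' flag) :
    Counters G root adj (insert u D) c' ∧
      (flag = 0 ↔ children G root p ⊆ insert u D) := by
  have hup : u ∈ children G root p \ D := Finset.mem_sdiff.2 ⟨hp, hu⟩
  have hbits := h.bits p ⟨u, hup⟩
  have hrem : children G root p \ insert u D = (children G root p \ D).erase u := by
    ext v
    simp only [Finset.mem_sdiff, Finset.mem_insert, Finset.mem_erase, not_or]
    tauto
  have hcard : (children G root p \ insert u D).card = (children G root p \ D).card - 1 := by
    rw [hrem, Finset.card_erase_of_mem hup]
  set x := (children G root p \ D).card - 1 with hx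
  -- The whole counter fits into its interval, so an interval without ones means the value 0.
  have hxlt : x < 2 ^ (adj p).length := by
    have h1 : (children G root p \ D).card ≤ (adj p).length := by
      refine (Finset.card_le_card Finset.sdiff_subset).trans ?_
      rw [card_children hG ha]; omega
    have := Nat.lt_two_pow_self (n := (adj p).length)
    omega
  have hsub : children G root p ⊆ insert u D ↔ x = 0 := by
    rw [← hcard, Finset.card_eq_zero, Finset.sdiff_eq_empty_iff_subset]
  have other : ∀ p', p' ≠ p → (children G root p' \ insert u D).Nonempty →
      (∀ i < (adj p').length, (offset adj p' + i ∈ c' ↔ offset adj p' + i ∈ c)) →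
      ∀ i < (adj p').length, offset adj p' + i ∈ c' ↔
        ((children G root p' \ insert u D).card - 1).testBit i = true := by
    intro p' hp' hne hcc i hi
    rw [sdiff_insert_of_notMem_children fun h' => hp' (parent_unique hG h' hp)] at hne ⊢
    rw [hcc i hi, h.bits p' hne i hi]
  have far : ∀ p', p' ≠ p → ∀ i < (adj p').length, ∀ j < (adj p).length,
      offset adj p' + i ≠ offset adj p + j :=
    fun p' hp' i hi j hj e => hp' (eq_of_offset_add_eq hi hj e)
  rcases hd with ⟨hf, i, -, hi, hic, hlow, hc'⟩ | ⟨hf, hlow, hc'⟩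
  · have hxi : x.testBit i = true := (hbits i hi).1 hic
    have hx0 : x ≠ 0 := by rintro h0; rw [h0] at hxi; simp at hxi
    have hlow' : ∀ j < i, x.testBit j = false := fun j hj => by
      have := (hbits j (by omega)).not.1 (hlow j (by omega) hj)
      simpa using this
    refine ⟨⟨hlt, fun p' hne => ?_⟩, by rw [hsub]; omega⟩
    by_cases hp' : p' = p
    · subst hp'
      intro j hj
      rw [hc', hcard, BitTricks.testBit_pred hxi hlow']
      split_ifs with h1 h2
      · refine ⟨fun _ => rfl, fun _ => ⟨Or.inr ⟨j, by omega, h1, rfl⟩, by omega⟩⟩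
      · subst h2; simp
      · rw [← hbits j hj]
        refine ⟨fun h3 => h3.1.resolve_right ?_, fun h3 => ⟨Or.inl h3, by omega⟩⟩
        rintro ⟨i', -, h4, h5⟩; omega
    · refine other p' hp' hne fun j hj => ?_
      rw [hc']
      refine ⟨fun h3 => h3.1.resolve_right ?_, fun h3 => ⟨Or.inl h3, far p' hp' j hj i hi⟩⟩
      rintro ⟨i', -, h4, h5⟩
      exact far p' hp' j hj i' (by omega) h5
  · have hx0 : x = 0 := by
      refine Nat.eq_of_testBit_eq fun j => ?_
      rw [Nat.zero_testBit]
      rcases Nat.lt_or_ge j (adj p).length with hj | hj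
      · have := (hbits j hj).not.1 (hlow j (by omega) hj)
        simpa using this
      · exact Nat.testBit_eq_false_of_lt
          (hxlt.trans_le (Nat.pow_le_pow_right (by norm_num) hj))
    refine ⟨⟨hlt, fun p' hne => ?_⟩, by rw [hsub]; omega⟩
    by_cases hp' : p' = p
    · subst hp'
      exact absurd (Finset.card_pos.2 hne) (by omega)
    · refine other p' hp' hne fun j hj => ?_
      rw [hc']
      refine ⟨fun h3 => h3.resolve_right ?_, fun h3 => Or.inl h3⟩
      rintro ⟨i', -, h4, h5⟩
      exact far p' hp' j hj i' (by omega) h5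

/-- The nodes of height `h` in `D`. -/
noncomputable def doneNodes (G : SimpleGraph (Fin n)) (root : Fin n) (h : ℕ) (D : Finset (Fin n)) :
    Finset (Fin n) :=
  Finset.univ.filter fun v => height G root v = h ∧ v ∈ D

/-- The nodes of height `h` outside of `D`. -/
noncomputable def todoNodes (G : SimpleGraph (Fin n)) (root : Fin n) (h : ℕ) (D : Finset (Fin n)) :
    Finset (Fin n) :=
  Finset.univ.filter fun v => height G root v = h ∧ v ∉ D

/-- The nodes of height greater than `h` whose children belong to `D`. -/
noncomputable def readyNodes (G : SimpleGraph (Fin n)) (root : Fin n) (h : ℕ) (D : Finset (Fin n)) :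
    Finset (Fin n) :=
  Finset.univ.filter fun v => h < height G root v ∧ children G root v ⊆ D

/-- The state while the nodes of height `h` are deleted; `D` is the set of deleted nodes. -/
structure Round (G : SimpleGraph (Fin n)) (root : Fin n) (adj : Fin n → List (Fin n)) (h : ℕ)
    (D : Finset (Fin n)) (a : DictState) : Prop where
  std : Std root a
  below : ∀ v, height G root v < h → v ∈ D
  above : ∀ v ∈ D, height G root v ≤ h
  client : a.set 0 = nodes (doneNodes G root h D)
  current : a.set 1 = nodes (todoNodes G root h D)
  ready : a.set 2 = nodes (readyNodes G root h D)
  deleted : a.set 3 = nodes D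
  counters : Counters G root adj D (a.set 4)

/-- The potential of the nodes that have not been deleted. -/
def weight (adj : Fin n → List (Fin n)) (D : Finset (Fin n)) : ℕ :=
  ∑ v ∈ Dᶜ, (50 * (adj v).length + 2000)

theorem weight_insert {u : Fin n} (hu : u ∉ D) :
    weight adj D = weight adj (insert u D) + (50 * (adj u).length + 2000) := by
  unfold weight
  rw [Finset.compl_insert, Finset.sum_erase_add _ _ (Finset.mem_compl.2 hu)]

theorem doneNodes_insert {h : ℕ} {u : Fin n} (hh : height G root u = h) :
    doneNodes G root h (insert u D) = insert u (doneNodes G root h D) := by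
  ext v
  simp only [doneNodes, Finset.mem_filter, Finset.mem_univ, true_and, Finset.mem_insert]
  constructor
  · rintro ⟨h1, rfl | h2⟩
    · exact Or.inl rfl
    · exact Or.inr ⟨h1, h2⟩
  · rintro (rfl | ⟨h1, h2⟩)
    · exact ⟨hh, Or.inl rfl⟩
    · exact ⟨h1, Or.inr h2⟩

theorem todoNodes_insert {h : ℕ} {u : Fin n} :
    todoNodes G root h (insert u D) = (todoNodes G root h D).erase u := by
  ext v
  simp only [todoNodes, Finset.mem_filter, Finset.mem_univ, true_and, Finset.mem_insert,
    Finset.mem_erase]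
  tauto

theorem readyNodes_insert_root {h : ℕ} :
    readyNodes G root h (insert root D) = readyNodes G root h D := by
  ext v
  simp only [readyNodes, Finset.mem_filter, Finset.mem_univ, true_and,
    Finset.subset_insert_iff_of_notMem (root_notMem_children v)]

/-- Only the parent of u has u among its children, so no other node can become ready. -/
theorem readyNodes_insert (hG : G.IsTree) {h : ℕ} {u p : Fin n} (hp : u ∈ children G root p)
    (hu : u ∉ D) (hh : height G root u = h) :
    readyNodes G root h (insert u D) =
      if children G root p ⊆ insert u D then insert p (readyNodes G root h D)
      else readyNodes G root h D := by
  have hlt := height_lt_of_mem_children hG hp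
  have key : ∀ v, v ≠ p → (children G root v ⊆ insert u D ↔ children G root v ⊆ D) := fun v hv =>
    Finset.subset_insert_iff_of_notMem fun h' => hv (parent_unique hG h' hp)
  ext v
  by_cases hv : v = p
  · subst hv
    split_ifs with h1
    · simp [readyNodes, h1, ← hh, hlt]
    · have h2 : ¬ children G root v ⊆ D := fun h2 => hu (h2 hp)
      simp [readyNodes, h1, h2]
  · split_ifs with h1 <;> simp [readyNodes, hv, key v hv]

end

end HeightIterator


/-! ### The specification of `next` -/

namespace HeightIterator

open WordRAM DictMachine RootedTree

section

variable {w B n : ℕ} {P : Params w B} {inp : List (BitVec w)} {G : SimpleGraph (Fin n)}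
  {root : Fin n} {adj : Fin n → List (Fin n)} {a : DictState} {b : ℕ}
  {Q : DictState → ℕ → Prop} {D : Finset (Fin n)}

/-- The number of steps that are reserved for the deletion of the remaining nodes. -/
def potential (adj : Fin n → List (Fin n)) (D : Finset (Fin n)) (a : DictState) : ℕ :=
  weight adj D + 100 * (offset adj n - (a.set 4).card) + 200 * (a.set 2).card

theorem Counters.card_le {c : Finset ℕ} (h : Counters G root adj D c) : c.card ≤ offset adj n := by
  simpa using Finset.card_le_card (s := c) (t := Finset.range (offset adj n))
    fun e he => Finset.mem_range.2 (h.lt e he)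

/-- The weight of u pays for the scan of its neighbors, the constant part of the decrement, a
possible new ready node, and a surplus of 1000. The budget may start up to 500 short of the
potential, which this surplus makes good. -/
theorem deleteProg_spec (hG : G.IsTree) (ha : IsAdjacencyList G adj) (hS : Setting P inp root adj)
    {h : ℕ} {u : Fin n} (hr : Round G root adj h D a) (hu : u ∉ D) (hh : height G root u = h)
    (h4 : a.reg 4 = u) (hb : potential adj D a ≤ b + 500)
    (hQ : ∀ a' b', Round G root adj h (insert u D) a' →
      potential adj (insert u D) a' + b + 1000 ≤ b' + potential adj D a → Q a' b') :
    dwp P inp deleteProg a b Q := by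
  have hlt := hS.lt_two_pow
  have hUl := hS.U_le
  have h0 := P.small_lt (i := 0) (by norm_num)
  have h1 := P.small_lt (i := 1) (by norm_num)
  have huU : (u : ℕ) < P.U := by omega
  have hwt := weight_insert (adj := adj) hu
  have hcl := hr.counters.card_le
  -- Children have smaller height and were deleted in earlier rounds, so an undeleted neighbor must
  -- be the parent.
  have hchild : ∀ v ∈ children G root u, v ∈ insert u D := fun v hv =>
    Finset.mem_insert_of_mem (hr.below v (hh ▸ height_lt_of_mem_children hG hv))
  have habove : ∀ v ∈ insert u D, height G root v ≤ h := fun v hv => by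
    rcases Finset.mem_insert.1 hv with rfl | hv
    · exact hh.le
    · exact hr.above v hv
  have hbelow : ∀ v, height G root v < h → v ∈ insert u D := fun v hv =>
    Finset.mem_insert_of_mem (hr.below v hv)
  unfold potential at hb hQ
  have hclient := hr.client
  have hcurrent := hr.current
  have hdeleted := hr.deleted
  refine ⟨by omega, by rw [h4]; exact huU, by omega, by simpa [h4] using huU, by omega,
    by simpa [h4] using huU, ?_⟩
  refine rangeProg_spec hS (u := u) (by simpa using h4) (by omega) ?_
  refine ⟨by omega, trivial, h0, ?_, ?_⟩
  · simp [BinOp.Fits, DictState.val, hr.std.size]; omega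
  refine searchLoop_spec hS (u := u) (j := 0) (D := insert u D) (by omega)
    ⟨by simp [hr.std.size], by simp [hr.std.root], by simp [hr.std.base]⟩
    (by simp [hdeleted, nodes_insert, h4]) (by simp) (by simp) (by omega) ?_
  intro a₂ b₂ hb₂ hsame hset hsearch
  have e0 : a₂.set 0 = nodes (doneNodes G root h (insert u D)) := by
    rw [hset, doneNodes_insert hh, nodes_insert]; simp [hclient, h4]
  have e1 : a₂.set 1 = nodes (todoNodes G root h (insert u D)) := by
    rw [hset, todoNodes_insert, nodes_erase]; simp [hcurrent, h4]
  have e2 : a₂.set 2 = a.set 2 := by rw [hset]; simp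
  have e3 : a₂.set 3 = nodes (insert u D) := by
    rw [hset, nodes_insert]; simp [hdeleted, h4]
  have e4 : a₂.set 4 = a.set 4 := by rw [hset]; simp
  obtain ⟨s0, s1, s4, s9⟩ := hsame
  simp at s0 s1 s4 s9
  have hstd : Std root a₂ := ⟨s0.trans hr.std.size, s1.trans hr.std.root, s9.trans hr.std.base⟩
  clear hset
  by_cases hroot : u = root
  · have h8 : a₂.reg 8 = n := by
      rcases hsearch with ⟨h8, -⟩ | ⟨v, hv, hvD, -⟩
      · rw [h8]; simp [DictState.val, BinOp.val, hr.std.size]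
      · have := ((ha u).2 v).1 hv
        rw [hroot] at this
        exact absurd (hchild v (by rw [hroot]; exact mem_children_root this)) hvD
    clear hsearch
    refine ⟨by omega, trivial, trivial, fun hc => ?_, fun _ => ?_⟩
    · simp only [Cmp.HoldsNat, DictState.val, h8, hstd.size] at hc; omega
    refine ⟨by omega, hQ _ _ ⟨hstd, hbelow, habove, e0, e1, ?_, e3, ?_⟩ ?_⟩
    · rw [e2, hr.ready, hroot, readyNodes_insert_root]
    · rw [e4, hroot]; exact hr.counters.insert_root
    · rw [e4, e2]; omega
  · obtain ⟨p, hp, hnb⟩ := exists_parent hG hroot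
    have hpu := height_lt_of_mem_children hG hp
    -- The parent has height greater than h, whereas all deleted nodes have height at most h.
    have hpD : p ∉ insert u D := fun h' => by have := habove p h'; omega
    have hpadj : p ∈ adj u := ((ha u).2 p).2 (mem_children.1 hp).1.symm
    have h8 : a₂.reg 8 = p := by
      rcases hsearch with ⟨-, hall⟩ | ⟨v, hv, hvD, h8⟩
      · obtain ⟨i, hi, hi'⟩ := List.getElem_of_mem hpadj
        exact absurd (hi' ▸ hall i hi (by omega)) hpD
      · rcases hnb v (((ha u).2 v).1 hv) with rfl | hv'
        · exact h8
        · exact absurd (hchild v hv') hvD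
    clear hsearch
    have hpU : (p : ℕ) < P.U := by omega
    refine ⟨by omega, trivial, trivial, fun _ => ?_, fun hc => ?_⟩
    · refine rangeProg_spec hS (u := p) h8 (by omega) ?_
      refine ⟨by omega, h0, h0, by simp [BinOp.Fits, DictState.val], ?_⟩
      refine decrLoop_spec hS (u := p) (j := 0) (by omega) (by simp) (by simp)
        (by simp [BinOp.val, DictState.val]) (by simpa [e4] using hr.counters.lt)
        (by simp [e4]; omega) ?_
      intro a₃ b₃ hb₃ hsame₃ h8₃ hset₃ hlt₃ hdec
      simp [e4, h8] at hb₃ h8₃ hdec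
      simp at hset₃
      obtain ⟨t0, t1, t4, t9⟩ := hsame₃
      simp at t0 t1 t4 t9
      obtain ⟨hcnt, hflag⟩ := hr.counters.decrement hG ha hu hp hlt₃ hdec
      have hcl' := hcnt.card_le
      have hstd₃ : Std root a₃ :=
        ⟨t0.trans hstd.size, t1.trans hstd.root, t9.trans hstd.base⟩
      refine ⟨by omega, trivial, h0, fun hc => ?_, fun hc => ?_⟩
      · simp only [Cmp.HoldsNat, DictState.val] at hc
        refine ⟨by omega, by rw [h8₃]; exact hpU, ?_⟩
        refine hQ _ _ ⟨⟨hstd₃.size, hstd₃.root, hstd₃.base⟩, hbelow, habove, ?_, ?_, ?_, ?_, ?_⟩ ?_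
        · simpa [hset₃ 0] using e0
        · simpa [hset₃ 1] using e1
        · rw [DictState.setSet_set_self, h8₃, hset₃ 2 (by decide), e2, hr.ready,
            readyNodes_insert hG hp hu hh, if_pos (hflag.1 hc), nodes_insert]
        · simpa [hset₃ 3] using e3
        · simpa using hcnt
        · simp only [DictState.setSet_set_self, h8₃, hset₃ 2 (by decide), e2]
          rw [DictState.setSet_set_of_ne _ (by decide)]
          have := Finset.card_insert_le (p : ℕ) (a.set 2)
          omega
      · simp only [Cmp.HoldsNat, DictState.val] at hc
        refine ⟨by omega, hQ _ _ ⟨hstd₃, hbelow, habove, ?_, ?_, ?_, ?_, hcnt⟩ ?_⟩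
        · rw [hset₃ 0 (by decide), e0]
        · rw [hset₃ 1 (by decide), e1]
        · rw [hset₃ 2 (by decide), e2, hr.ready,
            readyNodes_insert hG hp hu hh, if_neg fun h' => hc (hflag.2 h')]
        · rw [hset₃ 3 (by decide), e3]
        · rw [hset₃ 2 (by decide), e2]; omega
    · simp only [Cmp.HoldsNat, DictState.val, h8, hstd.size] at hc; omega

end

end HeightIterator


/-! ### The operations of the iterator -/

namespace HeightIterator

open WordRAM DictMachine RootedTree

section

variable {w B n : ℕ} {P : Params w B} {inp : List (BitVec w)} {G : SimpleGraph (Fin n)}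
  {root : Fin n} {adj : Fin n → List (Fin n)} {a : DictState} {b : ℕ}
  {Q : DictState → ℕ → Prop} {D : Finset (Fin n)}

/-- The number `x` is an element of `S`, or `n` if `S` is empty. -/
def IsChoice (S : Finset (Fin n)) (x : ℕ) : Prop :=
  (∃ u ∈ S, x = (u : ℕ)) ∨ S = ∅ ∧ x = n

theorem choice_spec (hstd : Std root a) {d : Fin 5} {y : Fin 12} {S : Finset (Fin n)}
    (hd : a.set d = nodes S) (hb : 40 ≤ b)
    (hQ : ∀ x, IsChoice S x → Q (a.setReg y x) (b - 40)) :
    dwp P inp (.choice y d) a b Q := by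
  refine ⟨hb, fun v hv => hQ v ?_, fun he => hQ _ ?_⟩
  · rw [hd, mem_nodes] at hv
    obtain ⟨u, hu, rfl⟩ := hv
    exact Or.inl ⟨u, hu, rfl⟩
  · rw [hd, nodes_eq_empty] at he
    exact Or.inr ⟨he, hstd.size⟩

theorem Std.setReg (h : Std root a) {i : Fin 12} (x : ℕ) (h0 : i ≠ 0 := by decide)
    (h1 : i ≠ 1 := by decide) (h9 : i ≠ 9 := by decide) : Std root (a.setReg i x) :=
  ⟨by simp [h0.symm, h.size], by simp [h1.symm, h.root], by simp [h9.symm, h.base]⟩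

theorem Round.setReg {h : ℕ} (hr : Round G root adj h D a) {i : Fin 12} (x : ℕ)
    (h0 : i ≠ 0 := by decide) (h1 : i ≠ 1 := by decide) (h9 : i ≠ 9 := by decide) :
    Round G root adj h D (a.setReg i x) :=
  ⟨hr.std.setReg x h0 h1 h9, hr.below, hr.above, hr.client, hr.current, hr.ready, hr.deleted,
    hr.counters⟩

/-- The loop may begin with a deficit of 500 if there is a node to delete, because the first
deletion repays it. This lets a call of `next` spend a constant before any credit is released. -/
theorem deleteLoop_spec (hG : G.IsTree) (ha : IsAdjacencyList G adj) (hS : Setting P inp root adj)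
    {h : ℕ} (hr : Round G root adj h D a) (h4 : IsChoice (todoNodes G root h D) (a.reg 4))
    (hb : potential adj D a + 100 ≤ b + if todoNodes G root h D = ∅ then 0 else 500)
    (hQ : ∀ D' a' b', Round G root adj h D' a' → todoNodes G root h D' = ∅ →
      potential adj D' a' + 99 ≤ b' → Q a' b') :
    DRuns P inp deleteLoop a b Q := by
  induction hk : (todoNodes G root h D).card generalizing D a b with
  | zero =>
    rw [Finset.card_eq_zero] at hk
    rw [if_pos hk] at hb
    refine DRuns.loop trivial trivial (by omega) (fun hc => ?_) (fun _ => ?_)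
    · simp only [Cmp.HoldsNat, DictState.val, hr.std.size] at hc
      rcases h4 with ⟨u, hu, -⟩ | ⟨-, h4⟩
      · rw [hk] at hu; exact absurd hu (Finset.notMem_empty u)
      · omega
    · exact hQ D _ _ hr hk (by omega)
  | succ k ih =>
    have hne : todoNodes G root h D ≠ ∅ := by
      intro h0; rw [h0, Finset.card_empty] at hk; omega
    rw [if_neg hne] at hb
    obtain ⟨u, hu, h4⟩ := h4.resolve_right fun h0 => hne h0.1
    have hu' := hu
    simp only [todoNodes, Finset.mem_filter, Finset.mem_univ, true_and] at hu'
    have hw := weight_insert (adj := adj) hu'.2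
    have hpot : 2000 ≤ potential adj D a := by unfold potential; omega
    refine DRuns.loop trivial trivial (by omega) (fun _ => ?_) (fun hc => ?_)
    · apply DRuns.of_dwp
      refine deleteProg_spec hG ha hS hr hu'.2 hu'.1 h4 (by omega) fun a' b' hr' hp' => ?_
      refine choice_spec hr'.std hr'.current (by omega) fun x hx => ?_
      refine ih (hr'.setReg x) (by simpa using hx) ?_ ?_
      · have : potential adj (insert u D) (a'.setReg 4 x) = potential adj (insert u D) a' := rfl
        rw [this]; omega
      · rw [todoNodes_insert, Finset.card_erase_of_mem hu, hk]; rfl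
    · simp only [Cmp.HoldsNat, DictState.val, hr.std.size, h4] at hc; omega

theorem moveLoop_spec (hS : Setting P inp root adj) (hstd : Std root a) {C N : Finset (Fin n)}
    (h1 : a.set 1 = nodes C) (h2 : a.set 2 = nodes N) (h4 : IsChoice N (a.reg 4))
    (hb : 130 * N.card + 1 ≤ b)
    (hQ : ∀ a' b', b ≤ b' + (130 * N.card + 1) → Std root a' → a'.set 1 = nodes (C ∪ N) →
      a'.set 2 = ∅ → (∀ d, d ≠ 1 → d ≠ 2 → a'.set d = a.set d) → Q a' b') :
    DRuns P inp moveLoop a b Q := by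
  induction hk : N.card generalizing C N a b with
  | zero =>
    rw [Finset.card_eq_zero] at hk
    subst hk
    refine DRuns.loop trivial trivial (by omega) (fun hc => ?_) (fun _ => ?_)
    · simp only [Cmp.HoldsNat, DictState.val, hstd.size] at hc
      rcases h4 with ⟨u, hu, -⟩ | ⟨-, h4⟩
      · exact absurd hu (Finset.notMem_empty u)
      · omega
    · exact hQ _ _ (by omega) hstd (by rw [h1, Finset.union_empty]) (by rw [h2]; rfl)
        fun _ _ _ => rfl
  | succ k ih =>
    have hne : N ≠ ∅ := by
      intro h0; rw [h0, Finset.card_empty] at hk; omega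
    obtain ⟨u, hu, h4⟩ := h4.resolve_right fun h0 => hne h0.1
    have hUl := hS.U_le
    have huU : (u : ℕ) < P.U := by omega
    have hcard : (N.erase u).card = k := by rw [Finset.card_erase_of_mem hu, hk]; rfl
    refine DRuns.loop trivial trivial (by omega) (fun _ => ?_) (fun hc => ?_)
    · apply DRuns.of_dwp
      refine ⟨by omega, by rw [h4]; exact huU, by omega, by simpa [h4] using huU, ?_⟩
      change dwp P inp (.choice 4 2) ((a.setSet 2 ((a.set 2).erase (a.reg 4))).setSet 1
        (insert (a.reg 4) (a.set 1))) (b - 1 - 40 - 40) _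
      refine choice_spec (root := root) (S := N.erase u) ?_ ?_ ?_ fun x hx => ?_
      · exact ⟨hstd.size, hstd.root, hstd.base⟩
      · simp [h2, h4, nodes_erase]
      · omega
      refine ih (C := insert u C) (N := N.erase u)
        ⟨hstd.size, hstd.root, hstd.base⟩
        (by simp [h1, h4, nodes_insert]) (by simp [h2, h4, nodes_erase]) (by simpa using hx)
        (by omega) (fun a' b' hb' e1 e2 e3 e4 => ?_) hcard
      refine hQ a' b' (by omega) e1 ?_ e3 fun d hd1 hd2 => ?_
      · rw [e2]
        congr 1
        ext v
        simp only [Finset.mem_union, Finset.mem_insert, Finset.mem_erase]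
        by_cases hv : v = u
        · subst hv; simp [hu]
        · simp [hv]
      · rw [e4 d hd1 hd2]; simp [hd1, hd2]
    · simp only [Cmp.HoldsNat, DictState.val, hstd.size, h4] at hc; omega

/-- The nodes of height less than `h`. -/
noncomputable def lowNodes (G : SimpleGraph (Fin n)) (root : Fin n) (h : ℕ) : Finset (Fin n) :=
  Finset.univ.filter fun v => height G root v < h

theorem mem_lowNodes {h : ℕ} {v : Fin n} : v ∈ lowNodes G root h ↔ height G root v < h := by
  simp [lowNodes]

theorem mem_level {h : ℕ} {v : Fin n} : v ∈ level G root h ↔ height G root v = h := by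
  simp [level]

/-- The state between the calls of a client with the view `x`. -/
structure Idle (G : SimpleGraph (Fin n)) (root : Fin n) (adj : Fin n → List (Fin n)) (x : View n)
    (a : DictState) : Prop where
  std : Std root a
  client : a.set 0 = nodes x.S
  current : a.set 1 = nodes (level G root x.h)
  ready : a.set 2 = ∅
  deleted : a.set 3 = nodes (lowNodes G root x.h)
  counters : Counters G root adj (lowNodes G root x.h) (a.set 4)

theorem Idle.setReg {x : View n} (hr : Idle G root adj x a) {i : Fin 12} (y : ℕ)
    (h0 : i ≠ 0 := by decide) (h1 : i ≠ 1 := by decide) (h9 : i ≠ 9 := by decide) :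
    Idle G root adj x (a.setReg i y) :=
  ⟨hr.std.setReg y h0 h1 h9, hr.client, hr.current, hr.ready, hr.deleted, hr.counters⟩

theorem Idle.setClient {x : View n} (hr : Idle G root adj x a) (S : Finset (Fin n)) :
    Idle G root adj ⟨x.h, S⟩ (a.setSet 0 (nodes S)) :=
  ⟨⟨hr.std.size, hr.std.root, hr.std.base⟩, by simp, by simpa using hr.current,
    by simpa using hr.ready, by simpa using hr.deleted, by simpa using hr.counters⟩

theorem Idle.round (hG : G.IsTree) {x : View n} (hi : Idle G root adj x a) :
    Round G root adj x.h (lowNodes G root x.h) (a.setSet 0 ∅) := by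
  refine ⟨⟨hi.std.size, hi.std.root, hi.std.base⟩, fun v hv => mem_lowNodes.2 hv,
    fun v hv => (mem_lowNodes.1 hv).le, ?_, ?_, ?_, ?_, ?_⟩
  · rw [DictState.setSet_set_self, eq_comm, nodes_eq_empty]
    ext v
    simp only [doneNodes, Finset.mem_filter, mem_lowNodes, Finset.notMem_empty]
    constructor
    · rintro ⟨-, h1, h2⟩; omega
    · exact False.elim
  · rw [DictState.setSet_set_of_ne _ (by decide), hi.current]
    congr 1
    ext v
    simp only [todoNodes, Finset.mem_filter, mem_lowNodes, mem_level, Finset.mem_univ, true_and]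
    omega
  · rw [DictState.setSet_set_of_ne _ (by decide), hi.ready, eq_comm, nodes_eq_empty]
    ext v
    simp only [readyNodes, Finset.mem_filter, Finset.notMem_empty, iff_false, not_and]
    intro _ h1 h2
    -- If all children have height less than h, the node has height at most h; hence nothing is
    -- ready at the start of a round.
    have := (height_le_iff hG).2 fun c hc => mem_lowNodes.1 (h2 hc)
    omega
  · simpa using hi.deleted
  · simpa using hi.counters

/-- With no node of height h left, exactly the nodes of height at most h are deleted. By
`height_le_iff`, the ready nodes are then those of height exactly h + 1. -/
theorem Round.idle (hG : G.IsTree) {h : ℕ} (hr : Round G root adj h D a)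
    (ht : todoNodes G root h D = ∅) {a' : DictState} (hs : Std root a')
    (h1 : a'.set 1 = nodes (todoNodes G root h D ∪ readyNodes G root h D)) (h2 : a'.set 2 = ∅)
    (hd : ∀ d, d ≠ 1 → d ≠ 2 → a'.set d = a.set d) :
    D = lowNodes G root (h + 1) ∧ Idle G root adj ⟨h + 1, level G root h⟩ a' := by
  have hD : D = lowNodes G root (h + 1) := by
    ext v
    rw [mem_lowNodes]
    refine ⟨fun hv => Nat.lt_succ_of_le (hr.above v hv), fun hv => ?_⟩
    rcases Nat.lt_or_ge (height G root v) h with h3 | h3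
    · exact hr.below v h3
    · by_contra h4
      have : v ∈ todoNodes G root h D := by
        simp only [todoNodes, Finset.mem_filter, Finset.mem_univ, true_and]
        exact ⟨by omega, h4⟩
      rw [ht] at this
      exact Finset.notMem_empty v this
  refine ⟨hD, hs, ?_, ?_, h2, ?_, ?_⟩
  · rw [hd 0 (by decide) (by decide), hr.client]
    congr 1
    ext v
    simp only [doneNodes, hD, Finset.mem_filter, mem_lowNodes, mem_level, Finset.mem_univ, true_and]
    omega
  · rw [h1, ht, Finset.empty_union]
    congr 1
    ext v
    simp only [readyNodes, Finset.mem_filter, mem_level, Finset.mem_univ, true_and]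
    have : children G root v ⊆ D ↔ height G root v ≤ h + 1 := by
      rw [height_le_iff hG, hD]
      exact forall₂_congr fun c _ => mem_lowNodes
    rw [this]
    omega
  · rw [hd 3 (by decide) (by decide), hr.deleted, hD]
  · rw [hd 4 (by decide) (by decide), ← hD]; exact hr.counters

/-- The budget is the potential before the call, and what is left covers the potential after it. The
credit of 200 per ready node pays for `moveLoop`. -/
theorem nextProg_spec (hG : G.IsTree) (ha : IsAdjacencyList G adj) (hS : Setting P inp root adj)
    {x : View n} (hi : Idle G root adj x a) (hne : (level G root x.h).Nonempty)
    (hb : potential adj (lowNodes G root x.h) a ≤ b)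
    (hQ : ∀ a' b', Idle G root adj ⟨x.h + 1, level G root x.h⟩ a' →
      potential adj (lowNodes G root (x.h + 1)) a' ≤ b' → Q a' b') :
    DRuns P inp nextProg a b Q := by
  have hr := hi.round hG
  have htodo : todoNodes G root x.h (lowNodes G root x.h) ≠ ∅ := by
    obtain ⟨v, hv⟩ := hne
    rw [mem_level] at hv
    refine Finset.ne_empty_of_mem (a := v) ?_
    simp only [todoNodes, Finset.mem_filter, Finset.mem_univ, true_and, mem_lowNodes]
    omega
  -- A nonempty level contains an undeleted node, whose weight covers the constant overhead of the
  -- call.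
  have hpot : 2000 ≤ potential adj (lowNodes G root x.h) a := by
    obtain ⟨v, hv⟩ := hne
    rw [mem_level] at hv
    have hw := weight_insert (adj := adj) (D := lowNodes G root x.h) (u := v)
      (by rw [mem_lowNodes]; omega)
    unfold potential; omega
  apply DRuns.of_dwp
  refine ⟨by omega, ?_⟩
  change dwp P inp (.choice 4 1) (a.setSet 0 ∅) (b - 40)
    fun a' b' => dwp P inp (deleteLoop ;;; .choice 4 2 ;;; moveLoop) a' b' Q
  refine choice_spec hr.std hr.current ?_ fun y hy => ?_
  · omega
  refine deleteLoop_spec hG ha hS (hr.setReg y) (by simpa using hy) ?_ ?_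
  · rw [if_neg htodo]
    have : potential adj (lowNodes G root x.h) ((a.setSet 0 ∅).setReg 4 y) =
      potential adj (lowNodes G root x.h) a := by simp [potential]
    omega
  · intro D' a' b' hr' ht hb'
    have hcard : (a'.set 2).card = (readyNodes G root x.h D').card := by
      rw [hr'.ready, nodes, Finset.card_map]
    unfold potential at hb'
    change dwp P inp (.choice 4 2) a' b' fun a' b' => dwp P inp moveLoop a' b' Q
    refine choice_spec hr'.std hr'.ready ?_ fun y hy => ?_
    · omega
    refine moveLoop_spec hS (hr'.std.setReg y) hr'.current hr'.ready (by simpa using hy)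
      (by omega) fun a'' b'' hb'' e1 e2 e3 e4 => ?_
    obtain ⟨hD, hidle⟩ := hr'.idle hG ht e1 e2 e3 e4
    refine hQ a'' b'' hidle ?_
    unfold potential
    rw [e3, e4 4 (by decide) (by decide), ← hD, Finset.card_empty, DictState.setReg_set]
    omega

theorem initProg_spec (hG : G.IsTree) (ha : IsAdjacencyList G adj) (hS : Setting P inp root adj)
    (h0 : a.reg 0 = n) (hset : ∀ d, a.set d = ∅) (hb : 200 * n + 5 ≤ b)
    (hQ : ∀ a' b', Idle G root adj ⟨0, ∅⟩ a' → Q a' b') :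
    DRuns P inp initProg a b Q := by
  have hlt := hS.lt_two_pow
  have hol := hS.offset_le
  have o0 := P.small_lt (i := 0) (by norm_num)
  have o1 := P.small_lt (i := 1) (by norm_num)
  have o3 := P.small_lt (i := 3) (by norm_num)
  have hlow : lowNodes G root 0 = ∅ := by simp [lowNodes]
  apply DRuns.of_dwp
  refine ⟨by omega, o1, root, by rw [hS.inp_eq]; exact encode_root root adj, ?_⟩
  refine ⟨by omega, trivial, o3, ?_, by omega, o0, o0, by simp [BinOp.Fits, DictState.val], ?_⟩
  · simp [BinOp.Fits, DictState.val, h0]; omega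
  refine initLoop_spec hG ha hS (k := 0) (by omega)
    ⟨by simp [h0], by simp, by simp [DictState.val, BinOp.val, h0]⟩
    (by simp [DictState.val, BinOp.val]) ?_ ?_ (by omega) ?_
  · simp [hset, leavesBelow, nodes]
  · simp [CountersBelow, hset]
  · intro a' b' hb' e1 e2 e3 e4
    refine hQ a' b' ⟨e1, ?_, ?_, ?_, ?_, ?_⟩
    · rw [e4 0 (by decide) (by decide)]; exact hset 0
    · rw [e2]
      congr 1
      ext v
      simp only [leavesBelow, Finset.mem_filter, Finset.mem_univ, true_and, mem_level, v.isLt]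
      rw [← Nat.le_zero, height_le_iff hG, Finset.eq_empty_iff_forall_notMem]
      simp
    · rw [e4 2 (by decide) (by decide)]; exact hset 2
    · rw [e4 3 (by decide) (by decide), hlow]; exact hset 3
    · rw [hlow]; exact e3.counters

end

end HeightIterator


/-! ### Sessions -/

namespace HeightIterator

open WordRAM DictMachine RootedTree

section

variable {w B n : ℕ} {P : Params w B} {inp : List (BitVec w)} {G : SimpleGraph (Fin n)}
  {root : Fin n} {adj : Fin n → List (Fin n)} {a : DictState} {b : ℕ}

theorem _root_.DictMachine.Rel.regs_up {σ : State 25 20 w} (h : Rel P σ a) (i : Fin 12) :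
    σ.regs (up i) = BitVec.ofNat w (a.reg i) := by
  obtain ⟨ν, h1, h2⟩ := h
  rw [← h2.user, ← h1.reg, BitVec.ofNat_toNat, BitVec.setWidth_eq]

/-- The value returned by `choice` is below n exactly if the current level is nonempty. The sets are
recorded as unchanged because the potential depends on them. -/
theorem hasNextProg_spec {x : View n} (hi : Idle G root adj x a) :
    DRuns P inp hasNextProg a 100 fun a' _ => Idle G root adj x a' ∧
      CorrectAnswer G root x .hasNext (BitVec.ofNat w (a'.reg 3)) ∧ a'.set = a.set := by
  have h0 := P.small_lt (i := 0) (by norm_num)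
  have h1 := P.small_lt (i := 1) (by norm_num)
  apply DRuns.of_dwp
  rw [hasNextProg, dwp]
  refine choice_spec hi.std hi.current (by norm_num) fun y hy => ?_
  refine ⟨by norm_num, trivial, trivial, fun hc => ?_, fun hc => ?_⟩
  · refine ⟨by norm_num, h1, h0, by simpa [BinOp.Fits, DictState.val] using h1,
      (hi.setReg y).setReg _, Or.inl ⟨?_, ?_⟩, rfl⟩
    · rcases hy with ⟨u, hu, -⟩ | ⟨-, hy⟩
      · exact ⟨u, hu⟩
      · simp [Cmp.HoldsNat, DictState.val, hi.std.size, hy] at hc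
    · simp [BinOp.val, DictState.val]
  · refine ⟨by norm_num, h0, h0, by simp [BinOp.Fits, DictState.val],
      (hi.setReg y).setReg _, Or.inr ⟨?_, ?_⟩, rfl⟩
    · rcases hy with ⟨u, -, hy⟩ | ⟨hy, -⟩
      · simp [Cmp.HoldsNat, DictState.val, hi.std.size, hy] at hc
      · rw [hy]; exact Finset.not_nonempty_empty
    · simp [BinOp.val, DictState.val]

theorem containsProg_spec (hS : Setting P inp root adj) {x : View n} (hi : Idle G root adj x a)
    {v : Fin n} (hv : a.reg 2 = v) :
    DRuns P inp containsProg a 100 fun a' _ => Idle G root adj x a' ∧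
      CorrectAnswer G root x (.contains v) (BitVec.ofNat w (a'.reg 3)) ∧ a'.set = a.set := by
  have hUl := hS.U_le
  have h0 := P.small_lt (i := 0) (by norm_num)
  have h1 := P.small_lt (i := 1) (by norm_num)
  apply DRuns.of_dwp
  refine ⟨by norm_num, by omega, fun hm => ?_, fun hm => ?_⟩
  · rw [hi.client, hv, coe_mem_nodes] at hm
    exact ⟨by norm_num, h1, h0, by simpa [BinOp.Fits, DictState.val] using h1,
      hi.setReg _, Or.inl ⟨hm, by simp [BinOp.val, DictState.val]⟩, rfl⟩
  · rw [hi.client, hv, coe_mem_nodes] at hm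
    exact ⟨by norm_num, h0, h0, by simp [BinOp.Fits, DictState.val],
      hi.setReg _, Or.inr ⟨hm, by simp [BinOp.val, DictState.val]⟩, rfl⟩

/-- The state after the client has passed the argument of a call. -/
def passed (a : DictState) : Call n → DictState
  | .add v => a.setReg 2 v
  | .remove v => a.setReg 2 v
  | .contains v => a.setReg 2 v
  | _ => a

theorem rel_pass (hS : Setting P inp root adj) {σ : State 25 20 w} (hσ : Rel P σ a) (c : Call n) :
    Rel P (impl.pass σ c) (passed a c) := by
  have hlt := hS.lt_two_pow
  have key : ∀ v : Fin n, Rel P (σ.setReg (up 2) (BitVec.ofNat w v)) (a.setReg 2 v) := by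
    intro v
    have h := hσ.setReg 2 (BitVec.ofNat w v)
    rwa [BitVec.toNat_ofNat, Nat.mod_eq_of_lt (by omega)] at h
  cases c
  case add v => exact key v
  case remove v => exact key v
  case contains v => exact key v
  all_goals exact hσ

/-- Every call is answered correctly. -/
theorem exists_exec (hG : G.IsTree) (ha : IsAdjacencyList G adj) (hS : Setting P inp root adj)
    {x : View n} {c : Call n} (hc : Permitted G root x c) {σ : State 25 20 w} (hσ : Rel P σ a)
    (hi : Idle G root adj x a) :
    ∃ σ' t a', Exec inp B (impl.prog c) (impl.pass σ c) σ' t ∧ Rel P σ' a' ∧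
      Idle G root adj (x.after G root c) a' ∧ CorrectAnswer G root x c (σ'.regs (up 3)) ∧
      (c ≠ .next → t ≤ 100) ∧
      (if c = .next then t else 0) + potential adj (lowNodes G root (x.after G root c).h) a' ≤
        potential adj (lowNodes G root x.h) a := by
  have hUl := hS.U_le
  have hp := rel_pass hS hσ c
  by_cases hnext : c = .next
  · subst hnext
    obtain ⟨σ', t, a', b', h1, h2, h3, h4, h5⟩ := nextProg_spec hG ha hS hi hc le_rfl
      (Q := fun a' b' => Idle G root adj ⟨x.h + 1, level G root x.h⟩ a' ∧
        potential adj (lowNodes G root (x.h + 1)) a' ≤ b') (fun _ _ h h' => ⟨h, h'⟩) σ hσ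
    refine ⟨σ', t, a', h1, h2, h4, trivial, fun h => absurd rfl h, ?_⟩
    rw [if_pos rfl]
    exact (Nat.add_le_add_left h5 t).trans h3
  -- All other calls take at most 100 steps and leave the dictionaries 2 and 4 alone, hence also the
  -- potential.
  suffices h : ∃ p : DictProg, p.compile = impl.prog c ∧ (x.after G root c).h = x.h ∧
      DRuns P inp p (passed a c) 100 fun a' _ => Idle G root adj (x.after G root c) a' ∧
        CorrectAnswer G root x c (BitVec.ofNat w (a'.reg 3)) ∧ a'.set 2 = a.set 2 ∧
          a'.set 4 = a.set 4 by
    obtain ⟨p, hpc, hh, hr⟩ := h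
    obtain ⟨σ', t, a', b', h1, h2, h3, h4, h5, h6, h7⟩ := hr _ hp
    rw [hpc] at h1
    refine ⟨σ', t, a', h1, h2, h4, by rw [h2.regs_up]; exact h5, fun _ => by omega, ?_⟩
    rw [if_neg hnext, zero_add, hh]
    unfold potential
    rw [h6, h7]
  cases c with
  | hasNext =>
    exact ⟨_, rfl, rfl, (hasNextProg_spec hi).mono fun a' _ h =>
      ⟨h.1, h.2.1, by rw [h.2.2], by rw [h.2.2]⟩⟩
  | next => exact absurd rfl hnext
  | add v =>
    refine ⟨_, rfl, rfl, DRuns.of_dwp ⟨by norm_num, ?_, ?_, trivial, rfl, rfl⟩⟩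
    · simp [passed]; omega
    · have := (hi.setReg (i := 2) v).setClient (insert v x.S)
      rw [nodes_insert, ← hi.client] at this
      simpa [passed, View.after] using this
  | remove v =>
    refine ⟨_, rfl, rfl, DRuns.of_dwp ⟨by norm_num, ?_, ?_, trivial, rfl, rfl⟩⟩
    · simp [passed]; omega
    · have := (hi.setReg (i := 2) v).setClient (x.S.erase v)
      rw [nodes_erase, ← hi.client] at this
      simpa [passed, View.after] using this
  | contains v =>
    exact ⟨_, rfl, rfl, (containsProg_spec hS (hi.setReg (i := 2) v)
      (by simp)).mono fun a' _ h => ⟨h.1, h.2.1, by rw [h.2.2]; rfl, by rw [h.2.2]; rfl⟩⟩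
  | choice =>
    refine ⟨_, rfl, rfl, DRuns.of_dwp (choice_spec hi.std hi.client (by norm_num)
      fun y hy => ⟨hi.setReg y, ?_, rfl, rfl⟩)⟩
    rw [DictState.setReg_reg_self]
    rcases hy with ⟨u, hu, rfl⟩ | ⟨h, rfl⟩
    · exact Or.inl ⟨u, hu, rfl⟩
    · exact Or.inr ⟨h, rfl⟩
  | clear =>
    refine ⟨_, rfl, rfl, DRuns.of_dwp ⟨by norm_num, ?_, trivial, rfl, rfl⟩⟩
    exact hi.setClient ∅

/-- Telescoping: the steps of each `next` are at most the drop of the potential, and the other calls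
do not change it. -/
theorem exists_session (hG : G.IsTree) (ha : IsAdjacencyList G adj) (hS : Setting P inp root adj)
    {x : View n} {calls : List (Call n)} (hc : AllPermitted G root x calls) {σ : State 25 20 w}
    (hσ : Rel P σ a) (hi : Idle G root adj x a) :
    ∃ events : List (Event n w), events.map (fun e => e.call) = calls ∧
      Session impl inp B σ events ∧ AllCorrect G root x events ∧
      (∀ e ∈ events, e.call ≠ .next → e.time ≤ 100) ∧
      ((events.filter fun e => e.call = .next).map fun e => e.time).sum ≤
        potential adj (lowNodes G root x.h) a := by
  induction calls generalizing x σ a with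
  | nil => exact ⟨[], rfl, Session.nil (I := impl) σ, trivial, by simp, by simp⟩
  | cons c cs ih =>
    obtain ⟨σ', t, a', h1, h2, h3, h4, h5, h6⟩ := exists_exec hG ha hS hc.1 hσ hi
    obtain ⟨es, e1, e2, e3, e4, e5⟩ := ih hc.2 h2 h3
    refine ⟨⟨c, σ'.regs (up 3), t⟩ :: es, by simp [e1], .cons h1 e2, ⟨h4, e3⟩, ?_, ?_⟩
    · rintro e he hne
      rcases List.mem_cons.1 he with rfl | he
      · exact h5 hne
      · exact e4 e he hne
    · by_cases h : c = .next
      · rw [if_pos h] at h6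
        simp only [List.filter_cons, h, decide_true, if_true, List.map_cons, List.sum_cons]
        exact (Nat.add_le_add_left e5 t).trans h6
      · rw [if_neg h, zero_add] at h6
        simp only [List.filter_cons, h, decide_false]
        exact e5.trans h6

/-- Already 4 * w ≤ 2 ^ w fails for w = 1, 2, 3. The dictionaries need words of at least four bits.
-/
theorem four_le_of_mul_le (hn : 1 ≤ n) (hw : 0 < w) (h : (3 * n + 1) * w ≤ 2 ^ w) : 4 ≤ w := by
  by_contra h4
  have h5 : 4 * w ≤ (3 * n + 1) * w := Nat.mul_le_mul_right w (by omega)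
  interval_cases w <;> norm_num at * <;> omega

theorem setting_mkParams (hG : G.IsTree) (ha : IsAdjacencyList G adj) (hn : 1 ≤ n) (hw : 4 ≤ w)
    (hnw : 2 * n + w < 2 ^ w) (hlt : 3 * n + 1 < 2 ^ w) :
    Setting (mkParams n w hn hw hnw) (inputWords w root adj) root adj := by
  have hsum := sum_length_adj hG ha
  rw [← offset_eq_sum] at hsum
  refine ⟨map_toNat_inputWords fun x hx => ?_, by omega, by omega, le_mkParams_U n w hn hw hnw⟩
  have := le_of_mem_encode hx
  omega

/-- By `sum_length_adj`, the neighbor lists contribute less than 100 * n, the nodes 2000 * n and the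
zeros of the counters less than 200 * n. -/
theorem potential_lowNodes_zero_le (hG : G.IsTree) (ha : IsAdjacencyList G adj)
    (h2 : a.set 2 = ∅) : potential adj (lowNodes G root 0) a ≤ 3000 * n := by
  have hsum := sum_length_adj hG ha
  have hlow : lowNodes G root 0 = ∅ := by simp [lowNodes]
  rw [hlow]
  unfold potential weight
  rw [h2, Finset.card_empty, offset_eq_sum, Finset.compl_empty, Finset.sum_add_distrib,
    ← Finset.mul_sum]
  simp only [Finset.sum_const, Finset.card_univ, Fintype.card_fin, smul_eq_mul]
  omega

/-- The initialization takes linear time. -/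
theorem exists_init (hG : G.IsTree) (ha : IsAdjacencyList G adj) (hn : 1 ≤ n) (hw : 4 ≤ w)
    (hnw : 2 * n + w < 2 ^ w) (hlt : 3 * n + 1 < 2 ^ w) (σ₀ : State 25 20 w) :
    ∃ σ₁ t a, Exec (inputWords w root adj) (numWords n w) impl.init σ₀ σ₁ t ∧ t ≤ 3000 * n ∧
      Rel (mkParams n w hn hw hnw) σ₁ a ∧ Idle G root adj ⟨0, ∅⟩ a := by
  have hS : Setting _ (inputWords w root adj) root adj :=
    setting_mkParams hG ha hn hw hnw hlt
  -- Any initial content is represented by some numbers; nothing is assumed about it.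
  have hσ₀ : Represents σ₀ ⟨fun i => (σ₀.regs i).toNat,
      fun b x => (σ₀.mem b (BitVec.ofNat w x)).toNat⟩ :=
    ⟨fun _ => rfl, fun b x => by simp⟩
  obtain ⟨σ, t, ν, b, h1, h2, h3, h4, h5, h6⟩ := setupProg_spec hn hw hnw
    (by rw [hS.inp_eq]; exact encode_zero root adj) (le_refl (9 * n + 250 + 0)) σ₀ hσ₀
  obtain ⟨σ', t', a', b', g1, g2, g3, g4⟩ := initProg_spec hG ha hS (Q := fun a _ =>
    Idle G root adj ⟨0, ∅⟩ a) h5 (fun _ => rfl) le_rfl (fun _ _ h => h) σ ⟨ν, h2, h6⟩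
  exact ⟨σ', t + t', a', .seq h1 g1, by omega, g2, g4⟩

end

end HeightIterator

/-! ### The main theorem -/

theorem mainTheorem7 :
    ∃ (I : HeightIterator.Impl) (C : ℕ),
      ∀ (n : ℕ) (G : SimpleGraph (Fin n)) (root : Fin n) (adj : Fin n → List (Fin n)),
        G.IsTree → RootedTree.IsAdjacencyList G adj →
      ∀ w : ℕ, 0 < w → (RootedTree.encode root adj).length * w ≤ 2 ^ w →
      ∃ B : ℕ, (I.r + I.k * B) * w ≤ C * (n + w) ∧
      ∀ σ₀ : WordRAM.State I.r I.k w,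
      ∃ (σ₁ : WordRAM.State I.r I.k w) (t₀ : ℕ),
        WordRAM.Exec (RootedTree.inputWords w root adj) B I.init σ₀ σ₁ t₀ ∧
        t₀ ≤ C * n ∧
        ∀ calls : List (HeightIterator.Call n),
          HeightIterator.AllPermitted G root ⟨0, ∅⟩ calls →
          ∃ events : List (HeightIterator.Event n w),
            events.map (fun e => e.call) = calls ∧
            HeightIterator.Session I (RootedTree.inputWords w root adj) B σ₁ events ∧
            HeightIterator.AllCorrect G root ⟨0, ∅⟩ events ∧
            (∀ e ∈ events, e.call ≠ HeightIterator.Call.next → e.time ≤ C) ∧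
            ((events.filter fun e => e.call = HeightIterator.Call.next).map
              fun e => e.time).sum ≤ C * n := by
  refine ⟨HeightIterator.impl, 3000, fun n G root adj hG ha w hw hle => ?_⟩
  have hn : 1 ≤ n := by have := root.isLt; omega
  -- The header and the n + 1 offsets make n + 3 words, the neighbor lists 2 * n - 2. With this the
  -- bound on w yields all size conditions below.
  have hlen : (RootedTree.encode root adj).length = 3 * n + 1 := by
    have hsum := RootedTree.sum_length_adj hG ha
    rw [RootedTree.length_encode, RootedTree.offset_eq_sum]
    omega
  rw [hlen] at hle
  have hw4 := HeightIterator.four_le_of_mul_le hn hw hle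
  have hnw : 2 * n + w < 2 ^ w := by nlinarith
  have hlt : 3 * n + 1 < 2 ^ w := by nlinarith
  refine ⟨DictMachine.numWords n w, ?_, fun σ₀ => ?_⟩
  · have hB := DictMachine.numWords_mul_le hn hw
    change (25 + 20 * DictMachine.numWords n w) * w ≤ 3000 * (n + w)
    rw [add_mul, mul_assoc]
    omega
  · obtain ⟨σ₁, t₀, a, h1, h2, h3, h4⟩ := HeightIterator.exists_init hG ha hn hw4 hnw hlt σ₀
    refine ⟨σ₁, t₀, h1, h2, fun calls hcalls => ?_⟩
    obtain ⟨events, e1, e2, e3, e4, e5⟩ := HeightIterator.exists_session hG ha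
      (HeightIterator.setting_mkParams hG ha hn hw4 hnw hlt) hcalls h3 h4
    exact ⟨events, e1, e2, e3, fun e he hne => (e4 e he hne).trans (by norm_num),
      e5.trans (HeightIterator.potential_lowNodes_zero_le hG ha h4.ready)⟩
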